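/- Let $n\ge 1$, and let $G=\mathrm{Sp}(n)\times\mathrm{Sp}(1)$ act on the unit sphere $S^{4n-1}\subset\mathbb H^n$ by $(A,z)\cdot v=Avz^{-1}$ (the action factors through $\mathrm{Sp}(n)\mathrm{Sp}(1)=G/\{\pm(\mathrm{Id},1)\}$). Let $H\cong\mathrm{Sp}(n-1)\times\mathrm{Sp}(1)$ be the stabilizer of $(1,0,\dots,0)$, with Lie algebra $\mathfrak h=\mathfrak{sp}(n-1)\oplus\mathfrak{sp}(1)$, where $\mathfrak{sp}(n-1)=\{(X,0)\in\mathfrak h\}$ and $\mathfrak{sp}(1)=\{(\zeta F_{1,1},\zeta)\}$. Here $E_{p,q}$ is the skew-symmetric matrix with $-1$ at $(p,q)$ and $1$ at $(q,p)$, $F_{p,q}$ ($p\neq q$) is the symmetric matrix with $1$ at $(p,q)$ and $(q,p)$, and $F_{p,p}$ has a single $1$ at $(p,p)$. Let $\kappa((X,\zeta),(X',\zeta'))=4(n+1)\,\mathrm{Re}\,\mathrm{tr}(XX')+8\,\mathrm{Re}(\zeta\zeta')$ be the Killing form of $\mathfrak{sp}(n)\oplus\mathfrak{sp}(1)$ and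 $\mathfrak m=\mathfrak h^{\perp_\kappa}=\mathfrak m_1\oplus\mathfrak m_2$ with $\mathfrak m_1=\{(xF_{1,1},-\tfrac{n+1}{2}x):x\in\mathrm{Im}\,\mathbb H\}$ and $\mathfrak m_2=\{(X,0)\in\mathfrak m: X_{11}=0\}$. For $a,b>0$ put $g_{a,b}=-a\kappa|_{\mathfrak m_1\times\mathfrak m_1}-b\kappa|_{\mathfrak m_2\times\mathfrak m_2}$ and, with $\Omega=\sqrt{2a(n+1)(n+3)}$ and $c=\frac1{2\sqrt{2b(n+1)}}$, $$e_1=\tfrac1\Omega(iF_{1,1},-\tfrac{n+1}2i),\quad e_2=\tfrac1\Omega(-kF_{1,1},\tfrac{n+1}2k),\quad e_3=\tfrac1\Omega(jF_{1,1},-\tfrac{n+1}2j),$$ $$e_{4p}=c\,(jF_{1,p+1},0),\ e_{4p+1}=c\,(kF_{1,p+1},0),\ e_{4p+2}=c\,(iF_{1,p+1},0),\ e_{4p+3}=c\,(E_{1,p+1},0)\quad(1\le p\le n-1).$$ Let $\Sigma=\Lambda^\bullet L'$, where $L'$ is the complex vector space with basis $y_1,\dots,y_{2n-1}$, and let $\mathfrak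 m$ act on $\Sigma$ by Clifford multiplication ($vw+wv=-2g_{a,b}(v,w)$) through $e_1=i\,\mathrm{Id}$ on $\Sigma^{\mathrm{even}}$, $e_1=-i\,\mathrm{Id}$ on $\Sigma^{\mathrm{odd}}$, $e_{2j}\cdot\eta=i(x_j\lrcorner\eta+y_j\wedge\eta)$, $e_{2j+1}\cdot\eta=y_j\wedge\eta-x_j\lrcorner\eta$, where $(x_j)$ is the basis dual to $(y_j)$. Put $\omega=\sum_{i=1}^{n-1}y_{2i}\wedge y_{2i+1}$. Let $\mathfrak h_{\mathbb C}=\mathfrak{sp}_{\mathbb C}(2n-2)\oplus\mathfrak{sp}_{\mathbb C}(2)$ be the complexification of $\mathfrak h$, acting on $\Sigma$ through $\mathfrak h\xrightarrow{\mathrm{ad}}\mathfrak{so}(\mathfrak m)\cong\mathfrak{spin}(\mathfrak m)\subset\mathrm{Cl}(\mathfrak m)$. The $G$-invariant Riemannian metrics on $S^{4n-1}=G/H$, that is, the $\mathrm{Ad}(H)$-invariant inner products on $\mathfrak m$, are exactly the $g_{a,b}$ with $a,b>0$; and for all $a,b>0$ the following hold. 1. $e_1,\dots,e_{4n-1}$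 is a $g_{a,b}$-orthonormal basis of $\mathfrak m$, and $\Sigma$ is a representation of $\mathfrak h_{\mathbb C}$. 2. As a representation of $\mathfrak{sp}_{\mathbb C}(2)$, the space $\Sigma^{\mathfrak{sp}_{\mathbb C}(2n-2)}$ is the direct sum of irreducible representations of dimensions $n+1$ and $n-1$ (the second summand being zero if $n=1$). 3. The space $\Sigma^{\mathfrak h_{\mathbb C}}$ is zero if $n\ne2$. If $n=2$, it is $1$-dimensional and contained in the span of $y_1$ and $\omega$. 4. For every lift $\rho\colon H\to\mathrm{Spin}(\mathfrak m)$ of the isotropy representation, the space of invariant spinors, that is, of maps $\varphi\colon G\to\Sigma$ with $\varphi(gh)=\rho(h^{-1})\cdot\varphi(g)$ and $\varphi(g^{-1}g')=\varphi(g')$ for all $g,g'\in G$, $h\in H$, is zero if $n\neq 2$. If $n=2$, it is $1$-dimensional, and its elements take values in the span of $y_1$ and $\omega$. -/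

import Mathlib

open scoped Quaternion TensorProduct

attribute [local instance 100] LieRing.ofAssociativeRing

namespace SpSphere

/-!
Throughout `N = n - 1`, so that the sphere is `S^{4n-1} ⊆ ℍ^n` with `n = N + 1`.  The coordinates
of `ℍ^n` are indexed by `Fin (N + 1)`; the first one has index `0` and the index `p + 1` of a
coordinate is `p.succ` with `p : Fin N`.
-/

/-- Quaternionic `n × n` matrices. -/
abbrev HMat (N : ℕ) : Type := Matrix (Fin (N + 1)) (Fin (N + 1)) ℍ[ℝ]

/-- The associative algebra `Mat_n(ℍ) × ℍ` in which the group and its Lie algebra live. -/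
abbrev Amb (N : ℕ) : Type := HMat N × ℍ[ℝ]

/-! ### The homogeneous space -/

/-- The group `Sp(n) × Sp(1)`; it acts on the sphere through its quotient `Sp(n)Sp(1)` by `±1`. -/
abbrev G (N : ℕ) : Type := unitary (HMat N) × unitary ℍ[ℝ]

/-- The unit sphere `S^{4n-1}` in `ℍ^n`. -/
def Sphere (N : ℕ) : Type := {v : Fin (N + 1) → ℍ[ℝ] // star v ⬝ᵥ v = 1}

lemma act_mem {N : ℕ} (g : G N) (v : Sphere N) :
    star (fun i => ((g.1 : HMat N).mulVec v.1) i * star (g.2 : ℍ[ℝ])) ⬝ᵥ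
      (fun i => ((g.1 : HMat N).mulVec v.1) i * star (g.2 : ℍ[ℝ])) = 1 := by
  have h1 : star ((g.1 : HMat N).mulVec v.1) ⬝ᵥ ((g.1 : HMat N).mulVec v.1) = 1 := by
    rw [Matrix.star_mulVec, Matrix.dotProduct_mulVec, Matrix.vecMul_vecMul,
      ← Matrix.star_eq_conjTranspose, Unitary.coe_star_mul_self, Matrix.vecMul_one]
    exact v.2
  have h2 : (g.2 : ℍ[ℝ]) * star (g.2 : ℍ[ℝ]) = 1 := Unitary.coe_mul_star_self g.2
  simp only [dotProduct, Pi.star_apply, star_mul, star_star] at h1 ⊢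
  calc _ = (g.2 : ℍ[ℝ]) * (∑ i, star (((g.1 : HMat N).mulVec v.1) i) *
        ((g.1 : HMat N).mulVec v.1) i) * star (g.2 : ℍ[ℝ]) := by
        rw [Finset.mul_sum, Finset.sum_mul]; simp only [mul_assoc]
    _ = 1 := by rw [h1, mul_one, h2]

/-- The action `(A, z) • v = A v z⁻¹` (and `z⁻¹ = star z` for a unit quaternion). -/
noncomputable instance (N : ℕ) : MulAction (G N) (Sphere N) where
  smul g v := ⟨fun i => ((g.1 : HMat N).mulVec v.1) i * star (g.2 : ℍ[ℝ]), act_mem g v⟩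
  one_smul v := by
    apply Subtype.ext
    funext i
    change ((1 : HMat N).mulVec v.1) i * star (1 : ℍ[ℝ]) = v.1 i
    simp
  mul_smul g h v := by
    apply Subtype.ext
    funext i
    change (((g.1 : HMat N) * (h.1 : HMat N)).mulVec v.1) i * star ((g.2 : ℍ[ℝ]) * (h.2 : ℍ[ℝ])) =
      ((g.1 : HMat N).mulVec (fun k => ((h.1 : HMat N).mulVec v.1) k * star (h.2 : ℍ[ℝ]))) i *
        star (g.2 : ℍ[ℝ])
    rw [← Matrix.mulVec_mulVec, star_mul, ← mul_assoc]
    congr 1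
    simp only [Matrix.mulVec, dotProduct, Finset.sum_mul, mul_assoc]

/-- The base point `(1, 0, …, 0)`. -/
noncomputable def basePoint (N : ℕ) : Sphere N := ⟨Pi.single 0 1, by
  rw [dotProduct_single_one]; simp⟩

/-- The isotropy group `H = Sp(n-1)Sp(1)`, that is, the stabilizer of `(1, 0, …, 0)`. -/
noncomputable def H (N : ℕ) : Subgroup (G N) := MulAction.stabilizer (G N) (basePoint N)

/-- The pair `(A, z)` as an element of `Mat_n(ℍ) × ℍ`. -/
def toAmb {N : ℕ} (g : G N) : Amb N := ((g.1 : HMat N), (g.2 : ℍ[ℝ]))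

/-- For `T = (X, ζ)`: the first column of `X` is `(ζ, 0, …, 0)`, that is, `X e₁ = e₁ ζ`. -/
def FixesAxis {N : ℕ} (T : Amb N) : Prop := ∀ i, T.1 i 0 = if i = 0 then T.2 else 0

lemma FixesAxis.mul {N : ℕ} {S T : Amb N} (hS : FixesAxis S) (hT : FixesAxis T) :
    FixesAxis (S * T) := by
  intro i
  simp only [Prod.fst_mul, Prod.snd_mul, Matrix.mul_apply, hT _]
  simp [hS i]

lemma toAmb_mul_star {N : ℕ} (g : G N) : toAmb g * star (toAmb g) = 1 :=
  Prod.ext (Unitary.coe_mul_star_self g.1) (Unitary.coe_mul_star_self g.2)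

lemma star_mul_toAmb {N : ℕ} (g : G N) : star (toAmb g) * toAmb g = 1 :=
  Prod.ext (Unitary.coe_star_mul_self g.1) (Unitary.coe_star_mul_self g.2)

lemma fixesAxis_of_mem {N : ℕ} {g : G N} (hg : g ∈ H N) : FixesAxis (toAmb g) := by
  intro i
  have h := congrArg (fun v : Sphere N => v.1 i * (g.2 : ℍ[ℝ])) (MulAction.mem_stabilizer_iff.1 hg)
  change ((g.1 : HMat N).mulVec (Pi.single 0 1)) i * star (g.2 : ℍ[ℝ]) * (g.2 : ℍ[ℝ]) =
    (Pi.single 0 1 : Fin (N + 1) → ℍ[ℝ]) i * (g.2 : ℍ[ℝ]) at h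
  rw [mul_assoc, Unitary.coe_star_mul_self, mul_one, Matrix.mulVec_single_one] at h
  change (g.1 : HMat N) i 0 = if i = 0 then (g.2 : ℍ[ℝ]) else 0
  have h' : (g.1 : HMat N) i 0 = (Pi.single 0 1 : Fin (N + 1) → ℍ[ℝ]) i * (g.2 : ℍ[ℝ]) := h
  rw [h']
  by_cases hi : i = 0
  · subst hi; simp
  · simp [hi]

lemma toAmb_inv {N : ℕ} (g : G N) : toAmb g⁻¹ = star (toAmb g) := rfl

/-! ### Lie algebras, the Killing form and the reductive complement -/

lemma star_smul_amb {N : ℕ} (r : ℝ) (T : Amb N) : star (r • T) = r • star T := by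
  refine Prod.ext ?_ (by simp)
  ext i j <;> simp [Matrix.star_apply]

/-- The isotropy algebra `𝔥 = 𝔰𝔭(n-1) ⊕ 𝔰𝔭(1)`: the skew-Hermitian pairs `(X, ζ)` in
`𝔤 = 𝔰𝔭(n) ⊕ 𝔰𝔭(1)` with `X e₁ = e₁ ζ`. -/
def isoAlg (N : ℕ) : LieSubalgebra ℝ (Amb N) where
  carrier := {T | star T = -T ∧ FixesAxis T}
  add_mem' := by
    rintro S T ⟨hS, hS'⟩ ⟨hT, hT'⟩
    refine ⟨by rw [star_add, hS, hT, neg_add], fun i => ?_⟩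
    simp only [Prod.fst_add, Prod.snd_add, Matrix.add_apply, hS' i, hT' i]
    split_ifs <;> simp
  zero_mem' := ⟨by simp, fun i => by simp⟩
  smul_mem' := by
    rintro r T ⟨hT, hT'⟩
    refine ⟨by rw [star_smul_amb, hT, smul_neg], fun i => ?_⟩
    simp only [Prod.smul_fst, Prod.smul_snd, Matrix.smul_apply, hT' i]
    split_ifs <;> simp
  lie_mem' := by
    rintro S T ⟨hS, hS'⟩ ⟨hT, hT'⟩
    refine ⟨?_, fun i => ?_⟩
    · rw [LieRing.of_associative_ring_bracket, star_sub, star_mul, star_mul, hS, hT]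
      simp
    · have h1 := hS'.mul hT' i
      have h2 := hT'.mul hS' i
      rw [LieRing.of_associative_ring_bracket]
      simp only [Prod.fst_sub, Prod.snd_sub, Matrix.sub_apply, h1, h2]
      split_ifs <;> simp

/-- The summand `𝔰𝔭(n-1)` of `𝔥`: the pairs `(X, 0)`. -/
def spLower (N : ℕ) : Submodule ℝ (isoAlg N) where
  carrier := {T | (T : Amb N).2 = 0}
  add_mem' := by
    intro S T hS hT
    change (S : Amb N).2 + (T : Amb N).2 = 0
    rw [show (S : Amb N).2 = 0 from hS, show (T : Amb N).2 = 0 from hT, add_zero]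
  zero_mem' := rfl
  smul_mem' := by
    intro r T hT
    change r • (T : Amb N).2 = 0
    rw [show (T : Amb N).2 = 0 from hT, smul_zero]

/-- The diagonally embedded summand `𝔰𝔭(1)` of `𝔥`: the pairs `(ζ F₁₁, ζ)`. -/
def spDiag (N : ℕ) : Submodule ℝ (isoAlg N) where
  carrier := {T | (T : Amb N).1 = Matrix.single 0 0 (T : Amb N).2}
  add_mem' := by
    intro S T hS hT
    change (S : Amb N).1 + (T : Amb N).1 = Matrix.single 0 0 ((S : Amb N).2 + (T : Amb N).2)
    rw [Matrix.single_add, ← show (S : Amb N).1 = _ from hS, ← show (T : Amb N).1 = _ from hT]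
  zero_mem' := by
    change (0 : HMat N) = Matrix.single 0 0 0
    simp
  smul_mem' := by
    intro r T hT
    change r • (T : Amb N).1 = Matrix.single 0 0 (r • (T : Amb N).2)
    rw [← Matrix.smul_single, ← show (T : Amb N).1 = _ from hT]

/-- `B₀(X, Y) = - Re tr (X Y)`. -/
noncomputable def B₀ {N : ℕ} (X Y : HMat N) : ℝ := -((X * Y).trace).re

lemma B₀_eq {N : ℕ} (X Y : HMat N) : B₀ X Y = -∑ i, ∑ j, (X i j * Y j i).re := by
  have key : ∀ q : Fin (N + 1) → ℍ[ℝ], (∑ i, q i).re = ∑ i, (q i).re := fun q =>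
    map_sum (AddMonoidHom.mk' (fun x : ℍ[ℝ] => x.re) fun _ _ => rfl) q Finset.univ
  simp only [B₀, Matrix.trace, Matrix.diag, Matrix.mul_apply, key]

lemma quat_re_mul_comm (x y : ℍ[ℝ]) : (x * y).re = (y * x).re := by
  simp only [Quaternion.re_mul]; ring

lemma B₀_comm {N : ℕ} (X Y : HMat N) : B₀ X Y = B₀ Y X := by
  rw [B₀_eq, B₀_eq, Finset.sum_comm]
  simp only [quat_re_mul_comm]

/-- The Killing form `κ((X,ζ),(X',ζ')) = -4(n+1) B₀(X,X') + 8 Re(ζζ')` of `𝔰𝔭(n) ⊕ 𝔰𝔭(1)`. -/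
noncomputable def κ (N : ℕ) : LinearMap.BilinForm ℝ (Amb N) :=
  LinearMap.mk₂ ℝ
    (fun S T => -4 * (((N + 1 : ℕ) : ℝ) + 1) * B₀ S.1 T.1 + 8 * (S.2 * T.2).re)
    (by intro S S' T; simp [B₀, add_mul]; ring)
    (by intro r S T; simp [B₀]; ring)
    (by intro S T T'; simp [B₀, mul_add]; ring)
    (by intro r S T; simp [B₀]; ring)

lemma κ_apply {N : ℕ} (S T : Amb N) :
    κ N S T = -4 * (((N + 1 : ℕ) : ℝ) + 1) * B₀ S.1 T.1 + 8 * (S.2 * T.2).re := rfl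

lemma κ_cyclic {N : ℕ} (S T U : Amb N) : κ N (S * T) U = κ N T (U * S) := by
  have h : B₀ (S.1 * T.1) U.1 = B₀ T.1 (U.1 * S.1) := by
    rw [B₀_comm (S.1 * T.1), B₀_comm T.1]; simp only [B₀, mul_assoc]
  have h' : (S.2 * T.2 * U.2).re = (T.2 * (U.2 * S.2)).re := by
    rw [mul_assoc, quat_re_mul_comm, mul_assoc]
  simp only [κ_apply, Prod.fst_mul, Prod.snd_mul, h, h']

/-- The reductive complement `𝔪 = 𝔥^⊥`, orthogonal with respect to the Killing form. -/
noncomputable def 𝔪 (N : ℕ) : Submodule ℝ (Amb N) where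
  carrier := {T | star T = -T ∧ ∀ S ∈ isoAlg N, κ N T S = 0}
  add_mem' := by
    rintro S T ⟨hS, hS'⟩ ⟨hT, hT'⟩
    refine ⟨by rw [star_add, hS, hT, neg_add], fun U hU => ?_⟩
    rw [map_add, LinearMap.add_apply, hS' U hU, hT' U hU, add_zero]
  zero_mem' := ⟨by simp, fun S _ => by simp⟩
  smul_mem' := by
    rintro r T ⟨hT, hT'⟩
    refine ⟨by rw [star_smul_amb, hT, smul_neg], fun U hU => ?_⟩
    rw [map_smul, LinearMap.smul_apply, hT' U hU, smul_zero]

lemma Ad_mem {N : ℕ} (h : H N) (T : 𝔪 N) :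
    toAmb (h : G N) * (T : Amb N) * star (toAmb (h : G N)) ∈ 𝔪 N := by
  refine ⟨?_, fun S hS => ?_⟩
  · simp only [star_mul, star_star, T.2.1]
    simp [mul_assoc]
  · have e1 : κ N (toAmb (h : G N) * (T : Amb N) * star (toAmb (h : G N))) S =
        κ N T (star (toAmb (h : G N)) * S * toAmb (h : G N)) := by
      rw [mul_assoc, κ_cyclic]
      have := κ_cyclic (star (toAmb (h : G N))) (S * toAmb (h : G N)) (T : Amb N)
      have sym : ∀ A B : Amb N, κ N A B = κ N B A := fun A B => by
        rw [κ_apply, κ_apply, B₀_comm, quat_re_mul_comm]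
      rw [sym, ← this, sym, mul_assoc]
    rw [e1]
    refine T.2.2 _ ⟨?_, ?_⟩
    · simp only [star_mul, star_star, hS.1]
      simp [mul_assoc]
    · have hinv : FixesAxis (star (toAmb (h : G N))) := by
        rw [← toAmb_inv]; exact fixesAxis_of_mem ((H N).inv_mem h.2)
      exact (hinv.mul hS.2).mul (fixesAxis_of_mem h.2)

/-- The isotropy representation `Ad|_H` of `H` on `𝔪`, by conjugation. -/
noncomputable def isotropy (N : ℕ) : H N →* Module.End ℝ (𝔪 N) where
  toFun h :=
    { toFun := fun T => ⟨toAmb (h : G N) * (T : Amb N) * star (toAmb (h : G N)), Ad_mem h T⟩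
      map_add' := fun S T => Subtype.ext (by simp [mul_add, add_mul])
      map_smul' := fun r T => Subtype.ext (by simp) }
  map_one' := by
    ext1 T
    apply Subtype.ext
    change (1 : Amb N) * (T : Amb N) * star (1 : Amb N) = T
    simp
  map_mul' g h := by
    ext1 T
    apply Subtype.ext
    change toAmb (g : G N) * toAmb (h : G N) * (T : Amb N) *
      star (toAmb (g : G N) * toAmb (h : G N)) =
      toAmb (g : G N) * (toAmb (h : G N) * (T : Amb N) * star (toAmb (h : G N))) *
        star (toAmb (g : G N))
    rw [star_mul]
    simp only [mul_assoc]

lemma ad_mem {N : ℕ} (S : isoAlg N) (T : 𝔪 N) : ⁅(S : Amb N), (T : Amb N)⁆ ∈ 𝔪 N := by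
  refine ⟨?_, fun U hU => ?_⟩
  · rw [LieRing.of_associative_ring_bracket, star_sub, star_mul, star_mul, S.2.1, T.2.1]
    simp
  · have sym : ∀ A B : Amb N, κ N A B = κ N B A := fun A B => by
      rw [κ_apply, κ_apply, B₀_comm, quat_re_mul_comm]
    have e1 : κ N ⁅(S : Amb N), (T : Amb N)⁆ U = κ N T ⁅U, (S : Amb N)⁆ := by
      rw [LieRing.of_associative_ring_bracket, LieRing.of_associative_ring_bracket, map_sub,
        map_sub, LinearMap.sub_apply, κ_cyclic, κ_cyclic, sym (S : Amb N), κ_cyclic]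
    rw [e1]
    exact T.2.2 _ ((isoAlg N).lie_mem hU S.2)

/-- The infinitesimal isotropy representation `ad|_𝔥` of `𝔥` on `𝔪`. -/
noncomputable def isotropyAlg (N : ℕ) : isoAlg N →ₗ[ℝ] Module.End ℝ (𝔪 N) :=
  LinearMap.mk₂ ℝ (fun S T => (⟨⁅(S : Amb N), (T : Amb N)⁆, ad_mem S T⟩ : 𝔪 N))
    (fun S S' T => Subtype.ext (add_lie (S : Amb N) (S' : Amb N) (T : Amb N)))
    (fun r S T => Subtype.ext (smul_lie r (S : Amb N) (T : Amb N)))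
    (fun S T T' => Subtype.ext (lie_add (S : Amb N) (T : Amb N) (T' : Amb N)))
    (fun r S T => Subtype.ext (lie_smul r (S : Amb N) (T : Amb N)))

/-! ### Invariant metrics -/

/-- On `𝔪` this is the projection onto the summand `𝔪₁ = {(x F₁₁, -((n+1)/2) x)}` along the
summand `𝔪₂` of all pairs `(X, 0) ∈ 𝔪` with `X₁₁ = 0`. -/
noncomputable def vert (N : ℕ) : Amb N →ₗ[ℝ] Amb N where
  toFun T := (Matrix.single 0 0 (T.1 0 0), T.2)
  map_add' S T := Prod.ext (by simp [Matrix.single_add]) rfl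
  map_smul' r T := Prod.ext (by simp [Matrix.smul_single]) rfl

/-- The metric `g_{a,b} = -a κ|_{𝔪₁ × 𝔪₁} - b κ|_{𝔪₂ × 𝔪₂}` on `𝔪 = 𝔪₁ ⊕ 𝔪₂`. -/
noncomputable def metric (N : ℕ) (a b : ℝ) : LinearMap.BilinForm ℝ (𝔪 N) :=
  LinearMap.mk₂ ℝ
    (fun S T => -a * κ N (vert N S) (vert N T) -
      b * κ N ((S : Amb N) - vert N S) ((T : Amb N) - vert N T))
    (by intro S S' T; simp only [Submodule.coe_add, map_add, map_sub, LinearMap.add_apply,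
          LinearMap.sub_apply]; ring)
    (by intro r S T; simp only [Submodule.coe_smul, map_smul, map_sub, LinearMap.smul_apply,
          LinearMap.sub_apply, smul_eq_mul]; ring)
    (by intro S T T'; simp only [Submodule.coe_add, map_add, map_sub, LinearMap.sub_apply]; ring)
    (by intro r S T; simp only [Submodule.coe_smul, map_smul, map_sub, LinearMap.sub_apply,
          smul_eq_mul]; ring)

/-- An invariant metric on `G/H`: an `Ad(H)`-invariant inner product on `𝔪`. -/
def IsInvariantMetric {N : ℕ} (B : LinearMap.BilinForm ℝ (𝔪 N)) : Prop :=
  (∀ S T, B S T = B T S) ∧ (∀ T, T ≠ 0 → 0 < B T T) ∧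
    ∀ (h : H N) (S T : 𝔪 N), B (isotropy N h S) (isotropy N h T) = B S T

/-! ### The orthonormal frame -/

/-- The elementary symmetric matrix `F_{p,q}`. -/
noncomputable def symF {N : ℕ} (p q : Fin (N + 1)) : HMat N :=
  if p = q then Matrix.single p p 1 else Matrix.single p q 1 + Matrix.single q p 1

/-- The elementary skew-symmetric matrix `E_{p,q}`. -/
noncomputable def skewE {N : ℕ} (p q : Fin (N + 1)) : HMat N :=
  Matrix.single q p 1 - Matrix.single p q 1

/-- The imaginary quaternion units. -/
def qi : ℍ[ℝ] := ⟨0, 1, 0, 0⟩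
/-- The imaginary quaternion units. -/
def qj : ℍ[ℝ] := ⟨0, 0, 1, 0⟩
/-- The imaginary quaternion units. -/
def qk : ℍ[ℝ] := ⟨0, 0, 0, 1⟩

/-- Index set of the basis `y₁, …, y_{2n-1}` of `L'`: `none` stands for `y₁`, and for
`p = 0, …, n-2` the pairs `(p, 0)` and `(p, 1)` stand for `y_{2(p+1)}` and `y_{2(p+1)+1}`. -/
abbrev IdxY (N : ℕ) : Type := Option (Fin N × Fin 2)

/-- Index set of the frame `e₁, …, e_{4n-1}`: `none` stands for `e₁`, and if `s` stands for `y_j`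
then `(s, 0)` and `(s, 1)` stand for `e_{2j}` and `e_{2j+1}`. -/
abbrev IdxE (N : ℕ) : Type := Option (IdxY N × Fin 2)

/-- `Ω = √(2a(n+1)(n+3))`. -/
noncomputable def Ωc (N : ℕ) (a : ℝ) : ℝ :=
  Real.sqrt (2 * a * (((N + 1 : ℕ) : ℝ) + 1) * (((N + 1 : ℕ) : ℝ) + 3))

/-- `(x F₁₁, -((n+1)/2) x)`. -/
noncomputable def vertVec (N : ℕ) (x : ℍ[ℝ]) : Amb N :=
  (x • symF 0 0, -((((N + 1 : ℕ) : ℝ) + 1) / 2) • x)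

/-- `1 / (2√(2b(n+1)))`. -/
noncomputable def horCoeff (N : ℕ) (b : ℝ) : ℝ :=
  1 / (2 * Real.sqrt (2 * b * (((N + 1 : ℕ) : ℝ) + 1)))

/-- The vectors `ξ₁ = e₁, ξ₂ = e₂, ξ₃ = e₃` and `e_{4p}, …, e_{4p+3}`. -/
noncomputable def frameAmb (N : ℕ) (a b : ℝ) : IdxE N → Amb N
  | none => (1 / Ωc N a) • vertVec N qi
  | some (none, 0) => (1 / Ωc N a) • vertVec N (-qk)
  | some (none, 1) => (1 / Ωc N a) • vertVec N qj
  | some (some (p, 0), 0) => horCoeff N b • (qj • symF 0 p.succ, 0)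
  | some (some (p, 0), 1) => horCoeff N b • (qk • symF 0 p.succ, 0)
  | some (some (p, 1), 0) => horCoeff N b • (qi • symF 0 p.succ, 0)
  | some (some (p, 1), 1) => horCoeff N b • (skewE 0 p.succ, 0)

/-- The horizontal vector with entry `q` at `(p + 1, 1)`. -/
noncomputable def horVec {N : ℕ} (p : Fin N) (q : ℍ[ℝ]) : HMat N :=
  Matrix.single p.succ 0 q - Matrix.single 0 p.succ (star q)


lemma qi_re : qi.re = 0 := rfl
lemma qi_imI : qi.imI = 1 := rfl
lemma qi_imJ : qi.imJ = 0 := rfl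
lemma qi_imK : qi.imK = 0 := rfl
lemma qj_re : qj.re = 0 := rfl
lemma qj_imI : qj.imI = 0 := rfl
lemma qj_imJ : qj.imJ = 1 := rfl
lemma qj_imK : qj.imK = 0 := rfl
lemma qk_re : qk.re = 0 := rfl
lemma qk_imI : qk.imI = 0 := rfl
lemma qk_imJ : qk.imJ = 0 := rfl
lemma qk_imK : qk.imK = 1 := rfl
lemma star_qi : star qi = -qi := by ext <;> simp [qi_re]
lemma star_qj : star qj = -qj := by ext <;> simp [qj_re]
lemma star_qk : star qk = -qk := by ext <;> simp [qk_re]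

lemma smul_symF_horVec {N : ℕ} (p : Fin N) {q : ℍ[ℝ]} (hq : star q = -q) :
    q • (symF 0 p.succ : HMat N) = horVec p q := by
  have : (0 : Fin (N + 1)) ≠ p.succ := (Fin.succ_ne_zero p).symm
  rw [symF, if_neg this, horVec, hq, smul_add, Matrix.smul_single, Matrix.smul_single,
    ← Matrix.single_neg, sub_neg_eq_add, add_comm]
  simp

lemma skewE_horVec {N : ℕ} (p : Fin N) : (skewE 0 p.succ : HMat N) = horVec p 1 := by
  simp [skewE, horVec]

lemma smul_symF_zero {N : ℕ} (q : ℍ[ℝ]) :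
    q • (symF 0 0 : HMat N) = Matrix.single 0 0 q := by
  simp [symF, Matrix.smul_single]

lemma B₀_single_right {N : ℕ} (X : HMat N) (p q : Fin (N + 1)) (x : ℍ[ℝ]) :
    B₀ X (Matrix.single p q x) = -(X q p * x).re := by
  rw [B₀, Matrix.trace_mul_single]
  simp

lemma vertVec_mem {N : ℕ} {x : ℍ[ℝ]} (hx : star x = -x) : vertVec N x ∈ 𝔪 N := by
  refine ⟨Prod.ext ?_ (by simp [vertVec, hx]), fun S hS => ?_⟩
  · simp [vertVec, smul_symF_zero, Matrix.star_eq_conjTranspose, Matrix.conjTranspose_single, hx,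
      Matrix.single_neg]
  · have h0 : S.1 0 0 = S.2 := by simpa using hS.2 0
    rw [κ_apply, vertVec, smul_symF_zero, B₀_comm, B₀_single_right, h0, quat_re_mul_comm]
    simp
    ring

lemma horVec_mem {N : ℕ} (p : Fin N) (q : ℍ[ℝ]) : ((horVec p q, 0) : Amb N) ∈ 𝔪 N := by
  refine ⟨Prod.ext ?_ (by simp), fun S hS => ?_⟩
  · simp [horVec, Matrix.star_eq_conjTranspose, Matrix.conjTranspose_single]
  · have h0 : S.1 p.succ 0 = 0 := by simpa using hS.2 p.succ
    have h1 : S.1 0 p.succ = 0 := by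
      have := congrFun (congrFun (congrArg Prod.fst hS.1) 0) p.succ
      simp only [Prod.fst_star, Matrix.star_apply, h0, star_zero, Prod.fst_neg,
        Matrix.neg_apply] at this
      simpa using this.symm
    rw [κ_apply, B₀_comm]
    have : B₀ S.1 (horVec p q) = 0 := by
      have hsub : B₀ S.1 (horVec p q) = B₀ S.1 (Matrix.single p.succ 0 q) -
          B₀ S.1 (Matrix.single 0 p.succ (star q)) := by
        simp only [B₀, horVec, mul_sub, Matrix.trace_sub, Quaternion.re_sub]; ring
      rw [hsub, B₀_single_right, B₀_single_right, h0, h1]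
      simp
    simp [this]

lemma frame_mem (N : ℕ) (a b : ℝ) : ∀ k, frameAmb N a b k ∈ 𝔪 N
  | none => Submodule.smul_mem _ _ (vertVec_mem star_qi)
  | some (none, 0) => Submodule.smul_mem _ _ (vertVec_mem (by rw [star_neg, star_qk]))
  | some (none, 1) => Submodule.smul_mem _ _ (vertVec_mem star_qj)
  | some (some (p, 0), 0) => Submodule.smul_mem _ _
      (by rw [smul_symF_horVec p star_qj]; exact horVec_mem p _)
  | some (some (p, 0), 1) => Submodule.smul_mem _ _
      (by rw [smul_symF_horVec p star_qk]; exact horVec_mem p _)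
  | some (some (p, 1), 0) => Submodule.smul_mem _ _
      (by rw [smul_symF_horVec p star_qi]; exact horVec_mem p _)
  | some (some (p, 1), 1) => Submodule.smul_mem _ _
      (by rw [skewE_horVec p]; exact horVec_mem p _)

/-- The frame `e₁, …, e_{4n-1}` of `𝔪`. -/
noncomputable def frame (N : ℕ) (a b : ℝ) (k : IdxE N) : 𝔪 N :=
  ⟨frameAmb N a b k, frame_mem N a b k⟩

lemma mem_structure {N : ℕ} (T : 𝔪 N) :
    star ((T : Amb N).1 0 0) = -(T : Amb N).1 0 0 ∧
    vert N T = vertVec N ((T : Amb N).1 0 0) ∧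
    (T : Amb N) - vert N T = (∑ p : Fin N, horVec p ((T : Amb N).1 p.succ 0), 0) := by
  obtain ⟨⟨X, ζ⟩, hT, hT'⟩ := T
  have hX : ∀ i j, star (X j i) = -X i j := fun i j =>
    congrFun (congrFun (congrArg Prod.fst hT) i) j
  have hζ : star ζ = -ζ := congrArg Prod.snd hT
  have reη : ∀ q : ℍ[ℝ], star q = -q → (q * q).re = 0 → q = 0 := by
    intro q hq h
    have h2 : (star q * q).re = 0 := by rw [hq, neg_mul, Quaternion.re_neg, h, neg_zero]
    rw [Quaternion.star_mul_self, Quaternion.re_coe] at h2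
    exact Quaternion.normSq_eq_zero.1 h2
  -- the lower right block vanishes
  have hblock : ∀ p q : Fin N, X p.succ q.succ = 0 := by
    set Y : HMat N := fun i j => if i = 0 ∨ j = 0 then 0 else X i j with hY
    have hYX : ∀ i j, star (Y j i) = -Y i j := by
      intro i j
      simp only [hY]
      by_cases h : i = 0 ∨ j = 0
      · rw [if_pos h, if_pos h.symm]; simp
      · rw [if_neg h, if_neg (fun h' => h h'.symm)]; exact hX i j
    have hS : ((Y, 0) : Amb N) ∈ isoAlg N := by
      refine ⟨Prod.ext ?_ (by simp), fun i => by simp [hY]⟩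
      ext1 i j
      exact hYX i j
    have h0 := hT' _ hS
    have hpos : ∀ i j, 0 ≤ -(X i j * Y j i).re ∧ ((X i j * Y j i).re = 0 → Y i j = 0) := by
      intro i j
      have h1 : Y j i = -star (Y i j) := by rw [hYX, neg_neg]
      have h2 : (X i j * Y j i).re = -(Quaternion.normSq (Y i j)) := by
        by_cases h : i = 0 ∨ j = 0
        · have h3 : Y i j = 0 := by simp only [hY]; rw [if_pos h]
          rw [h1, h3]; simp
        · have h3 : X i j = Y i j := by simp only [hY]; rw [if_neg h]
          rw [h1, h3, mul_neg, Quaternion.self_mul_star]; simp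
      rw [h2]
      refine ⟨by rw [neg_neg]; exact Quaternion.normSq_nonneg, fun h => ?_⟩
      exact Quaternion.normSq_eq_zero.1 (neg_eq_zero.1 h)
    rw [κ_apply, B₀_eq] at h0
    simp only [mul_zero, Quaternion.re_zero, add_zero] at h0
    have h4 : ∑ i, ∑ j, -(X i j * Y j i).re = 0 := by
      have hne : -4 * (((N + 1 : ℕ) : ℝ) + 1) ≠ 0 := by
        have : (0 : ℝ) < ((N + 1 : ℕ) : ℝ) + 1 := by positivity
        intro h; linarith
      have := (mul_eq_zero.1 h0).resolve_left hne
      simpa only [Finset.sum_neg_distrib] using this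
    intro p q
    have h5 := (Finset.sum_eq_zero_iff_of_nonneg
      (fun i _ => Finset.sum_nonneg fun j _ => (hpos i j).1)).1 h4 p.succ (Finset.mem_univ _)
    have h6 := (Finset.sum_eq_zero_iff_of_nonneg
      (fun j _ => (hpos p.succ j).1)).1 h5 q.succ (Finset.mem_univ _)
    have h7 := (hpos p.succ q.succ).2 (neg_eq_zero.1 h6)
    simpa [hY, Fin.succ_ne_zero] using h7
  have hx : star (X 0 0) = -X 0 0 := hX 0 0
  have hζx : ζ = -((((N + 1 : ℕ) : ℝ) + 1) / 2) • X 0 0 := by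
    set η : ℍ[ℝ] := (4 * (((N + 1 : ℕ) : ℝ) + 1)) • X 0 0 + (8 : ℝ) • ζ with hη
    have hη' : star η = -η := by
      rw [hη, star_add, Quaternion.star_smul, Quaternion.star_smul, hx, hζ, smul_neg, smul_neg,
        neg_add]
    have hS : ((Matrix.single 0 0 η, η) : Amb N) ∈ isoAlg N := by
      refine ⟨Prod.ext ?_ hη', fun i => ?_⟩
      · simp [Matrix.star_eq_conjTranspose, Matrix.conjTranspose_single, hη', Matrix.single_neg]
      · by_cases hi : i = 0
        · subst hi; simp
        · simp [hi, Ne.symm hi]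
    have h0 := hT' _ hS
    rw [κ_apply, B₀_single_right] at h0
    have h1 : (η * η).re = 0 := by
      conv_lhs => rw [hη, add_mul, Quaternion.re_add, smul_mul_assoc, smul_mul_assoc,
        Quaternion.re_smul, Quaternion.re_smul, ← hη]
      simp only [smul_eq_mul] at h0 ⊢
      linarith
    have h2 := reη η hη' h1
    have h3 : ζ = (1 / 8 : ℝ) • (η - (4 * (((N + 1 : ℕ) : ℝ) + 1)) • X 0 0) := by
      rw [hη, add_sub_cancel_left, smul_smul]; norm_num
    rw [h3, h2, zero_sub, smul_neg, smul_smul, neg_smul]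
    congr 2
    ring
  refine ⟨hx, ?_, ?_⟩
  · refine Prod.ext ?_ hζx
    simp [vert, vertVec, smul_symF_zero]
  · refine Prod.ext ?_ (by simp [vert])
    ext1 i j
    simp only [vert, LinearMap.coe_mk, AddHom.coe_mk, Prod.fst_sub, Matrix.sub_apply,
      Matrix.sum_apply, horVec]
    have hs : ∀ p : Fin N, (0 : Fin (N + 1)) ≠ p.succ := fun p => (Fin.succ_ne_zero p).symm
    refine Fin.cases ?_ (fun p => ?_) i <;> refine Fin.cases ?_ (fun q => ?_) j
    · simp
    · simp [Matrix.single_apply, hs, hX]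
    · simp [Matrix.single_apply, hs]
    · simp [hs, hblock]

lemma κ_vert {N : ℕ} (x x' : ℍ[ℝ]) : κ N (vertVec N x) (vertVec N x') =
    2 * (((N + 1 : ℕ) : ℝ) + 1) * (((N + 1 : ℕ) : ℝ) + 3) * (x * x').re := by
  rw [κ_apply]
  simp only [vertVec, smul_symF_zero, B₀_single_right, Matrix.single_apply_same, smul_mul_assoc,
    mul_smul_comm, Quaternion.re_smul, smul_eq_mul]
  ring

lemma κ_hor {N : ℕ} (u : Fin N → ℍ[ℝ]) (p : Fin N) (q : ℍ[ℝ]) :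
    κ N (∑ p : Fin N, horVec p (u p), 0) (horVec p q, 0) =
      -8 * (((N + 1 : ℕ) : ℝ) + 1) * (star (u p) * q).re := by
  have hs : ∀ p : Fin N, (0 : Fin (N + 1)) ≠ p.succ := fun p => (Fin.succ_ne_zero p).symm
  have hsub : ∀ Y : HMat N, B₀ Y (horVec p q) = B₀ Y (Matrix.single p.succ 0 q) -
      B₀ Y (Matrix.single 0 p.succ (star q)) := by
    intro Y
    simp only [B₀, horVec, mul_sub, Matrix.trace_sub, Quaternion.re_sub]; ring
  have h1 : (∑ p : Fin N, horVec p (u p)) 0 p.succ = -star (u p) := by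
    simp [Matrix.sum_apply, horVec, Matrix.single_apply, hs]
  have h2 : (∑ p : Fin N, horVec p (u p)) p.succ 0 = u p := by
    simp [Matrix.sum_apply, horVec, Matrix.single_apply, hs]
  rw [κ_apply, hsub, B₀_single_right, B₀_single_right]
  dsimp only
  rw [h1, h2]
  simp only [Quaternion.re_mul, Quaternion.re_star, Quaternion.imI_star, Quaternion.imJ_star,
    Quaternion.imK_star, Quaternion.re_neg, Quaternion.imI_neg, Quaternion.imJ_neg,
    Quaternion.imK_neg, Quaternion.re_zero, Quaternion.imI_zero, Quaternion.imJ_zero,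
    Quaternion.imK_zero]
  ring

lemma metric_vert {N : ℕ} (a b r : ℝ) (T : 𝔪 N) {x : ℍ[ℝ]} (h : r • vertVec N x ∈ 𝔪 N) :
    metric N a b T ⟨r • vertVec N x, h⟩ = -a * (r * (2 * (((N + 1 : ℕ) : ℝ) + 1) *
      (((N + 1 : ℕ) : ℝ) + 3) * ((T : Amb N).1 0 0 * x).re)) := by
  have hv : vert N (r • vertVec N x) = r • vertVec N x := by
    refine Prod.ext ?_ rfl
    simp [vert, vertVec, smul_symF_zero, Matrix.smul_single]
  change -a * κ N (vert N T) (vert N (r • vertVec N x)) - b * κ N ((T : Amb N) - vert N T)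
    (r • vertVec N x - vert N (r • vertVec N x)) = _
  rw [hv, (mem_structure T).2.1, sub_self, map_zero, mul_zero, sub_zero, map_smul, κ_vert,
    smul_eq_mul]

lemma metric_hor {N : ℕ} (a b r : ℝ) (T : 𝔪 N) (p : Fin N) {q : ℍ[ℝ]} {Z : HMat N}
    (hZ : Z = horVec p q) (h : r • ((Z, 0) : Amb N) ∈ 𝔪 N) :
    metric N a b T ⟨r • (Z, 0), h⟩ = -b * (r * (-8 * (((N + 1 : ℕ) : ℝ) + 1) *
      (star ((T : Amb N).1 p.succ 0) * q).re)) := by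
  subst hZ
  have hs : ∀ p : Fin N, (0 : Fin (N + 1)) ≠ p.succ := fun p => (Fin.succ_ne_zero p).symm
  have hv : vert N (r • ((horVec p q, 0) : Amb N)) = 0 := by
    refine Prod.ext ?_ (by simp [vert])
    simp [vert, horVec, (hs _).symm]
  change -a * κ N (vert N T) (vert N (r • (horVec p q, 0))) - b * κ N ((T : Amb N) - vert N T)
    (r • (horVec p q, 0) - vert N (r • (horVec p q, 0))) = _
  rw [hv, (mem_structure T).2.2, sub_zero, map_zero, map_smul, κ_hor, smul_eq_mul]
  ring

/-- Parseval's identity for the frame and the metric `g_{a,b}`. -/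
lemma parseval {N : ℕ} {a b : ℝ} (ha : 0 < a) (hb : 0 < b) (T : 𝔪 N) :
    metric N a b T T = ∑ k, metric N a b T (frame N a b k) ^ 2 := by
  obtain ⟨h0, h1, h2⟩ := mem_structure T
  have hre : ((T : Amb N).1 0 0).re = 0 := by
    have := congrArg (fun q : ℍ[ℝ] => q.re) h0
    simp only [Quaternion.re_star, Quaternion.re_neg] at this
    linarith
  have hn : (0 : ℝ) < ((N + 1 : ℕ) : ℝ) + 1 := by positivity
  have hΩ : (Ωc N a) ^ 2 = 2 * a * (((N + 1 : ℕ) : ℝ) + 1) * (((N + 1 : ℕ) : ℝ) + 3) :=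
    Real.sq_sqrt (by positivity)
  have hΩ0 : Ωc N a ≠ 0 := by
    have : 0 < Ωc N a := Real.sqrt_pos.2 (by positivity)
    exact this.ne'
  have hc : (horCoeff N b) ^ 2 * (8 * b * (((N + 1 : ℕ) : ℝ) + 1)) = 1 := by
    rw [horCoeff, div_pow, mul_pow, Real.sq_sqrt (by positivity)]
    field_simp
    ring
  set c := horCoeff N b with hcdef
  have hV : (1 / Ωc N a) ^ 2 * (2 * a * (((N + 1 : ℕ) : ℝ) + 1) * (((N + 1 : ℕ) : ℝ) + 3)) = 1 := by
    rw [← hΩ]; field_simp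
  set d := 1 / Ωc N a with hd
  have e1 : metric N a b T (frame N a b none) = _ := metric_vert a b d T _
  have e2 : metric N a b T (frame N a b (some (none, 0))) = _ := metric_vert a b d T _
  have e3 : metric N a b T (frame N a b (some (none, 1))) = _ := metric_vert a b d T _
  have f1 : ∀ p, metric N a b T (frame N a b (some (some (p, 0), 0))) = _ := fun p =>
    metric_hor a b c T p (smul_symF_horVec p star_qj) _
  have f2 : ∀ p, metric N a b T (frame N a b (some (some (p, 0), 1))) = _ := fun p =>
    metric_hor a b c T p (smul_symF_horVec p star_qk) _
  have f3 : ∀ p, metric N a b T (frame N a b (some (some (p, 1), 0))) = _ := fun p =>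
    metric_hor a b c T p (smul_symF_horVec p star_qi) _
  have f4 : ∀ p, metric N a b T (frame N a b (some (some (p, 1), 1))) = _ := fun p =>
    metric_hor a b c T p (skewE_horVec p) _
  have lhs : metric N a b T T = -a * (2 * (((N + 1 : ℕ) : ℝ) + 1) * (((N + 1 : ℕ) : ℝ) + 3) *
      ((T : Amb N).1 0 0 * (T : Amb N).1 0 0).re) - b * ∑ p : Fin N,
        (-8 * (((N + 1 : ℕ) : ℝ) + 1) *
          (star ((T : Amb N).1 p.succ 0) * (T : Amb N).1 p.succ 0).re) := by
    change -a * κ N (vert N T) (vert N T) - b * κ N ((T : Amb N) - vert N T)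
      ((T : Amb N) - vert N T) = _
    rw [h2, h1, κ_vert]
    congr 2
    have : ((∑ p : Fin N, horVec p ((T : Amb N).1 p.succ 0), 0) : Amb N) =
        ∑ p : Fin N, (horVec p ((T : Amb N).1 p.succ 0), 0) := by
      refine Prod.ext ?_ ?_
      · rw [Prod.fst_sum]
      · rw [Prod.snd_sum]; simp
    conv_lhs => rw [this, map_sum]
    refine Finset.sum_congr rfl fun p _ => ?_
    rw [← this, κ_hor]
  rw [lhs, Fintype.sum_option, Fintype.sum_prod_type, Fintype.sum_option, Fintype.sum_prod_type]
  simp only [Fin.sum_univ_two, e1, e2, e3, f1, f2, f3, f4]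
  rw [← add_assoc, sub_eq_add_neg, ← mul_neg, ← Finset.sum_neg_distrib, Finset.mul_sum]
  congr 1
  · simp only [Quaternion.re_mul, hre, Quaternion.re_neg, Quaternion.imI_neg, Quaternion.imJ_neg,
      Quaternion.imK_neg, qi_re, qi_imI, qi_imJ, qi_imK, qj_re, qj_imI, qj_imJ, qj_imK,
      qk_re, qk_imI, qk_imJ, qk_imK]
    linear_combination (-(2 * a * (((N + 1 : ℕ) : ℝ) + 1) * (((N + 1 : ℕ) : ℝ) + 3)) *
      (((T : Amb N).1 0 0).imI ^ 2 + ((T : Amb N).1 0 0).imJ ^ 2 + ((T : Amb N).1 0 0).imK ^ 2)) * hV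
  · refine Finset.sum_congr rfl fun p _ => ?_
    simp only [Quaternion.re_mul, Quaternion.re_star, Quaternion.imI_star, Quaternion.imJ_star,
      Quaternion.imK_star, qi_re, qi_imI, qi_imJ, qi_imK, qj_re, qj_imI, qj_imJ, qj_imK,
      qk_re, qk_imI, qk_imJ, qk_imK, Quaternion.re_one, Quaternion.imI_one, Quaternion.imJ_one,
      Quaternion.imK_one]
    linear_combination (-(8 * b * (((N + 1 : ℕ) : ℝ) + 1)) *
      (((T : Amb N).1 p.succ 0).re ^ 2 + ((T : Amb N).1 p.succ 0).imI ^ 2 +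
        ((T : Amb N).1 p.succ 0).imJ ^ 2 + ((T : Amb N).1 p.succ 0).imK ^ 2)) * hc

/-! ### The spinor module and Clifford multiplication -/

/-- The isotropic subspace `L'` with basis `y₁, …, y_{2n-1}`. -/
abbrev L' (N : ℕ) : Type := IdxY N → ℂ

/-- The spinor module `Σ = Λ^• L'`. -/
abbrev Spinor (N : ℕ) : Type := ExteriorAlgebra ℂ (L' N)

/-- The basis vector `y_s` of `L'`, as an element of `Σ`. -/
noncomputable def y {N : ℕ} (s : IdxY N) : Spinor N := ExteriorAlgebra.ι ℂ (Pi.single s 1)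

/-- The operator `η ↦ y_s ∧ η`. -/
noncomputable def wedgeY {N : ℕ} (s : IdxY N) : Module.End ℂ (Spinor N) :=
  LinearMap.mulLeft ℂ (y s)

/-- The operator `η ↦ x_s ⌟ η`; here `x_s` is dual to `y_s`. -/
noncomputable def contrX {N : ℕ} (s : IdxY N) : Module.End ℂ (Spinor N) :=
  CliffordAlgebra.contractLeft (LinearMap.proj s)

/-- The operator `Id` on `Σ^even` and `-Id` on `Σ^odd`. -/
noncomputable def parity (N : ℕ) : Module.End ℂ (Spinor N) :=
  (CliffordAlgebra.involute : Spinor N →ₐ[ℂ] Spinor N).toLinearMap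

/-- Clifford multiplication by the orthonormal vectors: `e₁` acts as `i Id` on `Σ^even` and
`-i Id` on `Σ^odd`, and `e_{2j} η = i (x_j ⌟ η + y_j ∧ η)`, `e_{2j+1} η = y_j ∧ η - x_j ⌟ η`. -/
noncomputable def γ {N : ℕ} : IdxE N → Module.End ℂ (Spinor N)
  | none => Complex.I • parity N
  | some (s, 0) => Complex.I • (contrX s + wedgeY s)
  | some (s, 1) => wedgeY s - contrX s

lemma wedge_wedge {N : ℕ} (s t : IdxY N) : wedgeY s * wedgeY t + wedgeY t * wedgeY s = 0 := by
  refine LinearMap.ext fun η => ?_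
  change y s * (y t * η) + y t * (y s * η) = 0
  rw [← mul_assoc, ← mul_assoc, ← add_mul]
  have : y s * y t + y t * y s = 0 := ExteriorAlgebra.ι_add_mul_swap _ _
  rw [this, zero_mul]

lemma contr_contr {N : ℕ} (s t : IdxY N) : contrX s * contrX t + contrX t * contrX s = 0 := by
  refine LinearMap.ext fun η => ?_
  change CliffordAlgebra.contractLeft _ (CliffordAlgebra.contractLeft _ η) +
    CliffordAlgebra.contractLeft _ (CliffordAlgebra.contractLeft _ η) = 0
  rw [CliffordAlgebra.contractLeft_comm, neg_add_cancel]

lemma contr_wedge {N : ℕ} (s t : IdxY N) : contrX s * wedgeY t + wedgeY t * contrX s =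
    (if s = t then (1 : ℂ) else 0) • (1 : Module.End ℂ (Spinor N)) := by
  refine LinearMap.ext fun η => ?_
  change CliffordAlgebra.contractLeft (LinearMap.proj s) (y t * η) +
    y t * CliffordAlgebra.contractLeft (LinearMap.proj s) η = (if s = t then (1 : ℂ) else 0) • η
  have := CliffordAlgebra.contractLeft_ι_mul (Q := (0 : QuadraticForm ℂ (L' N)))
    (LinearMap.proj s : Module.Dual ℂ (L' N)) (Pi.single t 1) η
  change CliffordAlgebra.contractLeft (LinearMap.proj s) (y t * η) = _ at this
  rw [this]
  change _ - y t * _ + _ = _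
  rw [sub_add_cancel]
  congr 1
  simp [Pi.single_apply]

lemma parity_sq (N : ℕ) : parity N * parity N = 1 := by
  refine LinearMap.ext fun η => ?_
  exact CliffordAlgebra.involute_involute η

lemma parity_wedge {N : ℕ} (s : IdxY N) : parity N * wedgeY s + wedgeY s * parity N = 0 := by
  refine LinearMap.ext fun η => ?_
  change CliffordAlgebra.involute (y s * η) + y s * CliffordAlgebra.involute η = 0
  have h : CliffordAlgebra.involute (y s) = -y s := CliffordAlgebra.involute_ι _
  rw [map_mul, h, neg_mul, neg_add_cancel]

lemma parity_contr {N : ℕ} (s : IdxY N) : parity N * contrX s + contrX s * parity N = 0 := by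
  refine LinearMap.ext fun η => ?_
  change CliffordAlgebra.involute (CliffordAlgebra.contractLeft (LinearMap.proj s) η) +
    CliffordAlgebra.contractLeft (LinearMap.proj s) (CliffordAlgebra.involute η) = 0
  induction η using CliffordAlgebra.left_induction with
  | algebraMap r => simp
  | add x z hx hz => rw [map_add, map_add, map_add, map_add, add_add_add_comm, hx, hz, add_zero]
  | ι_mul x m hx =>
    have hx' := eq_neg_of_add_eq_zero_right hx
    simp only [CliffordAlgebra.contractLeft_ι_mul, map_mul, map_sub, map_smul,
      CliffordAlgebra.involute_ι, neg_mul, map_neg, hx']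
    simp

lemma γ_anticomm {N : ℕ} (k l : IdxE N) :
    γ k * γ l + γ l * γ k = (if k = l then (-2 : ℂ) else 0) • (1 : Module.End ℂ (Spinor N)) := by
  have p2 := parity_sq N
  have pw := parity_wedge (N := N)
  have pc := parity_contr (N := N)
  have ww := wedge_wedge (N := N)
  have cc := contr_contr (N := N)
  have cw := contr_wedge (N := N)
  rcases k with _ | ⟨s, r⟩ <;> rcases l with _ | ⟨t, r'⟩
  · simp only [γ, smul_mul_smul_comm, Complex.I_mul_I, p2, if_true]
    module
  · fin_cases r'
    · have h1 := pw t
      have h2 := pc t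
      simp only [γ, Fin.zero_eta, smul_mul_smul_comm, Complex.I_mul_I, mul_add, add_mul,
        reduceCtorEq, if_false]
      linear_combination (norm := module) (-1 : ℂ) • h1 + (-1 : ℂ) • h2
    · have h1 := pw t
      have h2 := pc t
      simp only [γ, Fin.mk_one, smul_mul_assoc, mul_smul_comm, mul_sub, sub_mul,
        reduceCtorEq, if_false]
      linear_combination (norm := module) Complex.I • h1 - Complex.I • h2
  · fin_cases r
    · have h1 := pw s
      have h2 := pc s
      simp only [γ, Fin.zero_eta, smul_mul_smul_comm, Complex.I_mul_I, mul_add, add_mul,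
        reduceCtorEq, if_false]
      linear_combination (norm := module) (-1 : ℂ) • h1 + (-1 : ℂ) • h2
    · have h1 := pw s
      have h2 := pc s
      simp only [γ, Fin.mk_one, smul_mul_assoc, mul_smul_comm, mul_sub, sub_mul,
        reduceCtorEq, if_false]
      linear_combination (norm := module) Complex.I • h1 - Complex.I • h2
  · have h1 := ww s t
    have h2 := cc s t
    have h3 := cw s t
    have h4 := cw t s
    have hst : (if t = s then (1 : ℂ) else 0) = if s = t then (1 : ℂ) else 0 := by
      simp only [eq_comm]
    rw [hst] at h4
    have hd : ∀ i : Fin 2, (if (some (s, i) : IdxE N) = some (t, i) then (-2 : ℂ) else 0) =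
        -2 * if s = t then (1 : ℂ) else 0 := by
      intro i; by_cases h : s = t <;> simp [h]
    have hz : ∀ i j : Fin 2, i ≠ j →
        (if (some (s, i) : IdxE N) = some (t, j) then (-2 : ℂ) else 0) = 0 := by
      intro i j h; simp [h]
    fin_cases r <;> fin_cases r'
    · rw [hd]
      simp only [γ, smul_mul_smul_comm, Complex.I_mul_I, mul_add, add_mul]
      linear_combination (norm := module) (-1 : ℂ) • h1 + (-1 : ℂ) • h2 + (-1 : ℂ) • h3 +
        (-1 : ℂ) • h4
    · rw [hz _ _ (by decide)]
      simp only [γ, smul_mul_assoc, mul_smul_comm, mul_sub, sub_mul, mul_add, add_mul]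
      linear_combination (norm := module) Complex.I • h1 - Complex.I • h2 + Complex.I • h3 -
        Complex.I • h4
    · rw [hz _ _ (by decide)]
      simp only [γ, smul_mul_assoc, mul_smul_comm, mul_sub, sub_mul, mul_add, add_mul]
      linear_combination (norm := module) Complex.I • h1 - Complex.I • h2 - Complex.I • h3 +
        Complex.I • h4
    · rw [hd]
      simp only [γ, mul_sub, sub_mul]
      linear_combination (norm := module) h1 + h2 - h3 - h4

/-- Clifford multiplication `v ↦ ∑ₖ g_{a,b}(v, eₖ) eₖ·` of `𝔪` on `Σ`. -/
noncomputable def cliffMul (N : ℕ) (a b : ℝ) : 𝔪 N →ₗ[ℝ] Module.End ℂ (Spinor N) :=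
  ∑ k, ((metric N a b).flip (frame N a b k)).smulRight (γ k)

/-- The quadratic form `v ↦ -g_{a,b}(v, v)` of the Clifford relation `v w + w v = -2 g(v, w)`. -/
noncomputable def cliffForm (N : ℕ) (a b : ℝ) : QuadraticForm ℝ (𝔪 N) :=
  (-metric N a b).toQuadraticMap

lemma cliffMul_sq {N : ℕ} {a b : ℝ} (ha : 0 < a) (hb : 0 < b) (v : 𝔪 N) :
    cliffMul N a b v * cliffMul N a b v =
      algebraMap ℝ (Module.End ℂ (Spinor N)) (cliffForm N a b v) := by
  have hc : cliffMul N a b v = ∑ k, metric N a b v (frame N a b k) • γ k := by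
    simp [cliffMul]
  have hQ : cliffForm N a b v = -∑ k, metric N a b v (frame N a b k) ^ 2 := by
    rw [← parseval ha hb]; simp [cliffForm]
  rw [hc, hQ, Algebra.algebraMap_eq_smul_one]
  set f := fun k => metric N a b v (frame N a b k)
  have h2 : (2 : ℝ) • ((∑ k, f k • (γ k : Module.End ℂ (Spinor N))) * ∑ k, f k • γ k) =
      (2 : ℝ) • ((-∑ k, f k ^ 2) • (1 : Module.End ℂ (Spinor N))) := by
    have h3 : (∑ k, f k • (γ k : Module.End ℂ (Spinor N))) * ∑ k, f k • γ k =
        ∑ k, ∑ l, (f k * f l) • (γ k * γ l) := by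
      rw [Finset.sum_mul_sum]; simp only [smul_mul_smul_comm]
    have h4 : (∑ k, f k • (γ k : Module.End ℂ (Spinor N))) * ∑ k, f k • γ k =
        ∑ k, ∑ l, (f k * f l) • (γ l * γ k) := by
      rw [h3, Finset.sum_comm]
      exact Finset.sum_congr rfl fun k _ => Finset.sum_congr rfl fun l _ => by
        rw [mul_comm (f l)]
    rw [two_smul]
    nth_rewrite 1 [h3]
    rw [h4, ← Finset.sum_add_distrib]
    simp only [← Finset.sum_add_distrib, ← smul_add, γ_anticomm]
    have h5 : ∀ k l : IdxE N, (f k * f l) • ((if k = l then (-2 : ℂ) else 0) •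
        (1 : Module.End ℂ (Spinor N))) = if k = l then (-2 * f k ^ 2) • 1 else 0 := by
      intro k l
      by_cases h : k = l
      · subst h
        rw [if_pos rfl, if_pos rfl, show (-2 : ℂ) = ((-2 : ℝ) : ℂ) by norm_num,
          Complex.coe_smul, smul_smul]
        congr 1; ring
      · simp [h]
    simp only [h5, Finset.sum_ite_eq, Finset.mem_univ, if_true, ← Finset.sum_smul, smul_smul,
      ← Finset.mul_sum]
    congr 1; ring
  exact smul_right_injective _ (two_ne_zero : (2 : ℝ) ≠ 0) h2

/-- The representation of the Clifford algebra `Cl(𝔪, g_{a,b})` on the spinor module. -/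
noncomputable def cliffRep {N : ℕ} {a b : ℝ} (ha : 0 < a) (hb : 0 < b) :
    CliffordAlgebra (cliffForm N a b) →ₐ[ℝ] Module.End ℂ (Spinor N) :=
  CliffordAlgebra.lift _ ⟨cliffMul N a b, cliffMul_sq ha hb⟩

/-! ### Invariant spinors: the infinitesimal description -/

/-- The map `𝔰𝔬(𝔪) → Cl(𝔪)` that sends `v ∧ w`, acting on `𝔪` as
`u ↦ g(v, u) w - g(w, u) v`, to `(v w - w v) / 4`.  As `A = ∑_{i<j} g(A eᵢ, eⱼ) eᵢ ∧ eⱼ` for a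
skew-symmetric `A`, its image is `(1/4) ∑_{i,j} g(A eᵢ, eⱼ) eᵢ eⱼ`. -/
noncomputable def soToCl (N : ℕ) (a b : ℝ) :
    Module.End ℝ (𝔪 N) →ₗ[ℝ] CliffordAlgebra (cliffForm N a b) where
  toFun A := ∑ i, ∑ j, ((1 / 4 : ℝ) * metric N a b (A (frame N a b i)) (frame N a b j)) •
    (CliffordAlgebra.ι (cliffForm N a b) (frame N a b i) *
      CliffordAlgebra.ι (cliffForm N a b) (frame N a b j))
  map_add' A B := by
    simp only [LinearMap.add_apply, map_add, mul_add, add_smul, Finset.sum_add_distrib]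
  map_smul' r A := by
    simp only [LinearMap.smul_apply, map_smul, smul_eq_mul, Finset.smul_sum, smul_smul,
      RingHom.id_apply]
    simp only [mul_left_comm]

/-- The restriction to the isotropy algebra `𝔥` of the spin representation, that is, the
composition `𝔥 → 𝔰𝔬(𝔪) → Cl(𝔪) → 𝔤𝔩(Σ)`. -/
noncomputable def spinRep {N : ℕ} {a b : ℝ} (ha : 0 < a) (hb : 0 < b) :
    isoAlg N →ₗ[ℝ] Module.End ℂ (Spinor N) :=
  (cliffRep ha hb).toLinearMap ∘ₗ soToCl N a b ∘ₗ isotropyAlg N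

/-- The complex linear extension of `spinRep` to `𝔥_ℂ`. -/
noncomputable def spinRepC {N : ℕ} {a b : ℝ} (ha : 0 < a) (hb : 0 < b) :
    ℂ ⊗[ℝ] isoAlg N →ₗ[ℂ] Module.End ℂ (Spinor N) :=
  (spinRep ha hb).liftBaseChange ℂ

/-- `𝔰𝔭_ℂ(2n-2) ⊆ 𝔥_ℂ`. -/
noncomputable def spLowerC (N : ℕ) : Submodule ℂ (ℂ ⊗[ℝ] isoAlg N) := (spLower N).baseChange ℂ

/-- `𝔰𝔭_ℂ(2) ⊆ 𝔥_ℂ`. -/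
noncomputable def spDiagC (N : ℕ) : Submodule ℂ (ℂ ⊗[ℝ] isoAlg N) := (spDiag N).baseChange ℂ

/-- The spinors annihilated by all elements of a subspace of `𝔥_ℂ`. -/
noncomputable def annihilated {N : ℕ} {a b : ℝ} (ha : 0 < a) (hb : 0 < b)
    (K : Submodule ℂ (ℂ ⊗[ℝ] isoAlg N)) : Submodule ℂ (Spinor N) :=
  ⨅ T ∈ K, LinearMap.ker (spinRepC ha hb T)

/-- A subspace of `Σ` that is mapped into itself by all elements of `K ⊆ 𝔥_ℂ`. -/
def IsStable {N : ℕ} {a b : ℝ} (ha : 0 < a) (hb : 0 < b)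
    (K : Submodule ℂ (ℂ ⊗[ℝ] isoAlg N)) (U : Submodule ℂ (Spinor N)) : Prop :=
  ∀ T ∈ K, ∀ ψ ∈ U, spinRepC ha hb T ψ ∈ U

/-- `U` is an irreducible representation of `K`. -/
def IsIrred {N : ℕ} {a b : ℝ} (ha : 0 < a) (hb : 0 < b)
    (K : Submodule ℂ (ℂ ⊗[ℝ] isoAlg N)) (U : Submodule ℂ (Spinor N)) : Prop :=
  IsStable ha hb K U ∧ U ≠ ⊥ ∧ ∀ U' ≤ U, IsStable ha hb K U' → U' = ⊥ ∨ U' = U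

/-! ### Invariant spinors: sections of the homogeneous spinor bundle -/

/-- A lift of the isotropy representation to `Spin(𝔪)`, which is the datum of a homogeneous spin
structure: a homomorphism `ρ : H → Spin(𝔪)` with `ρ(h) v ρ(h)⁻¹ = Ad(h) v`.  (Continuity need not
be required: two lifts differ by a homomorphism `H → {±1}`, which is trivial because every element
of `H` is a square, and the simply connected group `H` has a continuous lift.) -/
def IsSpinLift {N : ℕ} {a b : ℝ} (ρ : H N →* spinGroup (cliffForm N a b)) : Prop :=
  ∀ (h : H N) (v : 𝔪 N),
    (ρ h : CliffordAlgebra (cliffForm N a b)) * CliffordAlgebra.ι (cliffForm N a b) v *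
      ((ρ h)⁻¹ : spinGroup (cliffForm N a b)) =
    CliffordAlgebra.ι (cliffForm N a b) (isotropy N h v)

/-- The space of invariant spinors: sections of the spinor bundle `G ×_H Σ`, that is, maps
`φ : G → Σ` with `φ(gh) = σ(ρ(h⁻¹)) φ(g)`, which are fixed by the action `(g·φ)(g') = φ(g⁻¹g')`
of `G`. -/
noncomputable def invSpinors {N : ℕ} {a b : ℝ} (ha : 0 < a) (hb : 0 < b)
    (ρ : H N →* spinGroup (cliffForm N a b)) : Submodule ℂ (G N → Spinor N) where
  carrier := {φ |
    (∀ (g : G N) (h : H N),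
      φ (g * h) = cliffRep ha hb (ρ h⁻¹ : CliffordAlgebra (cliffForm N a b)) (φ g)) ∧
    ∀ g g' : G N, φ (g⁻¹ * g') = φ g'}
  add_mem' := by
    rintro φ χ ⟨h1, h2⟩ ⟨h3, h4⟩
    exact ⟨fun g h => by simp only [Pi.add_apply, h1, h3, map_add],
      fun g g' => by simp only [Pi.add_apply, h2, h4]⟩
  zero_mem' := ⟨fun g h => by simp, fun g g' => rfl⟩
  smul_mem' := by
    rintro c φ ⟨h1, h2⟩
    exact ⟨fun g h => by simp only [Pi.smul_apply, h1, map_smul],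
      fun g g' => by simp only [Pi.smul_apply, h2]⟩

/-- The spinor `y₁`. -/
noncomputable def y₁ (N : ℕ) : Spinor N := y none

/-- The spinor `ω = ∑_{i=1}^{n-1} y_{2i} ∧ y_{2i+1}`. -/
noncomputable def ω (N : ℕ) : Spinor N := ∑ p : Fin N, y (some (p, 0)) * y (some (p, 1))

end SpSphere

/-! Write Clifford multiplication through the creation operators `wedgeY` and the annihilation
operators `contrX` on the Fock space Σ. In this form (`spinRep_explicit`) the parameters a and b
cancel. The summand 𝔰𝔭(n-1) acts by derivations on the horizontal modes y₂, …, y_{2n-1} and kills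
y₁, while the diagonal 𝔰𝔭(1) acts through `cartanOp`, `raiseOp` and `lowerOp`.

On the horizontal factor, 𝔰𝔭_ℂ(2n-2) and the 𝔰𝔩₂ generated by ω ∧ and the dual contraction form a
Howe dual pair, and the invariants are spanned by 1, ω, …, ω^{n-1}. The equations of the subalgebra
𝔤𝔩_{n-1} already suffice; under it the horizontal modes form V ⊕ V*. On invariants, contraction
followed by ω ∧ is a scalar in each degree (`IsSpInvariant.omegaWedge_omegaContr`), nonzero in
positive degree, so an induction on the degree divides by ω (`IsSpInvariant.mem_omegaSpan`).

Together with y₁ the invariants form ℂ² ⊗ Sym^{n-1} ℂ² over the diagonal 𝔰𝔩₂, which splits as Symⁿ ⊕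
Sym^{n-2} by Clebsch–Gordan. The strings `bigVec` and `smallVec` exhibit the two summands. A trivial
summand occurs only for n = 2, where it is the line through ω + i y₁.

Invariant metrics: sign changes, coordinate rotations and unit quaternions in H force an invariant
form to be determined by one value on 𝔪₁ and one on 𝔪₂ (`invariant_eq_zero`).

Invariant sections are constant with a value fixed by ρ(H). The lift ρ is not assumed continuous, so
it cannot be differentiated. Instead, the action of a torus element of H is computed up to a scalar
by Schur's lemma. Since π is irrational, its eigenvectors are weight vectors, and conjugation by j,
which reverses weights, forces the weight to be zero (`spinRep_torusElt_eq_zero`). Adjoint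
conjugates of the torus then reach enough of 𝔥. Conversely, for n = 2 the group H acts on the
invariant line by a character, which is trivial because every element of H is a commutator
(`liftOp_smallVec`). -/

namespace SpSphere

/-! ### Eigenspace decompositions -/

/-- A subspace stable under `f` contains the components of its elements with respect to a
decomposition into eigenvectors of `f`. -/
lemma mem_iSup_inf_of_stable {V ι : Type*} [AddCommGroup V] [Module ℂ V] (f : Module.End ℂ V)
    {μ : ι → ℂ} (hμ : Function.Injective μ) {Z : ι → Submodule ℂ V}
    (hZ : ∀ i, ∀ x ∈ Z i, f x = μ i • x) {p : Submodule ℂ V} (hp : ∀ x ∈ p, f x ∈ p) {ψ : V}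
    (hψ : ψ ∈ p) (hψ' : ψ ∈ ⨆ i, Z i) : ψ ∈ ⨆ i, p ⊓ Z i := by
  classical
  have key : ∀ (s : Finset ι) (v : ι → V), (∀ i, v i ∈ Z i) → ∑ i ∈ s, v i ∈ p →
      ∀ i ∈ s, v i ∈ p := by
    intro s
    induction s using Finset.induction_on with
    | empty => simp
    | insert j s hj ih =>
      intro v hv hs
      -- Applying f - μ_j removes the j-th term and multiplies every other one by a nonzero scalar,
      -- so the induction hypothesis applies to the shorter sum.
      have h1 : ∑ i ∈ s, (μ i - μ j) • v i ∈ p := by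
        have h2 := p.sub_mem (hp _ hs) (p.smul_mem (μ j) hs)
        rw [map_sum, Finset.smul_sum, ← Finset.sum_sub_distrib, Finset.sum_insert hj,
          hZ j _ (hv j), sub_self, zero_add] at h2
        convert h2 using 2 with i _
        rw [hZ i _ (hv i), sub_smul]
      have h3 : ∀ i ∈ s, v i ∈ p := by
        intro i hi
        have hne : μ i - μ j ≠ 0 :=
          sub_ne_zero.2 fun h => hj (hμ h ▸ hi)
        exact (p.smul_mem_iff hne).1
          (ih (fun i => (μ i - μ j) • v i) (fun i => (Z i).smul_mem _ (hv i)) h1 i hi)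
      intro i hi
      rcases Finset.mem_insert.1 hi with rfl | hi
      · rw [Finset.sum_insert hj] at hs
        exact (p.add_mem_iff_left (p.sum_mem h3)).1 hs
      · exact h3 i hi
  obtain ⟨v, hv, hsum⟩ := (Submodule.mem_iSup_iff_exists_finsupp Z ψ).1 hψ'
  rw [← hsum]
  refine Submodule.sum_mem _ fun i hi => Submodule.mem_iSup_of_mem i ⟨?_, hv i⟩
  refine key v.support v hv ?_ i hi
  rw [← hsum] at hψ
  exact hψ

/-! ### Creation and annihilation operators -/

section Fock

variable {N : ℕ}

lemma wedgeY_apply (s : IdxY N) (η : Spinor N) : wedgeY s η = y s * η := rfl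

lemma wedgeY_sq (s : IdxY N) : wedgeY s * wedgeY s = 0 := by
  have h := wedge_wedge s s
  rw [← two_smul ℂ] at h
  exact (smul_eq_zero.1 h).resolve_left two_ne_zero

lemma contrX_sq (s : IdxY N) : contrX s * contrX s = 0 := by
  have h := contr_contr s s
  rw [← two_smul ℂ] at h
  exact (smul_eq_zero.1 h).resolve_left two_ne_zero

lemma wedgeY_comm (s t : IdxY N) : wedgeY s * wedgeY t = -(wedgeY t * wedgeY s) :=
  eq_neg_of_add_eq_zero_left (wedge_wedge s t)

lemma contrX_comm (s t : IdxY N) : contrX s * contrX t = -(contrX t * contrX s) :=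
  eq_neg_of_add_eq_zero_left (contr_contr s t)

lemma contrX_wedgeY_self (s : IdxY N) : contrX s * wedgeY s = 1 - wedgeY s * contrX s := by
  have h := contr_wedge s s
  rw [if_pos rfl, one_smul] at h
  exact eq_sub_of_add_eq h

lemma contrX_wedgeY_of_ne {s t : IdxY N} (h : s ≠ t) :
    contrX s * wedgeY t = -(wedgeY t * contrX s) := by
  have h' := contr_wedge s t
  rw [if_neg h, zero_smul] at h'
  exact eq_neg_of_add_eq_zero_left h'

lemma contrX_one (s : IdxY N) : contrX s (1 : Spinor N) = 0 :=
  CliffordAlgebra.contractLeft_one (Q := (0 : QuadraticForm ℂ (L' N))) _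

/-- The number operator of the mode `y_s`. -/
noncomputable def num (s : IdxY N) : Module.End ℂ (Spinor N) := wedgeY s * contrX s

lemma num_one (s : IdxY N) : num s (1 : Spinor N) = 0 := by
  rw [num, Module.End.mul_apply, contrX_one, map_zero]

lemma num_mul_wedgeY_self (s : IdxY N) : num s * wedgeY s = wedgeY s := by
  rw [num, mul_assoc, contrX_wedgeY_self, mul_sub, mul_one, ← mul_assoc, wedgeY_sq, zero_mul,
    sub_zero]

lemma wedgeY_mul_num_self (s : IdxY N) : wedgeY s * num s = 0 := by
  rw [num, ← mul_assoc, wedgeY_sq, zero_mul]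

lemma contrX_mul_num_self (s : IdxY N) : contrX s * num s = contrX s := by
  rw [num, ← mul_assoc, contrX_wedgeY_self, sub_mul, one_mul, mul_assoc, contrX_sq, mul_zero,
    sub_zero]

lemma num_mul_contrX_self (s : IdxY N) : num s * contrX s = 0 := by
  rw [num, mul_assoc, contrX_sq, mul_zero]

lemma num_mul_wedgeY_of_ne {s t : IdxY N} (h : s ≠ t) : num s * wedgeY t = wedgeY t * num s := by
  rw [num, mul_assoc, contrX_wedgeY_of_ne h, mul_neg, ← mul_assoc, wedgeY_comm s t, neg_mul,
    neg_neg, mul_assoc]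

lemma num_mul_contrX_of_ne {s t : IdxY N} (h : s ≠ t) : num s * contrX t = contrX t * num s := by
  rw [num, mul_assoc, contrX_comm s t, mul_neg, ← mul_assoc, ← neg_mul,
    ← contrX_wedgeY_of_ne h.symm, mul_assoc]

lemma num_sq (s : IdxY N) : num s * num s = num s := by
  nth_rw 2 [num]
  rw [← mul_assoc, num_mul_wedgeY_self, num]

/-- A family of subspaces compatible with the wedge products by the `y_s` exhausts `Σ`. -/
lemma iSup_eq_top_of_wedgeY {ι : Type*} (Z : ι → Submodule ℂ (Spinor N)) (i₀ : ι)
    (h0 : (1 : Spinor N) ∈ Z i₀) (hw : ∀ s i, ∀ η ∈ Z i, ∃ j, wedgeY s η ∈ Z j) :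
    ⨆ i, Z i = ⊤ := by
  refine eq_top_iff.2 fun η _ => ?_
  induction η using CliffordAlgebra.left_induction with
  | algebraMap r =>
    rw [Algebra.algebraMap_eq_smul_one]
    exact Submodule.smul_mem _ _ (Submodule.mem_iSup_of_mem i₀ h0)
  | add x z hx hz => exact Submodule.add_mem _ (hx trivial) (hz trivial)
  | ι_mul x m hx =>
    have hm : CliffordAlgebra.ι (0 : QuadraticForm ℂ (L' N)) m * x =
        ∑ s, m s • wedgeY s x := by
      conv_lhs => rw [pi_eq_sum_univ' m, map_sum, Finset.sum_mul]
      refine Finset.sum_congr rfl fun s _ => ?_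
      rw [map_smul, smul_mul_assoc]
      congr 2
    rw [hm]
    refine Submodule.sum_mem _ fun s _ => Submodule.smul_mem _ _ ?_
    have hle : ⨆ i, Z i ≤ (⨆ i, Z i).comap (wedgeY s) := by
      refine iSup_le fun i η hη => ?_
      obtain ⟨j, hj⟩ := hw s i η hη
      exact Submodule.mem_iSup_of_mem j hj
    exact hle (hx trivial)

/-- The operator `∑ₛ mₛ nₛ` of which the monomial `y_{s₁} ∧ ⋯ ∧ y_{sₖ}` is an eigenvector with
eigenvalue `m_{s₁} + ⋯ + m_{sₖ}`. -/
noncomputable def weightOp (m : IdxY N → ℤ) : Module.End ℂ (Spinor N) :=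
  ∑ s, (m s : ℂ) • num s

/-- Every n_t with t ≠ s commutes with y_s ∧; the shift comes from n_s y_s = y_s against y_s n_s =
0. -/
lemma weightOp_mul_wedgeY (m : IdxY N → ℤ) (s : IdxY N) :
    weightOp m * wedgeY s = wedgeY s * weightOp m + (m s : ℂ) • wedgeY s := by
  rw [weightOp, Finset.sum_mul, Finset.mul_sum, ← Finset.add_sum_erase _ _ (Finset.mem_univ s),
    ← Finset.add_sum_erase _ _ (Finset.mem_univ s), smul_mul_assoc, num_mul_wedgeY_self,
    mul_smul_comm, wedgeY_mul_num_self, smul_zero, zero_add, add_comm]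
  congr 1
  refine Finset.sum_congr rfl fun t ht => ?_
  rw [smul_mul_assoc, mul_smul_comm, num_mul_wedgeY_of_ne (Finset.ne_of_mem_erase ht)]

lemma weightOp_mul_contrX (m : IdxY N → ℤ) (s : IdxY N) :
    weightOp m * contrX s = contrX s * weightOp m - (m s : ℂ) • contrX s := by
  rw [weightOp, Finset.sum_mul, Finset.mul_sum, ← Finset.add_sum_erase _ _ (Finset.mem_univ s),
    ← Finset.add_sum_erase _ _ (Finset.mem_univ s), smul_mul_assoc, num_mul_contrX_self,
    mul_smul_comm, contrX_mul_num_self, smul_zero, zero_add, add_sub_cancel_left]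
  refine Finset.sum_congr rfl fun t ht => ?_
  rw [smul_mul_assoc, mul_smul_comm, num_mul_contrX_of_ne (Finset.ne_of_mem_erase ht)]

lemma weightOp_one (m : IdxY N → ℤ) : weightOp m (1 : Spinor N) = 0 := by
  simp [weightOp, LinearMap.sum_apply, num_one]

lemma weightOp_wedgeY {m : IdxY N → ℤ} {s : IdxY N} {k : ℤ} {η : Spinor N}
    (h : weightOp m η = (k : ℂ) • η) :
    weightOp m (wedgeY s η) = ((k + m s : ℤ) : ℂ) • wedgeY s η := by
  have := LinearMap.congr_fun (weightOp_mul_wedgeY m s) η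
  simp only [Module.End.mul_apply, LinearMap.add_apply, LinearMap.smul_apply, h, map_smul] at this
  rw [this, ← add_smul]
  push_cast
  rfl

/-- A spinor that is annihilated by all contractions is a scalar. -/
lemma mem_span_one_of_contrX {ψ : Spinor N} (h : ∀ s, contrX s ψ = 0) :
    ψ ∈ Submodule.span ℂ {(1 : Spinor N)} := by
  -- These are the degree pieces for the total number operator. Taking the scalars themselves in
  -- degree 0 makes the exhaustion argument prove that its kernel consists of scalars.
  set Z : ℕ → Submodule ℂ (Spinor N) := fun k => if k = 0 then Submodule.span ℂ {1} else
    Module.End.eigenspace (weightOp fun _ => 1) (k : ℂ) with hZdef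
  have hZ : ∀ k, ∀ x ∈ Z k, weightOp (fun _ => 1) x = (k : ℂ) • x := by
    intro k x hx
    by_cases hk : k = 0
    · simp only [hZdef, hk, if_true] at hx
      obtain ⟨r, rfl⟩ := Submodule.mem_span_singleton.1 hx
      rw [map_smul, weightOp_one, hk]; simp
    · simp only [hZdef, hk, if_false] at hx
      exact Module.End.mem_eigenspace_iff.1 hx
  have htop : ⨆ k, Z k = ⊤ := by
    refine iSup_eq_top_of_wedgeY _ 0 ?_ fun s k η hη => ⟨k + 1, ?_⟩
    · simp [hZdef, Submodule.mem_span_singleton_self]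
    · simp only [hZdef, Nat.succ_ne_zero, if_false, Module.End.mem_eigenspace_iff]
      have := weightOp_wedgeY (m := fun _ => 1) (s := s) (k := k) (η := η)
        (by simpa using hZ k η hη)
      simpa using this
  have hker : weightOp (fun _ => 1) ψ = 0 := by
    simp [weightOp, LinearMap.sum_apply, num, h]
  have := mem_iSup_inf_of_stable (weightOp fun _ => 1) (μ := fun k : ℕ => (k : ℂ))
    Nat.cast_injective hZ (p := LinearMap.ker (weightOp fun _ => 1))
    (fun x hx => by rw [LinearMap.mem_ker.1 hx]; exact Submodule.zero_mem _) hker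
    (htop ▸ Submodule.mem_top)
  refine (iSup_le fun k => ?_ : _ ≤ Submodule.span ℂ {(1 : Spinor N)}) this
  rintro x ⟨hx1, hx2⟩
  by_cases hk : k = 0
  · simpa [hZdef, hk] using hx2
  · have h1 := hZ k x hx2
    rw [LinearMap.mem_ker.1 hx1] at h1
    have := (smul_eq_zero.1 h1.symm).resolve_left (Nat.cast_ne_zero.2 hk)
    rw [this]; exact Submodule.zero_mem _

/-- Schur's lemma for the spinor module. -/
lemma eq_smul_one_of_commute {Q : Module.End ℂ (Spinor N)}
    (hw : ∀ s, Q * wedgeY s = wedgeY s * Q) (hc : ∀ s, Q * contrX s = contrX s * Q) :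
    ∃ r : ℂ, Q = r • 1 := by
  -- The vacuum is the only state killed by all annihilators, so Q preserves its line; the creation
  -- operators carry the resulting scalar to all of Σ.
  have h1 : Q 1 ∈ Submodule.span ℂ {(1 : Spinor N)} := by
    refine mem_span_one_of_contrX fun s => ?_
    rw [← Module.End.mul_apply, ← hc, Module.End.mul_apply, contrX_one, map_zero]
  obtain ⟨r, hr⟩ := Submodule.mem_span_singleton.1 h1
  refine ⟨r, ?_⟩
  -- With a one-element index set, the exhaustion lemma is an induction principle: a kernel that
  -- contains 1 and is stable under every y_s ∧ is everything.
  have htop : ⨆ _ : Unit, LinearMap.ker (Q - r • 1) = ⊤ := by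
    refine iSup_eq_top_of_wedgeY _ () ?_ fun s _ η hη => ⟨(), ?_⟩
    · simp [hr]
    · rw [LinearMap.mem_ker] at hη ⊢
      rw [← Module.End.mul_apply, sub_mul, hw, smul_mul_assoc, one_mul]
      have : wedgeY s * Q - r • wedgeY s = wedgeY s * (Q - r • 1) := by
        rw [mul_sub, mul_smul_comm, mul_one]
      rw [this, Module.End.mul_apply, hη, map_zero]
  rw [iSup_const] at htop
  exact sub_eq_zero.1 (LinearMap.ker_eq_top.1 htop)

/-! ### The action of a diagonal matrix -/

/-- The automorphism of `Σ` induced by the diagonal map `y_s ↦ z_s y_s` of `L'`. -/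
noncomputable def diagOp (z : IdxY N → ℂ) : Module.End ℂ (Spinor N) :=
  (ExteriorAlgebra.map (LinearMap.pi fun s => z s • LinearMap.proj s :
    L' N →ₗ[ℂ] L' N)).toLinearMap

lemma diagOp_one (z : IdxY N → ℂ) : diagOp z (1 : Spinor N) = 1 :=
  map_one (ExteriorAlgebra.map _)

lemma diagOp_mul_wedgeY (z : IdxY N → ℂ) (s : IdxY N) :
    diagOp z * wedgeY s = z s • (wedgeY s * diagOp z) := by
  refine LinearMap.ext fun η => ?_
  change ExteriorAlgebra.map _ (y s * η) = z s • (y s * ExteriorAlgebra.map _ η)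
  rw [map_mul, y, ExteriorAlgebra.map_apply_ι, ← smul_mul_assoc, ← map_smul]
  congr 2
  ext t
  by_cases h : t = s
  · subst h; simp
  · simp [h]

/-- The difference of the two sides kills 1 and passes through y_t ∧ up to the factor -z_t, so its
kernel is all of Σ. -/
lemma diagOp_mul_contrX {z : IdxY N → ℂ} {s : IdxY N} (hz : z s ≠ 0) :
    diagOp z * contrX s = (z s)⁻¹ • (contrX s * diagOp z) := by
  have htop : ⨆ _ : Unit, LinearMap.ker (diagOp z * contrX s -
      (z s)⁻¹ • (contrX s * diagOp z)) = ⊤ := by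
    refine iSup_eq_top_of_wedgeY _ () ?_ fun t _ η hη => ⟨(), ?_⟩
    · simp [contrX_one, diagOp_one]
    · rw [LinearMap.mem_ker] at hη ⊢
      have e1 : diagOp z * contrX s * wedgeY t = (if s = t then (1 : ℂ) else 0) • diagOp z -
          z t • (wedgeY t * (diagOp z * contrX s)) := by
        rw [mul_assoc, eq_sub_of_add_eq (contr_wedge s t), mul_sub, ← mul_assoc (diagOp z),
          diagOp_mul_wedgeY, mul_smul_comm, mul_one, smul_mul_assoc, mul_assoc]
      have e2 : contrX s * diagOp z * wedgeY t = z t • ((if s = t then (1 : ℂ) else 0) • diagOp z -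
          wedgeY t * (contrX s * diagOp z)) := by
        rw [mul_assoc, diagOp_mul_wedgeY, mul_smul_comm, ← mul_assoc,
          eq_sub_of_add_eq (contr_wedge s t), sub_mul, smul_mul_assoc, one_mul, mul_assoc]
      have e3 : (diagOp z * contrX s - (z s)⁻¹ • (contrX s * diagOp z)) * wedgeY t =
          -(z t • (wedgeY t * (diagOp z * contrX s - (z s)⁻¹ • (contrX s * diagOp z)))) := by
        rw [sub_mul, smul_mul_assoc, e1, e2, mul_sub, mul_smul_comm]
        by_cases h : s = t
        · subst h
          simp only [if_true, one_smul, smul_sub, smul_smul, inv_mul_cancel₀ hz,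
            mul_inv_cancel₀ hz]
          abel
        · simp only [h, if_false, zero_smul, zero_sub, smul_neg, smul_sub, smul_smul,
            mul_comm (z t)]
          abel
      rw [← Module.End.mul_apply, e3, LinearMap.neg_apply, LinearMap.smul_apply,
        Module.End.mul_apply, hη, map_zero, smul_zero, neg_zero]
  rw [iSup_const] at htop
  exact sub_eq_zero.1 (LinearMap.ker_eq_top.1 htop)

lemma diagOp_mul_parity (z : IdxY N → ℂ) : diagOp z * parity N = parity N * diagOp z := by
  have htop : ⨆ _ : Unit, LinearMap.ker (diagOp z * parity N - parity N * diagOp z) = ⊤ := by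
    refine iSup_eq_top_of_wedgeY _ () ?_ fun t _ η hη => ⟨(), ?_⟩
    · have : parity N 1 = 1 := map_one (CliffordAlgebra.involute : Spinor N →ₐ[ℂ] Spinor N)
      simp [diagOp_one, this]
    · rw [LinearMap.mem_ker] at hη ⊢
      have h1 := eq_neg_of_add_eq_zero_left (parity_wedge t)
      have e3 : (diagOp z * parity N - parity N * diagOp z) * wedgeY t =
          -(z t • (wedgeY t * (diagOp z * parity N - parity N * diagOp z))) := by
        rw [sub_mul, mul_assoc, h1, mul_neg, ← mul_assoc, diagOp_mul_wedgeY, mul_assoc,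
          diagOp_mul_wedgeY, mul_smul_comm, ← mul_assoc, h1, smul_mul_assoc, mul_sub, smul_sub,
          neg_mul, smul_neg, mul_assoc, mul_assoc]
        abel
      rw [← Module.End.mul_apply, e3, LinearMap.neg_apply, LinearMap.smul_apply,
        Module.End.mul_apply, hη, map_zero, smul_zero, neg_zero]
  rw [iSup_const] at htop
  exact sub_eq_zero.1 (LinearMap.ker_eq_top.1 htop)

/-- If no two different powers of `z` agree, then an eigenvector of the torus element
`y_s ↦ z ^ (m s) y_s` is a weight vector. -/
lemma weightOp_of_diagOp {m : IdxY N → ℤ} {z : ℂ} (hz0 : z ≠ 0)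
    (hz : Function.Injective fun k : ℤ => z ^ k) {r : ℂ} :
    ∃ k : ℤ, ∀ ψ : Spinor N, diagOp (fun s => z ^ m s) ψ = r • ψ →
      weightOp m ψ = (k : ℂ) • ψ := by
  -- Monomials are eigenvectors of both operators, with matched eigenvalues k and z^k; these joint
  -- eigenspaces exhaust Σ.
  set Z : ℤ → Submodule ℂ (Spinor N) := fun k => Module.End.eigenspace (weightOp m) (k : ℂ) ⊓
    Module.End.eigenspace (diagOp fun s => z ^ m s) (z ^ k) with hZ
  have htop : ⨆ k, Z k = ⊤ := by
    refine iSup_eq_top_of_wedgeY _ 0 ?_ fun s k η hη => ⟨k + m s, ?_⟩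
    · refine ⟨?_, ?_⟩ <;> rw [SetLike.mem_coe, Module.End.mem_eigenspace_iff]
      · rw [weightOp_one]; simp
      · rw [diagOp_one]; simp
    · obtain ⟨h1, h2⟩ := hη
      rw [SetLike.mem_coe, Module.End.mem_eigenspace_iff] at h1 h2
      refine ⟨?_, ?_⟩ <;> rw [SetLike.mem_coe, Module.End.mem_eigenspace_iff]
      · exact weightOp_wedgeY h1
      · rw [← Module.End.mul_apply, diagOp_mul_wedgeY, LinearMap.smul_apply, Module.End.mul_apply,
          h2, map_smul, smul_smul, zpow_add₀ hz0, mul_comm]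
  have hstab : ∀ x ∈ Module.End.eigenspace (diagOp fun s => z ^ m s) r,
      weightOp m x ∈ Module.End.eigenspace (diagOp fun s => z ^ m s) r := by
    intro x hx
    rw [Module.End.mem_eigenspace_iff] at hx ⊢
    have hcomm : diagOp (fun s => z ^ m s) * weightOp m =
        weightOp m * diagOp (fun s => z ^ m s) := by
      rw [weightOp, Finset.mul_sum, Finset.sum_mul]
      refine Finset.sum_congr rfl fun s _ => ?_
      rw [mul_smul_comm, smul_mul_assoc, num, ← mul_assoc, diagOp_mul_wedgeY, smul_mul_assoc,
        mul_assoc, diagOp_mul_contrX (zpow_ne_zero _ hz0), mul_smul_comm, smul_smul (z ^ m s),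
        mul_inv_cancel₀ (zpow_ne_zero _ hz0), one_smul, mul_assoc]
    rw [← Module.End.mul_apply, hcomm, Module.End.mul_apply, hx, map_smul]
  have hdec : ∀ ψ ∈ Module.End.eigenspace (diagOp fun s => z ^ m s) r,
      ψ ∈ ⨆ k, Module.End.eigenspace (diagOp fun s => z ^ m s) r ⊓ Z k := fun ψ hψ =>
    mem_iSup_inf_of_stable (weightOp m) (μ := fun k : ℤ => (k : ℂ)) Int.cast_injective (Z := Z)
      (fun k x hx => Module.End.mem_eigenspace_iff.1 hx.1) hstab hψ (htop ▸ Submodule.mem_top)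
  by_cases hr : ∃ k : ℤ, z ^ k = r
  · obtain ⟨k, hk⟩ := hr
    refine ⟨k, fun ψ hψ => ?_⟩
    refine Module.End.mem_eigenspace_iff.1 ((iSup_le fun j => ?_ :
      _ ≤ Module.End.eigenspace (weightOp m) (k : ℂ))
      (hdec ψ (Module.End.mem_eigenspace_iff.2 hψ)))
    rintro x ⟨h1, h2, h3⟩
    by_cases hx : x = 0
    · rw [hx]; exact Submodule.zero_mem _
    · rw [SetLike.mem_coe, Module.End.mem_eigenspace_iff] at h1 h3
      -- A nonzero component of weight j forces z^j = r, and injectivity of the powers leaves one j.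
      have : z ^ j = z ^ k := by
        rw [hk]; exact smul_left_injective ℂ hx (h3.symm.trans h1)
      rw [← hz this]; exact h2
  -- If r is not a power of z, the r-eigenspace is zero and the weight 0 is an arbitrary choice.
  · refine ⟨0, fun ψ hψ => ?_⟩
    refine Module.End.mem_eigenspace_iff.1 ((iSup_le fun j => ?_ :
      _ ≤ Module.End.eigenspace (weightOp m) ((0 : ℤ) : ℂ))
      (hdec ψ (Module.End.mem_eigenspace_iff.2 hψ)))
    rintro x ⟨h1, h2, h3⟩
    by_cases hx : x = 0
    · rw [hx]; exact Submodule.zero_mem _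
    · rw [SetLike.mem_coe, Module.End.mem_eigenspace_iff] at h1 h3
      exact absurd ⟨j, smul_left_injective ℂ hx (h3.symm.trans h1)⟩ hr

end Fock

/-! ### Strings of weight vectors of an 𝔰𝔩₂-triple. -/

section Chains

variable {V : Type*} [AddCommGroup V] [Module ℂ V] {K E F : Module.End ℂ V} {x : ℕ → V}
  {κ : ℕ → ℂ} {m : ℕ}

/-- A nonzero subspace of a chain of weight vectors that is stable under the raising, lowering and
weight operators is the whole chain. -/
lemma chain_irreducible (hκ : Function.Injective κ) (hK : ∀ j, K (x j) = κ j • x j)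
    (hE : ∀ j, E (x j) = x (j + 1)) (hF : ∀ j, j + 1 < m → ∃ β : ℂ, β ≠ 0 ∧ F (x (j + 1)) = β • x j)
    {U : Submodule ℂ V} (hU : U ≤ Submodule.span ℂ (Set.range fun j : Fin m => x j))
    (hUK : ∀ v ∈ U, K v ∈ U) (hUE : ∀ v ∈ U, E v ∈ U) (hUF : ∀ v ∈ U, F v ∈ U) :
    U = ⊥ ∨ U = Submodule.span ℂ (Set.range fun j : Fin m => x j) := by
  by_cases h : ∃ j : Fin m, x j ∈ U
  · right
    obtain ⟨j₀, hj₀⟩ := h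
    -- One vector of the string generates all: raising reaches the indices above j₀, and lowering,
    -- whose coefficients are nonzero, those below.
    have hup : ∀ i, x (j₀ + i) ∈ U := by
      intro i
      induction i with
      | zero => exact hj₀
      | succ i ih => rw [← add_assoc, ← hE]; exact hUE _ ih
    have hdown : ∀ i j : ℕ, i + j = j₀ → x j ∈ U := by
      intro i
      induction i with
      | zero => intro j hj; rw [zero_add] at hj; rw [hj]; exact hj₀
      | succ i ih =>
        intro j hj
        obtain ⟨β, hβ, hFj⟩ := hF j (by omega)
        have := hUF _ (ih (j + 1) (by omega))
        rw [hFj] at this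
        exact (U.smul_mem_iff hβ).1 this
    refine le_antisymm hU (Submodule.span_le.2 ?_)
    rintro _ ⟨j, rfl⟩
    rcases le_total (j₀ : ℕ) j with h | h
    · obtain ⟨i, hi⟩ := Nat.exists_eq_add_of_le h
      change x j ∈ U
      rw [hi]; exact hup i
    · exact hdown (j₀ - j) j (by omega)
  · left
    refine eq_bot_iff.2 fun v hv => ?_
    have hspan : Submodule.span ℂ (Set.range fun j : Fin m => x j) =
        ⨆ j : Fin m, Submodule.span ℂ {x j} := Submodule.span_range_eq_iSup
    -- The weights are distinct, so U is the sum of its intersections with the lines of the string;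
    -- if U contains none of the x_j, these are all zero.
    have := mem_iSup_inf_of_stable K (μ := fun j : Fin m => κ j)
      (hκ.comp Fin.val_injective) (Z := fun j : Fin m => Submodule.span ℂ {x j})
      (fun j v hv => by
        obtain ⟨r, rfl⟩ := Submodule.mem_span_singleton.1 hv
        rw [map_smul, hK, smul_comm]) hUK hv (hspan ▸ hU hv)
    refine (iSup_le fun j => ?_ : _ ≤ (⊥ : Submodule ℂ V)) this
    rintro w ⟨hw, hw'⟩
    obtain ⟨r, rfl⟩ := Submodule.mem_span_singleton.1 hw'
    by_cases hr : r = 0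
    · simp [hr]
    · exact absurd ⟨j, (U.smul_mem_iff hr).1 hw⟩ h

/-- Lowering sends each vector to a nonzero multiple of its predecessor, so nonvanishing propagates
upwards from the bottom. -/
lemma chain_ne_zero (hF : ∀ j, j + 1 < m → ∃ β : ℂ, β ≠ 0 ∧ F (x (j + 1)) = β • x j)
    (h0 : 0 < m → x 0 ≠ 0) (j : ℕ) (hj : j < m) : x j ≠ 0 := by
  induction j with
  | zero => exact h0 hj
  | succ j ih =>
    intro h
    obtain ⟨β, hβ, hFj⟩ := hF j hj
    rw [h, map_zero] at hFj
    exact ih (by omega) ((smul_eq_zero.1 hFj.symm).resolve_left hβ)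

lemma finrank_chain (hκ : Function.Injective κ) (hK : ∀ j, K (x j) = κ j • x j)
    (hx : ∀ j < m, x j ≠ 0) :
    Module.finrank ℂ (Submodule.span ℂ (Set.range fun j : Fin m => x j)) = m := by
  have hli : LinearIndependent ℂ fun j : Fin m => x j :=
    Module.End.eigenvectors_linearIndependent' K (fun j : Fin m => κ j)
      (hκ.comp Fin.val_injective) _ fun j =>
        ⟨Module.End.mem_eigenspace_iff.2 (hK j), hx j j.2⟩
  rw [finrank_span_eq_card hli, Fintype.card_fin]

end Chains

/-! ### The dual pair -/

section Howe

variable {N : ℕ}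

/-- The operator `η ↦ ω ∧ η`. -/
noncomputable def omegaWedge (N : ℕ) : Module.End ℂ (Spinor N) :=
  ∑ p : Fin N, wedgeY (some (p, 0)) * wedgeY (some (p, 1))

/-- The contraction with the bivector dual to `ω`. -/
noncomputable def omegaContr (N : ℕ) : Module.End ℂ (Spinor N) :=
  ∑ p : Fin N, contrX (some (p, 0)) * contrX (some (p, 1))

lemma omegaWedge_apply (η : Spinor N) : omegaWedge N η = ω N * η := by
  simp only [omegaWedge, LinearMap.sum_apply, Module.End.mul_apply, wedgeY_apply, ω,
    Finset.sum_mul, mul_assoc]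

lemma some_zero_ne_some_one (p r : Fin N) : (some (p, 0) : IdxY N) ≠ some (r, 1) := by simp

/-- A pair of contractions in other modes commutes with the wedge; only the summand p = r leaves a
single contraction behind. -/
lemma omegaContr_mul_wedgeY_zero (r : Fin N) : omegaContr N * wedgeY (some (r, 0)) =
    wedgeY (some (r, 0)) * omegaContr N - contrX (some (r, 1)) := by
  rw [omegaContr, Finset.sum_mul, Finset.mul_sum,
    ← Finset.add_sum_erase _ _ (Finset.mem_univ r),
    ← Finset.add_sum_erase _ _ (Finset.mem_univ r), add_sub_right_comm]
  congr 1
  · rw [mul_assoc, contrX_wedgeY_of_ne (some_zero_ne_some_one r r).symm, mul_neg, ← mul_assoc,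
      contrX_wedgeY_self, sub_mul, one_mul, ← mul_assoc]
    abel
  · refine Finset.sum_congr rfl fun p hp => ?_
    have hpr : (some (p, 0) : IdxY N) ≠ some (r, 0) := by simpa using Finset.ne_of_mem_erase hp
    rw [mul_assoc, contrX_wedgeY_of_ne (some_zero_ne_some_one r p).symm, mul_neg, ← mul_assoc,
      contrX_wedgeY_of_ne hpr, neg_mul, neg_neg, mul_assoc]

lemma omegaContr_mul_wedgeY_one (r : Fin N) : omegaContr N * wedgeY (some (r, 1)) =
    wedgeY (some (r, 1)) * omegaContr N + contrX (some (r, 0)) := by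
  rw [omegaContr, Finset.sum_mul, Finset.mul_sum,
    ← Finset.add_sum_erase _ _ (Finset.mem_univ r),
    ← Finset.add_sum_erase _ _ (Finset.mem_univ r), add_right_comm]
  congr 1
  · rw [mul_assoc, contrX_wedgeY_self, mul_sub, mul_one, ← mul_assoc,
      contrX_wedgeY_of_ne (some_zero_ne_some_one r r), neg_mul, mul_assoc]
    abel
  · refine Finset.sum_congr rfl fun p hp => ?_
    have hpr : (some (p, 1) : IdxY N) ≠ some (r, 1) := by simpa using Finset.ne_of_mem_erase hp
    rw [mul_assoc, contrX_wedgeY_of_ne hpr, mul_neg, ← mul_assoc,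
      contrX_wedgeY_of_ne (some_zero_ne_some_one p r), neg_mul, neg_neg, mul_assoc]

lemma omegaContr_mul_contrX (s : IdxY N) :
    omegaContr N * contrX s = contrX s * omegaContr N := by
  rw [omegaContr, Finset.sum_mul, Finset.mul_sum]
  refine Finset.sum_congr rfl fun p _ => ?_
  rw [mul_assoc, contrX_comm _ s, mul_neg, ← mul_assoc, contrX_comm _ s, neg_mul, neg_neg,
    mul_assoc]

lemma omegaContr_mul_wedgeY_none : omegaContr N * wedgeY none = wedgeY none * omegaContr N := by
  rw [omegaContr, Finset.sum_mul, Finset.mul_sum]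
  refine Finset.sum_congr rfl fun p _ => ?_
  rw [mul_assoc, contrX_wedgeY_of_ne (by simp), mul_neg, ← mul_assoc,
    contrX_wedgeY_of_ne (by simp), neg_mul, neg_neg, mul_assoc]

lemma omegaWedge_mul_wedgeY (s : IdxY N) :
    omegaWedge N * wedgeY s = wedgeY s * omegaWedge N := by
  rw [omegaWedge, Finset.sum_mul, Finset.mul_sum]
  refine Finset.sum_congr rfl fun p _ => ?_
  rw [mul_assoc, wedgeY_comm _ s, mul_neg, ← mul_assoc, wedgeY_comm _ s, neg_mul, neg_neg,
    mul_assoc]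

lemma contrX_none_mul_omegaWedge : contrX none * omegaWedge N = omegaWedge N * contrX none := by
  rw [omegaWedge, Finset.sum_mul, Finset.mul_sum]
  refine Finset.sum_congr rfl fun p _ => ?_
  rw [← mul_assoc, contrX_wedgeY_of_ne (by simp), neg_mul, mul_assoc,
    contrX_wedgeY_of_ne (by simp), mul_neg, neg_neg, mul_assoc]

/-- The weights of the number operator on the horizontal modes. -/
def horWeight : IdxY N → ℤ
  | none => 0
  | some _ => 1

/-- The weights of the number operator on the modes `(p, 0)`. -/
def zeroWeight : IdxY N → ℤ
  | none => 0
  | some (_, i) => if i = 0 then 1 else 0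

lemma weightOp_horWeight : weightOp (horWeight (N := N)) =
    ∑ p : Fin N, (num (some (p, 0)) + num (some (p, 1))) := by
  rw [weightOp, Fintype.sum_option, Fintype.sum_prod_type]
  simp [horWeight]

lemma weightOp_zeroWeight : weightOp (zeroWeight (N := N)) = ∑ p : Fin N, num (some (p, 0)) := by
  rw [weightOp, Fintype.sum_option, Fintype.sum_prod_type]
  simp [zeroWeight]

/-- The 𝔰𝔩₂ relation of the dual pair: the commutator counts occupied horizontal modes, centred at
half of their number 2N. -/
lemma omegaContr_mul_omegaWedge : omegaContr N * omegaWedge N =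
    omegaWedge N * omegaContr N + weightOp horWeight - (N : ℂ) • 1 := by
  rw [omegaWedge, Finset.mul_sum, Finset.sum_mul, weightOp_horWeight, ← Finset.sum_add_distrib]
  have : ((N : ℂ) • 1 : Module.End ℂ (Spinor N)) = ∑ _p : Fin N, 1 := by
    rw [Finset.sum_const, Finset.card_univ, Fintype.card_fin, Nat.cast_smul_eq_nsmul]
  rw [this, ← Finset.sum_sub_distrib]
  refine Finset.sum_congr rfl fun p _ => ?_
  rw [← mul_assoc, omegaContr_mul_wedgeY_zero, sub_mul, mul_assoc, omegaContr_mul_wedgeY_one,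
    mul_add, contrX_wedgeY_self, ← mul_assoc, num, num]
  abel

/-- The equations that characterize the `𝔰𝔭_ℂ(2n-2)`-invariant spinors. -/
def IsSpInvariant (ψ : Spinor N) : Prop := ∀ p r : Fin N,
  (wedgeY (some (r, 0)) * contrX (some (p, 0))) ψ = (wedgeY (some (p, 1)) * contrX (some (r, 1))) ψ

/-- Neither side of the defining equation commutes with the contraction, but the two correction
terms agree because contractions anticommute. -/
lemma IsSpInvariant.omegaContr {ψ : Spinor N} (h : IsSpInvariant ψ) :
    IsSpInvariant (omegaContr N ψ) := by
  intro p r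
  have e1 : wedgeY (some (r, 0)) * contrX (some (p, 0)) * SpSphere.omegaContr N =
      SpSphere.omegaContr N * (wedgeY (some (r, 0)) * contrX (some (p, 0))) +
        contrX (some (r, 1)) * contrX (some (p, 0)) := by
    rw [← mul_assoc, omegaContr_mul_wedgeY_zero, mul_assoc, ← omegaContr_mul_contrX, sub_mul,
      mul_assoc, sub_add_cancel]
  have e2 : wedgeY (some (p, 1)) * contrX (some (r, 1)) * SpSphere.omegaContr N =
      SpSphere.omegaContr N * (wedgeY (some (p, 1)) * contrX (some (r, 1))) -
        contrX (some (p, 0)) * contrX (some (r, 1)) := by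
    rw [← mul_assoc, omegaContr_mul_wedgeY_one, mul_assoc, ← omegaContr_mul_contrX, add_mul,
      mul_assoc, add_sub_cancel_right]
  rw [← Module.End.mul_apply, ← Module.End.mul_apply, e1, e2, contrX_comm (some (r, 1)),
    LinearMap.add_apply, LinearMap.sub_apply, Module.End.mul_apply (SpSphere.omegaContr N),
    Module.End.mul_apply (SpSphere.omegaContr N), h p r, LinearMap.neg_apply, sub_eq_add_neg]

/-- Both sides of the defining equation preserve the number of occupied modes (p, 0). -/
lemma IsSpInvariant.weightOp {ψ : Spinor N} (h : IsSpInvariant ψ) :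
    IsSpInvariant (weightOp zeroWeight ψ) := by
  intro p r
  have e1 : SpSphere.weightOp zeroWeight * (wedgeY (some (r, 0)) * contrX (some (p, 0))) =
      wedgeY (some (r, 0)) * contrX (some (p, 0)) * SpSphere.weightOp zeroWeight := by
    rw [← mul_assoc, weightOp_mul_wedgeY, add_mul, mul_assoc, weightOp_mul_contrX, mul_sub,
      mul_assoc]
    simp [zeroWeight]
  have e2 : SpSphere.weightOp zeroWeight * (wedgeY (some (p, 1)) * contrX (some (r, 1))) =
      wedgeY (some (p, 1)) * contrX (some (r, 1)) * SpSphere.weightOp zeroWeight := by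
    rw [← mul_assoc, weightOp_mul_wedgeY, add_mul, mul_assoc, weightOp_mul_contrX, mul_sub,
      mul_assoc]
    simp [zeroWeight]
  rw [← Module.End.mul_apply, ← Module.End.mul_apply, ← e1, ← e2, Module.End.mul_apply, h p r,
    ← Module.End.mul_apply]

/-- A Casimir identity: with M the number of occupied modes (p, 0), the composite acts on invariants
as -M(N + 1 - M). Invariance trades y_{(p,1)} x_{(r,1)} for y_{(r,0)} x_{(p,0)}, after which only
modes (p, 0) remain. -/
lemma IsSpInvariant.omegaWedge_omegaContr {ψ : Spinor N} (h : IsSpInvariant ψ) :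
    omegaWedge N (SpSphere.omegaContr N ψ) = -(SpSphere.weightOp zeroWeight
      (((N : ℂ) + 1) • ψ - SpSphere.weightOp zeroWeight ψ)) := by
  have key : ∀ p r : Fin N, (wedgeY (some (p, 0)) * wedgeY (some (p, 1)) *
      (contrX (some (r, 0)) * contrX (some (r, 1)))) ψ = -(num (some (p, 0)) ψ -
        (num (some (p, 0)) * num (some (r, 0))) ψ + if p = r then num (some (p, 0)) ψ else 0) := by
    intro p r
    have e1 : wedgeY (some (p, 0)) * wedgeY (some (p, 1)) *
        (contrX (some (r, 0)) * contrX (some (r, 1))) =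
        -(wedgeY (some (p, 0)) * contrX (some (r, 0)) *
          (wedgeY (some (p, 1)) * contrX (some (r, 1)))) := by
      rw [mul_assoc, ← mul_assoc (wedgeY (some (p, 1))),
        ← neg_eq_iff_eq_neg.2 (contrX_wedgeY_of_ne (some_zero_ne_some_one r p))]
      simp only [neg_mul, mul_neg, mul_assoc]
    have e2 : wedgeY (some (p, 0)) * contrX (some (r, 0)) *
        (wedgeY (some (r, 0)) * contrX (some (p, 0))) = num (some (p, 0)) -
          num (some (p, 0)) * num (some (r, 0)) + if p = r then num (some (p, 0)) else 0 := by
      rw [mul_assoc, ← mul_assoc (contrX _), contrX_wedgeY_self, sub_mul, one_mul, mul_sub]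
      by_cases hpr : p = r
      · subst hpr
        rw [if_pos rfl, num_sq, ← num, num_mul_contrX_self, mul_zero]
        abel
      · have : (some (r, 0) : IdxY N) ≠ some (p, 0) := by simpa using Ne.symm hpr
        rw [if_neg hpr, ← num.eq_def (some (r, 0)), num_mul_contrX_of_ne this, ← mul_assoc, ← num,
          add_zero]
    rw [e1, LinearMap.neg_apply, Module.End.mul_apply, ← h p r, ← Module.End.mul_apply, e2]
    by_cases hpr : p = r <;> simp [hpr]
  rw [← Module.End.mul_apply, omegaWedge, SpSphere.omegaContr, Finset.sum_mul_sum]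
  simp only [LinearMap.sum_apply, key]
  rw [weightOp_zeroWeight]
  simp only [LinearMap.sum_apply, map_sub, map_smul, map_sum, Finset.sum_neg_distrib,
    Finset.sum_add_distrib, Finset.sum_sub_distrib, Finset.sum_ite_eq, Finset.mem_univ, if_true,
    Finset.sum_const, Finset.card_univ, Fintype.card_fin, Module.End.mul_apply]
  rw [← Finset.smul_sum, ← Nat.cast_smul_eq_nsmul ℂ, add_smul, one_smul]
  congr 1
  rw [Finset.sum_comm, add_sub_right_comm]

/-- The spinors in which exactly the modes in `S` are occupied. -/
noncomputable def occupied (S : Finset (IdxY N)) : Submodule ℂ (Spinor N) :=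
  ⨅ s, LinearMap.ker (num s - (if s ∈ S then (1 : ℂ) else 0) • 1)

lemma mem_occupied {S : Finset (IdxY N)} {ψ : Spinor N} :
    ψ ∈ occupied S ↔ ∀ s, num s ψ = if s ∈ S then ψ else 0 := by
  simp only [occupied, Submodule.mem_iInf, LinearMap.mem_ker, LinearMap.sub_apply, sub_eq_zero]
  refine forall_congr' fun s => ?_
  by_cases h : s ∈ S <;> simp [h]

/-- This is the decomposition of Σ into the lines of monomials, phrased through occupation numbers.
-/
lemma iSup_occupied : ⨆ S, occupied (N := N) S = ⊤ := by
  refine iSup_eq_top_of_wedgeY _ ∅ ?_ fun t S η hη => ⟨insert t S, ?_⟩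
  · rw [mem_occupied]; intro s; simp [num_one]
  · rw [mem_occupied] at hη ⊢
    intro s
    rw [← Module.End.mul_apply]
    by_cases hst : s = t
    · subst hst
      rw [num_mul_wedgeY_self]; simp
    · rw [num_mul_wedgeY_of_ne hst, Module.End.mul_apply, hη s]
      by_cases hs : s ∈ S <;> simp [hs, hst]

/-- The weight spaces of `∑ₚ n_{(p,0)}`; the weight space of weight `0` is given by the stronger
condition that every summand vanishes. -/
noncomputable def zeroWeightSpace (k : ℕ) : Submodule ℂ (Spinor N) :=
  if k = 0 then ⨅ p : Fin N, LinearMap.ker (num (some (p, 0)))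
  else Module.End.eigenspace (weightOp zeroWeight) (k : ℂ)

lemma weightOp_of_mem_zeroWeightSpace {k : ℕ} {x : Spinor N} (hx : x ∈ zeroWeightSpace k) :
    weightOp zeroWeight x = (k : ℂ) • x := by
  by_cases hk : k = 0
  · simp only [zeroWeightSpace, hk, if_true, Submodule.mem_iInf, LinearMap.mem_ker] at hx
    rw [weightOp_zeroWeight, LinearMap.sum_apply, hk]
    simp [hx]
  · simp only [zeroWeightSpace, hk, if_false] at hx
    exact Module.End.mem_eigenspace_iff.1 hx

/-- There are only N modes (p, 0), so the weight of a monomial, being the number of those it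
contains, is at most N. -/
lemma iSup_zeroWeightSpace : ⨆ k : Fin (N + 1), zeroWeightSpace (N := N) k = ⊤ := by
  classical
  rw [eq_top_iff, ← iSup_occupied]
  refine iSup_le fun S x hx => ?_
  rw [mem_occupied] at hx
  set A := (Finset.univ : Finset (Fin N)).filter fun p => (some (p, 0) : IdxY N) ∈ S with hA
  have hcard : A.card < N + 1 := by
    have := Finset.card_le_univ A
    rw [Fintype.card_fin] at this
    omega
  refine Submodule.mem_iSup_of_mem ⟨A.card, hcard⟩ ?_
  by_cases hk : A.card = 0
  · simp only [zeroWeightSpace, hk, if_true, Submodule.mem_iInf, LinearMap.mem_ker]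
    intro p
    rw [hx, if_neg]
    intro hp
    have : p ∈ A := Finset.mem_filter.2 ⟨Finset.mem_univ _, hp⟩
    rw [Finset.card_eq_zero.1 hk] at this
    exact absurd this (Finset.notMem_empty _)
  · simp only [zeroWeightSpace, hk, if_false]
    rw [Module.End.mem_eigenspace_iff, weightOp_zeroWeight, LinearMap.sum_apply]
    simp only [hx]
    rw [← Finset.sum_filter, Finset.sum_const, Nat.cast_smul_eq_nsmul]

lemma mem_iSup_inf_zeroWeightSpace {p : Submodule ℂ (Spinor N)}
    (hp : ∀ x ∈ p, weightOp zeroWeight x ∈ p) {ψ : Spinor N} (hψ : ψ ∈ p) :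
    ψ ∈ ⨆ k : Fin (N + 1), p ⊓ zeroWeightSpace (N := N) k :=
  mem_iSup_inf_of_stable (weightOp zeroWeight) (μ := fun k : Fin (N + 1) => ((k : ℕ) : ℂ))
    (Nat.cast_injective.comp Fin.val_injective) (fun _ _ hx => weightOp_of_mem_zeroWeightSpace hx)
    hp hψ (iSup_zeroWeightSpace ▸ Submodule.mem_top)

/-- An eigenvector of `∑ₚ n_{(p,0)}` lies in the weight space, and it is zero if the weight is
too large. -/
lemma eq_zero_or_mem_zeroWeightSpace {k : ℕ} {ψ : Spinor N}
    (h : weightOp zeroWeight ψ = (k : ℂ) • ψ) :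
    ψ = 0 ∨ k < N + 1 ∧ ψ ∈ zeroWeightSpace k := by
  have := mem_iSup_inf_zeroWeightSpace (p := Module.End.eigenspace (weightOp zeroWeight) (k : ℂ))
    (fun x hx => by
      rw [Module.End.mem_eigenspace_iff] at hx
      rw [hx]; exact Submodule.smul_mem _ _ (Module.End.mem_eigenspace_iff.2 hx))
    (Module.End.mem_eigenspace_iff.2 h)
  have hz : ∀ j : Fin (N + 1), (j : ℕ) ≠ k → ∀ x ∈ Module.End.eigenspace
      (weightOp zeroWeight) (k : ℂ) ⊓ zeroWeightSpace (N := N) j, x = 0 := by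
    rintro j hj x ⟨h1, h2⟩
    rw [SetLike.mem_coe, Module.End.mem_eigenspace_iff, weightOp_of_mem_zeroWeightSpace h2] at h1
    by_contra hx
    exact hj (Nat.cast_injective (smul_left_injective ℂ hx h1))
  by_cases hk : k < N + 1
  · refine Or.inr ⟨hk, (iSup_le fun j => ?_ : _ ≤ zeroWeightSpace k) this⟩
    intro x hx
    by_cases hj : (j : ℕ) = k
    · rw [← hj]; exact hx.2
    · rw [hz j hj x hx]; exact Submodule.zero_mem _
  · left
    refine (iSup_le fun j => ?_ : _ ≤ (⊥ : Submodule ℂ (Spinor N))) this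
    intro x hx
    exact hz j (by omega) x hx

/-- The span of the spinors `ωᵏ` and `y₁ ∧ ωᵏ`. -/
noncomputable def omegaSpan (N : ℕ) : Submodule ℂ (Spinor N) :=
  Submodule.span ℂ (Set.range fun k : ℕ => ω N ^ k) ⊔
    Submodule.span ℂ (Set.range fun k : ℕ => y₁ N * ω N ^ k)

lemma omega_pow_mem (k : ℕ) : ω N ^ k ∈ omegaSpan N :=
  Submodule.mem_sup_left (Submodule.subset_span ⟨k, rfl⟩)

lemma y₁_mul_omega_pow_mem (k : ℕ) : y₁ N * ω N ^ k ∈ omegaSpan N :=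
  Submodule.mem_sup_right (Submodule.subset_span ⟨k, rfl⟩)

lemma omega_mul_y₁ : ω N * y₁ N = y₁ N * ω N := by
  have := LinearMap.congr_fun (omegaWedge_mul_wedgeY (N := N) none) 1
  simpa [omegaWedge_apply, wedgeY_apply, y₁] using this

lemma omegaWedge_mem_omegaSpan {ψ : Spinor N} (h : ψ ∈ omegaSpan N) :
    omegaWedge N ψ ∈ omegaSpan N := by
  refine (sup_le ?_ ?_ : omegaSpan N ≤ (omegaSpan N).comap (omegaWedge N)) h
  · refine Submodule.span_le.2 ?_
    rintro _ ⟨k, rfl⟩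
    change omegaWedge N (ω N ^ k) ∈ omegaSpan N
    rw [omegaWedge_apply, ← pow_succ']
    exact omega_pow_mem _
  · refine Submodule.span_le.2 ?_
    rintro _ ⟨k, rfl⟩
    change omegaWedge N (y₁ N * ω N ^ k) ∈ omegaSpan N
    rw [omegaWedge_apply, ← mul_assoc, omega_mul_y₁, mul_assoc, ← pow_succ']
    exact y₁_mul_omega_pow_mem _

/-- Split ψ = x₁(y₁ψ) + y₁(x₁ψ). Both x₁(y₁ψ) and x₁ψ are killed by all contractions, hence scalars,
so ψ is a combination of 1 and y₁. -/
lemma mem_omegaSpan_of_contrX {ψ : Spinor N} (h : ∀ s : Fin N × Fin 2, contrX (some s) ψ = 0) :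
    ψ ∈ omegaSpan N := by
  have h1 : (contrX none * wedgeY none : Module.End ℂ (Spinor N)) ψ ∈ Submodule.span ℂ {(1 : Spinor N)} := by
    refine mem_span_one_of_contrX fun s => ?_
    rcases s with _ | s
    · rw [← Module.End.mul_apply, ← mul_assoc, contrX_sq, zero_mul, LinearMap.zero_apply]
    · rw [← Module.End.mul_apply, ← mul_assoc, contrX_comm, neg_mul, mul_assoc,
        contrX_wedgeY_of_ne (by simp), mul_neg, neg_neg, ← mul_assoc, Module.End.mul_apply, h,
        map_zero]
  have h2 : contrX none ψ ∈ Submodule.span ℂ {(1 : Spinor N)} := by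
    refine mem_span_one_of_contrX fun s => ?_
    rcases s with _ | s
    · rw [← Module.End.mul_apply, contrX_sq, LinearMap.zero_apply]
    · rw [← Module.End.mul_apply, contrX_comm, LinearMap.neg_apply, Module.End.mul_apply, h,
        map_zero, neg_zero]
  obtain ⟨r, hr⟩ := Submodule.mem_span_singleton.1 h1
  obtain ⟨t, ht⟩ := Submodule.mem_span_singleton.1 h2
  have : ψ = r • 1 + t • (y₁ N * 1) := by
    rw [hr, mul_one, contrX_wedgeY_self, LinearMap.sub_apply, Module.End.mul_apply, ← ht, map_smul,
      wedgeY_apply, mul_one, y₁]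
    simp
  rw [this]
  exact Submodule.add_mem _ (Submodule.smul_mem _ _ (by simpa using omega_pow_mem (N := N) 0))
    (Submodule.smul_mem _ _ (by simpa using y₁_mul_omega_pow_mem (N := N) 0))

lemma weightOp_omegaContr (ψ : Spinor N) : weightOp zeroWeight (omegaContr N ψ) =
    omegaContr N (weightOp zeroWeight ψ) - omegaContr N ψ := by
  have : weightOp zeroWeight * omegaContr N = omegaContr N * weightOp zeroWeight -
      omegaContr N := by
    rw [omegaContr, Finset.mul_sum, Finset.sum_mul, ← Finset.sum_sub_distrib]
    refine Finset.sum_congr rfl fun p _ => ?_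
    rw [← mul_assoc, weightOp_mul_contrX, sub_mul, mul_assoc, weightOp_mul_contrX, mul_sub,
      mul_assoc]
    simp [zeroWeight]
  exact LinearMap.congr_fun this ψ

/-- The first fundamental theorem: the invariant spinors are spanned by `ωᵏ` and `y₁ ∧ ωᵏ`. -/
lemma IsSpInvariant.mem_omegaSpan {ψ : Spinor N} (h : IsSpInvariant ψ) : ψ ∈ omegaSpan N := by
  -- Induction on the weight, which the contraction lowers by one while preserving invariance.
  have key : ∀ (k : ℕ) (ψ : Spinor N), IsSpInvariant ψ →
      SpSphere.weightOp zeroWeight ψ = (k : ℂ) • ψ → ψ ∈ omegaSpan N := by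
    intro k
    induction k with
    | zero =>
      intro ψ hψ hk
      rcases eq_zero_or_mem_zeroWeightSpace hk with rfl | ⟨-, h0⟩
      · exact Submodule.zero_mem _
      simp only [zeroWeightSpace, if_true, Submodule.mem_iInf, LinearMap.mem_ker] at h0
      refine mem_omegaSpan_of_contrX ?_
      rintro ⟨p, i⟩
      have hn : num (some (p, i)) ψ = 0 := by
        fin_cases i
        · exact h0 p
        -- The diagonal equation equates the occupation numbers of (p, 0) and (p, 1), so an
        -- invariant with all modes (p, 0) empty has no horizontal modes at all.
        · have := hψ p p
          change num _ ψ = num _ ψ at this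
          rw [h0 p] at this
          exact this.symm
      rw [← contrX_mul_num_self, Module.End.mul_apply, hn, map_zero]
    | succ k ih =>
      intro ψ hψ hk
      rcases eq_zero_or_mem_zeroWeightSpace hk with rfl | ⟨hlt, -⟩
      · exact Submodule.zero_mem _
      have h1 : SpSphere.omegaContr N ψ ∈ omegaSpan N := by
        refine ih _ hψ.omegaContr ?_
        rw [weightOp_omegaContr, hk, map_smul]
        push_cast
        rw [add_smul, one_smul, add_sub_cancel_right]
      have h2 := omegaWedge_mem_omegaSpan h1
      -- In weight k + 1 the Casimir scalar is -(k + 1)(N - k). It is nonzero since the weight of a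
      -- nonzero ψ is at most N, so ψ is a multiple of ω ∧ (contraction of ψ).
      rw [hψ.omegaWedge_omegaContr, hk, ← sub_smul, map_smul, hk, smul_smul, ← neg_smul] at h2
      refine ((omegaSpan N).smul_mem_iff ?_).1 h2
      refine neg_ne_zero.2 (mul_ne_zero ?_ (Nat.cast_ne_zero.2 (Nat.succ_ne_zero k)))
      rw [sub_ne_zero]
      have : N + 1 ≠ k + 1 := by omega
      exact_mod_cast this
  let p : Submodule ℂ (Spinor N) := ⨅ (p : Fin N) (r : Fin N), LinearMap.ker
    (wedgeY (some (r, 0)) * contrX (some (p, 0)) - wedgeY (some (p, 1)) * contrX (some (r, 1)))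
  have hp : ∀ x, x ∈ p ↔ IsSpInvariant x := by
    intro x
    simp only [p, Submodule.mem_iInf, LinearMap.mem_ker, LinearMap.sub_apply, sub_eq_zero]
    rfl
  -- The invariants are stable under the weight operator, so each homogeneous component of ψ is
  -- again invariant.
  have := mem_iSup_inf_zeroWeightSpace (p := p)
    (fun x hx => (hp _).2 ((hp x).1 hx).weightOp) ((hp ψ).2 h)
  refine (iSup_le fun k => ?_ : _ ≤ omegaSpan N) this
  rintro x ⟨h1, h2⟩
  exact key k x ((hp x).1 h1) (weightOp_of_mem_zeroWeightSpace h2)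

end Howe

/-! ### Clebsch–Gordan decomposition of the span of ωᵏ and y₁ ∧ ωᵏ. -/

section Chain

variable {N : ℕ}

lemma weightOp_omega_pow (m : IdxY N → ℤ) (c : ℤ)
    (hm : ∀ p, m (some (p, 0)) + m (some (p, 1)) = c) (k : ℕ) :
    weightOp m (ω N ^ k) = ((k * c : ℤ) : ℂ) • ω N ^ k := by
  have hW : weightOp m * omegaWedge N = omegaWedge N * weightOp m + (c : ℂ) • omegaWedge N := by
    rw [omegaWedge, Finset.mul_sum, Finset.sum_mul, Finset.smul_sum, ← Finset.sum_add_distrib]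
    refine Finset.sum_congr rfl fun p _ => ?_
    rw [← mul_assoc, weightOp_mul_wedgeY, add_mul, mul_assoc, weightOp_mul_wedgeY, mul_add,
      ← mul_assoc, smul_mul_assoc, mul_smul_comm, add_assoc, ← add_smul, ← hm p]
    push_cast
    rw [add_comm (m (some (p, 1)) : ℂ)]
  induction k with
  | zero => rw [pow_zero, weightOp_one]; simp
  | succ k ih =>
    rw [pow_succ', ← omegaWedge_apply, ← Module.End.mul_apply, hW, LinearMap.add_apply,
      Module.End.mul_apply, ih, map_smul, LinearMap.smul_apply, ← add_smul]
    congr 1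
    push_cast
    ring

/-- The power ωᵏ would have weight k in the modes (p, 0), but weights do not exceed N. -/
lemma omega_pow_eq_zero {k : ℕ} (hk : N < k) : ω N ^ k = 0 := by
  have h := weightOp_omega_pow (N := N) zeroWeight 1 (fun p => by simp [zeroWeight]) k
  rw [mul_one] at h
  rcases eq_zero_or_mem_zeroWeightSpace (k := k) (by simpa using h) with h | ⟨h, -⟩
  · exact h
  · omega

/-- By the 𝔰𝔩₂ relation, moving the contraction past ω in front of ωʲ costs 2j - N; the coefficient
is the sum of these for j = 0, …, k. -/
lemma omegaContr_omega_pow_succ (k : ℕ) :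
    omegaContr N (ω N ^ (k + 1)) = (-((k + 1 : ℂ) * (N - k))) • ω N ^ k := by
  have hrec : ∀ k : ℕ, omegaContr N (ω N ^ (k + 1)) =
      omegaWedge N (omegaContr N (ω N ^ k)) + (2 * (k : ℂ) - N) • ω N ^ k := by
    intro k
    have h := weightOp_omega_pow (N := N) horWeight 2 (fun p => by simp [horWeight]) k
    rw [pow_succ', ← omegaWedge_apply, ← Module.End.mul_apply, omegaContr_mul_omegaWedge,
      LinearMap.sub_apply, LinearMap.add_apply, h, Module.End.mul_apply, LinearMap.smul_apply,
      Module.End.one_apply, add_sub_assoc, ← sub_smul]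
    push_cast
    rw [mul_comm (k : ℂ)]
  induction k with
  | zero =>
    rw [hrec, pow_zero]
    have : omegaContr N (1 : Spinor N) = 0 := by
      simp [omegaContr, LinearMap.sum_apply, contrX_one]
    rw [this, map_zero]
    simp
  | succ k ih =>
    rw [hrec, ih, map_smul, omegaWedge_apply, ← pow_succ', ← add_smul]
    congr 1
    push_cast
    ring

lemma omegaContr_y₁_mul (η : Spinor N) : omegaContr N (y₁ N * η) = y₁ N * omegaContr N η :=
  LinearMap.congr_fun (omegaContr_mul_wedgeY_none (N := N)) η

lemma parity_omega_pow (k : ℕ) : parity N (ω N ^ k) = ω N ^ k := by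
  have h1 : ∀ s : IdxY N, CliffordAlgebra.involute (y s) = -y s := fun s =>
    CliffordAlgebra.involute_ι _
  have h2 : CliffordAlgebra.involute (ω N) = ω N := by
    simp only [ω, map_sum, map_mul, h1, neg_mul_neg]
  change CliffordAlgebra.involute (ω N ^ k) = ω N ^ k
  rw [map_pow, h2]

lemma parity_y₁_mul (η : Spinor N) : parity N (y₁ N * η) = -(y₁ N * parity N η) := by
  have := LinearMap.congr_fun (eq_neg_of_add_eq_zero_left (parity_wedge (N := N) none)) η
  exact this

lemma contrX_none_omega_pow (k : ℕ) : contrX none (ω N ^ k) = 0 := by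
  induction k with
  | zero => rw [pow_zero, contrX_one]
  | succ k ih =>
    rw [pow_succ', ← omegaWedge_apply, ← Module.End.mul_apply, contrX_none_mul_omegaWedge,
      Module.End.mul_apply, ih, map_zero]

lemma contrX_none_y₁_mul_omega_pow (k : ℕ) : contrX none (y₁ N * ω N ^ k) = ω N ^ k := by
  have := LinearMap.congr_fun (contrX_wedgeY_self (N := N) none) (ω N ^ k)
  rw [LinearMap.sub_apply, Module.End.mul_apply, Module.End.mul_apply, contrX_none_omega_pow,
    map_zero, sub_zero] at this
  exact this

lemma y₁_mul_y₁ : y₁ N * y₁ N = 0 := ExteriorAlgebra.ι_sq_zero _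

/-- The operator by which `(T_k - i T_j) / 2 ∈ 𝔰𝔭_ℂ(2)` acts. -/
noncomputable def raiseOp (N : ℕ) : Module.End ℂ (Spinor N) :=
  omegaWedge N + Complex.I • (parity N * wedgeY none)

/-- The operator by which `(T_k + i T_j) / 2 ∈ 𝔰𝔭_ℂ(2)` acts. -/
noncomputable def lowerOp (N : ℕ) : Module.End ℂ (Spinor N) :=
  omegaContr N - Complex.I • (parity N * contrX none)

/-- The weights of the operator by which `T_i` acts. -/
def diagWeight : IdxY N → ℤ
  | none => 2
  | some _ => 1

/-- The operator by which `-i T_i ∈ 𝔰𝔭_ℂ(2)` acts. -/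
noncomputable def cartanOp (N : ℕ) : Module.End ℂ (Spinor N) :=
  ((N : ℂ) + 1) • 1 - weightOp diagWeight

lemma raiseOp_omega_pow (k : ℕ) :
    raiseOp N (ω N ^ k) = ω N ^ (k + 1) - Complex.I • (y₁ N * ω N ^ k) := by
  rw [raiseOp, LinearMap.add_apply, omegaWedge_apply, ← pow_succ', LinearMap.smul_apply,
    Module.End.mul_apply, wedgeY_apply]
  change _ + Complex.I • parity N (y₁ N * ω N ^ k) = _
  rw [parity_y₁_mul, parity_omega_pow, smul_neg, sub_eq_add_neg]

lemma raiseOp_y₁_mul (k : ℕ) : raiseOp N (y₁ N * ω N ^ k) = y₁ N * ω N ^ (k + 1) := by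
  rw [raiseOp, LinearMap.add_apply, omegaWedge_apply, ← mul_assoc, omega_mul_y₁, mul_assoc,
    ← pow_succ', LinearMap.smul_apply, Module.End.mul_apply, wedgeY_apply]
  change _ + Complex.I • parity N (y₁ N * (y₁ N * ω N ^ k)) = _
  rw [← mul_assoc, y₁_mul_y₁, zero_mul, map_zero, smul_zero, add_zero]

lemma lowerOp_one : lowerOp N 1 = 0 := by
  simp [lowerOp, omegaContr, LinearMap.sum_apply, contrX_one]

lemma lowerOp_omega_pow_succ (k : ℕ) :
    lowerOp N (ω N ^ (k + 1)) = (-((k + 1 : ℂ) * (N - k))) • ω N ^ k := by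
  rw [lowerOp, LinearMap.sub_apply, omegaContr_omega_pow_succ, LinearMap.smul_apply,
    Module.End.mul_apply, contrX_none_omega_pow, map_zero, smul_zero, sub_zero]

lemma lowerOp_y₁_mul_omega_pow_succ (k : ℕ) : lowerOp N (y₁ N * ω N ^ (k + 1)) =
    (-((k + 1 : ℂ) * (N - k))) • (y₁ N * ω N ^ k) - Complex.I • ω N ^ (k + 1) := by
  rw [lowerOp, LinearMap.sub_apply, omegaContr_y₁_mul, omegaContr_omega_pow_succ,
    LinearMap.smul_apply, Module.End.mul_apply, contrX_none_y₁_mul_omega_pow, parity_omega_pow,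
    mul_smul_comm]

lemma lowerOp_y₁ : lowerOp N (y₁ N) = -(Complex.I • 1) := by
  have h := contrX_none_y₁_mul_omega_pow (N := N) 0
  have h' := omegaContr_y₁_mul (1 : Spinor N)
  have h'' : omegaContr N (1 : Spinor N) = 0 := by
    simp [omegaContr, LinearMap.sum_apply, contrX_one]
  have hp := parity_omega_pow (N := N) 0
  rw [pow_zero] at h hp
  rw [mul_one] at h h'
  rw [lowerOp, LinearMap.sub_apply, h', h'', mul_zero, LinearMap.smul_apply, Module.End.mul_apply,
    h, hp, zero_sub]

/-- A basis of weight vectors of the summand of dimension `n + 1`. -/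
noncomputable def bigVec (N k : ℕ) : Spinor N :=
  -- This is (ω - i y₁)ᵏ. At k = 0 the exponent is truncated to 0, harmlessly because the
  -- coefficient vanishes.
  ω N ^ k - ((k : ℂ) * Complex.I) • (y₁ N * ω N ^ (k - 1))

/-- A basis of weight vectors of the summand of dimension `n - 1`. -/
noncomputable def smallVec (N k : ℕ) : Spinor N :=
  -- For k = 0 the combination ω + N i y₁ is the one killed by `lowerOp`; the others are its
  -- multiples by (ω - i y₁)ᵏ.
  ω N ^ (k + 1) + (((N : ℂ) - k) * Complex.I) • (y₁ N * ω N ^ k)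

/-- On the span of ωᵏ and y₁ ∧ ωᵏ the raising operator is multiplication by ω - i y₁. -/
lemma raiseOp_bigVec (k : ℕ) : raiseOp N (bigVec N k) = bigVec N (k + 1) := by
  rcases k with _ | k
  · have h := raiseOp_omega_pow (N := N) 0
    simpa [bigVec] using h
  · simp only [bigVec, map_sub, map_smul, raiseOp_omega_pow, raiseOp_y₁_mul, Nat.add_sub_cancel]
    push_cast
    module

lemma raiseOp_smallVec (k : ℕ) : raiseOp N (smallVec N k) = smallVec N (k + 1) := by
  simp only [smallVec, map_add, map_smul, raiseOp_omega_pow, raiseOp_y₁_mul]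
  push_cast
  module

lemma lowerOp_bigVec_zero : lowerOp N (bigVec N 0) = 0 := by
  simp [bigVec, lowerOp_one]

/-- Up to sign, these are the structure constants of the irreducible 𝔰𝔩₂-module of dimension N + 2.
-/
lemma lowerOp_bigVec_succ (k : ℕ) :
    lowerOp N (bigVec N (k + 1)) = (-((k + 1 : ℂ) * (N + 1 - k))) • bigVec N k := by
  have hI : Complex.I * Complex.I = -1 := Complex.I_mul_I
  rcases k with _ | k
  · have h := lowerOp_omega_pow_succ (N := N) 0
    simp only [bigVec, map_sub, map_smul, h, Nat.add_sub_cancel, pow_zero, mul_one, lowerOp_y₁,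
      smul_neg, smul_smul]
    simp only [mul_assoc, hI]
    push_cast
    module
  · simp only [bigVec, map_sub, map_smul, lowerOp_omega_pow_succ, Nat.add_sub_cancel,
      lowerOp_y₁_mul_omega_pow_succ, smul_sub, smul_smul]
    simp only [mul_assoc, hI]
    push_cast
    module

lemma lowerOp_smallVec_zero : lowerOp N (smallVec N 0) = 0 := by
  have hI : Complex.I * Complex.I = -1 := Complex.I_mul_I
  have h := lowerOp_omega_pow_succ (N := N) 0
  simp only [smallVec, map_add, map_smul, h, pow_zero, mul_one, lowerOp_y₁, smul_neg, smul_smul]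
  simp only [mul_assoc, hI]
  push_cast
  module

/-- The same constants for the module of dimension N. -/
lemma lowerOp_smallVec_succ (k : ℕ) :
    lowerOp N (smallVec N (k + 1)) = (-((k + 1 : ℂ) * (N - (k + 1)))) • smallVec N k := by
  have hI : Complex.I * Complex.I = -1 := Complex.I_mul_I
  simp only [smallVec, map_add, map_smul, lowerOp_omega_pow_succ, lowerOp_y₁_mul_omega_pow_succ,
    smul_sub, smul_add, smul_smul]
  simp only [mul_assoc, hI]
  push_cast
  module

lemma weightOp_diagWeight_omega_pow (k : ℕ) :
    weightOp diagWeight (ω N ^ k) = (2 * k : ℂ) • ω N ^ k := by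
  rw [weightOp_omega_pow diagWeight 2 (fun p => by simp [diagWeight])]
  push_cast
  rw [mul_comm]

lemma weightOp_diagWeight_y₁_mul (k : ℕ) :
    weightOp diagWeight (y₁ N * ω N ^ k) = (2 * (k + 1) : ℂ) • (y₁ N * ω N ^ k) := by
  have := weightOp_wedgeY (N := N) (m := diagWeight) (s := none) (k := 2 * k)
    (by rw [weightOp_diagWeight_omega_pow]; push_cast; rfl)
  rw [show y₁ N * ω N ^ k = wedgeY none (ω N ^ k) from rfl, this]
  congr 1
  simp only [diagWeight]
  push_cast
  ring

lemma cartanOp_bigVec (k : ℕ) :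
    cartanOp N (bigVec N k) = ((N : ℂ) + 1 - 2 * k) • bigVec N k := by
  rcases k with _ | k
  · simp only [bigVec, cartanOp, LinearMap.sub_apply, LinearMap.smul_apply, Module.End.one_apply,
      map_sub, map_smul, weightOp_diagWeight_omega_pow]
    push_cast
    simp
  · simp only [bigVec, cartanOp, LinearMap.sub_apply, LinearMap.smul_apply, Module.End.one_apply,
      map_sub, map_smul, weightOp_diagWeight_omega_pow, weightOp_diagWeight_y₁_mul,
      Nat.add_sub_cancel]
    push_cast
    module

lemma cartanOp_smallVec (k : ℕ) :
    cartanOp N (smallVec N k) = ((N : ℂ) - 1 - 2 * k) • smallVec N k := by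
  simp only [smallVec, cartanOp, LinearMap.sub_apply, LinearMap.smul_apply, Module.End.one_apply,
    map_add, map_smul, weightOp_diagWeight_omega_pow, weightOp_diagWeight_y₁_mul]
  push_cast
  module

/-- The string ends one step later than the powers of ω do: at index N + 1 the multiple of y₁ ∧ ω^N
still survives. -/
lemma bigVec_eq_zero : bigVec N (N + 2) = 0 := by
  rw [bigVec, omega_pow_eq_zero (by omega), omega_pow_eq_zero (by omega)]
  simp

/-- At k = N the coefficient N - k vanishes together with ω^{N+1}. -/
lemma smallVec_eq_zero : smallVec N N = 0 := by
  rw [smallVec, omega_pow_eq_zero (by omega)]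
  simp

/-- The summand of dimension `n + 1`. -/
noncomputable def bigSummand (N : ℕ) : Submodule ℂ (Spinor N) :=
  Submodule.span ℂ (Set.range fun k : Fin (N + 2) => bigVec N k)

/-- The summand of dimension `n - 1`. -/
noncomputable def smallSummand (N : ℕ) : Submodule ℂ (Spinor N) :=
  Submodule.span ℂ (Set.range fun k : Fin N => smallVec N k)

lemma bigWeight_injective : Function.Injective fun k : ℕ => (N : ℂ) + 1 - 2 * k := by
  intro j k h
  have : (j : ℂ) = k := by
    have h' : (N : ℂ) + 1 - 2 * j = (N : ℂ) + 1 - 2 * k := h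
    linear_combination (-1 / 2 : ℂ) * h'
  exact_mod_cast this

lemma smallWeight_injective : Function.Injective fun k : ℕ => (N : ℂ) - 1 - 2 * k := by
  intro j k h
  have : (j : ℂ) = k := by
    have h' : (N : ℂ) - 1 - 2 * j = (N : ℂ) - 1 - 2 * k := h
    linear_combination (-1 / 2 : ℂ) * h'
  exact_mod_cast this

lemma lowerOp_bigVec_ne (j : ℕ) (hj : j + 1 < N + 2) :
    ∃ β : ℂ, β ≠ 0 ∧ lowerOp N (bigVec N (j + 1)) = β • bigVec N j := by
  refine ⟨_, ?_, lowerOp_bigVec_succ j⟩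
  refine neg_ne_zero.2 (mul_ne_zero (by exact_mod_cast Nat.succ_ne_zero j) (sub_ne_zero.2 ?_))
  have : N + 1 ≠ j := by omega
  exact_mod_cast this

lemma lowerOp_smallVec_ne (j : ℕ) (hj : j + 1 < N) :
    ∃ β : ℂ, β ≠ 0 ∧ lowerOp N (smallVec N (j + 1)) = β • smallVec N j := by
  refine ⟨_, ?_, lowerOp_smallVec_succ j⟩
  refine neg_ne_zero.2 (mul_ne_zero (by exact_mod_cast Nat.succ_ne_zero j) (sub_ne_zero.2 ?_))
  have : N ≠ j + 1 := by omega
  exact_mod_cast this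

lemma smallVec_zero_ne_zero (hN : 0 < N) : smallVec N 0 ≠ 0 := by
  intro h
  have h1 := congrArg (contrX none) h
  rw [smallVec, map_add, map_smul, contrX_none_omega_pow, contrX_none_y₁_mul_omega_pow, map_zero,
    zero_add, pow_zero] at h1
  have h2 := (smul_eq_zero.1 h1).resolve_right one_ne_zero
  have h3 : (N : ℂ) ≠ 0 := Nat.cast_ne_zero.2 hN.ne'
  simp [h3] at h2

lemma finrank_bigSummand : Module.finrank ℂ (bigSummand N) = N + 2 :=
  finrank_chain bigWeight_injective cartanOp_bigVec
    (chain_ne_zero lowerOp_bigVec_ne fun _ => by simp [bigVec])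

lemma finrank_smallSummand : Module.finrank ℂ (smallSummand N) = N :=
  finrank_chain smallWeight_injective cartanOp_smallVec
    (chain_ne_zero lowerOp_smallVec_ne smallVec_zero_ne_zero)

lemma bigVec_mem (k : ℕ) (hk : k < N + 2) : bigVec N k ∈ bigSummand N :=
  Submodule.subset_span ⟨⟨k, hk⟩, rfl⟩

lemma smallVec_mem (k : ℕ) (hk : k < N) : smallVec N k ∈ smallSummand N :=
  Submodule.subset_span ⟨⟨k, hk⟩, rfl⟩

/-- The operators that generate the action of `𝔰𝔭_ℂ(2)` preserve `U`. -/
def ChainStable (U : Submodule ℂ (Spinor N)) : Prop :=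
  ∀ ψ ∈ U, cartanOp N ψ ∈ U ∧ raiseOp N ψ ∈ U ∧ lowerOp N ψ ∈ U

lemma chainStable_bigSummand : ChainStable (bigSummand N) := by
  intro ψ hψ
  refine ⟨?_, ?_, ?_⟩
  · refine (Submodule.span_le.2 ?_ : bigSummand N ≤ (bigSummand N).comap (cartanOp N)) hψ
    rintro _ ⟨k, rfl⟩
    change cartanOp N (bigVec N k) ∈ bigSummand N
    rw [cartanOp_bigVec]
    exact Submodule.smul_mem _ _ (bigVec_mem k k.2)
  · refine (Submodule.span_le.2 ?_ : bigSummand N ≤ (bigSummand N).comap (raiseOp N)) hψ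
    rintro _ ⟨⟨k, hk⟩, rfl⟩
    change raiseOp N (bigVec N k) ∈ bigSummand N
    rw [raiseOp_bigVec]
    rcases Nat.lt_or_ge (k + 1) (N + 2) with h | h
    · exact bigVec_mem _ h
    · rw [show k + 1 = N + 2 by omega, bigVec_eq_zero]
      exact Submodule.zero_mem _
  · refine (Submodule.span_le.2 ?_ : bigSummand N ≤ (bigSummand N).comap (lowerOp N)) hψ
    rintro _ ⟨⟨k, hk⟩, rfl⟩
    change lowerOp N (bigVec N k) ∈ bigSummand N
    rcases k with _ | k
    · rw [lowerOp_bigVec_zero]; exact Submodule.zero_mem _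
    · rw [lowerOp_bigVec_succ]
      exact Submodule.smul_mem _ _ (bigVec_mem _ (by omega))

lemma chainStable_smallSummand : ChainStable (smallSummand N) := by
  intro ψ hψ
  refine ⟨?_, ?_, ?_⟩
  · refine (Submodule.span_le.2 ?_ : smallSummand N ≤ (smallSummand N).comap (cartanOp N)) hψ
    rintro _ ⟨k, rfl⟩
    change cartanOp N (smallVec N k) ∈ smallSummand N
    rw [cartanOp_smallVec]
    exact Submodule.smul_mem _ _ (smallVec_mem k k.2)
  · refine (Submodule.span_le.2 ?_ : smallSummand N ≤ (smallSummand N).comap (raiseOp N)) hψ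
    rintro _ ⟨⟨k, hk⟩, rfl⟩
    change raiseOp N (smallVec N k) ∈ smallSummand N
    rw [raiseOp_smallVec]
    rcases Nat.lt_or_ge (k + 1) N with h | h
    · exact smallVec_mem _ h
    · rw [show k + 1 = N by omega, smallVec_eq_zero]
      exact Submodule.zero_mem _
  · refine (Submodule.span_le.2 ?_ : smallSummand N ≤ (smallSummand N).comap (lowerOp N)) hψ
    rintro _ ⟨⟨k, hk⟩, rfl⟩
    change lowerOp N (smallVec N k) ∈ smallSummand N
    rcases k with _ | k
    · rw [lowerOp_smallVec_zero]; exact Submodule.zero_mem _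
    · rw [lowerOp_smallVec_succ]
      exact Submodule.smul_mem _ _ (smallVec_mem _ (by omega))

lemma bigSummand_irreducible {U : Submodule ℂ (Spinor N)} (hU : U ≤ bigSummand N)
    (h : ChainStable U) : U = ⊥ ∨ U = bigSummand N :=
  chain_irreducible bigWeight_injective cartanOp_bigVec raiseOp_bigVec lowerOp_bigVec_ne hU
    (fun v hv => (h v hv).1) (fun v hv => (h v hv).2.1) (fun v hv => (h v hv).2.2)

lemma smallSummand_irreducible {U : Submodule ℂ (Spinor N)} (hU : U ≤ smallSummand N)
    (h : ChainStable U) : U = ⊥ ∨ U = smallSummand N :=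
  chain_irreducible smallWeight_injective cartanOp_smallVec raiseOp_smallVec lowerOp_smallVec_ne hU
    (fun v hv => (h v hv).1) (fun v hv => (h v hv).2.1) (fun v hv => (h v hv).2.2)

/-- The intersection is a submodule of the irreducible big summand; if it were everything, dimension
N + 2 would fit into dimension N. -/
lemma bigSummand_inf_smallSummand : bigSummand N ⊓ smallSummand N = ⊥ := by
  have hst : ChainStable (bigSummand N ⊓ smallSummand N) := fun ψ hψ =>
    ⟨⟨(chainStable_bigSummand ψ hψ.1).1, (chainStable_smallSummand ψ hψ.2).1⟩,
      ⟨(chainStable_bigSummand ψ hψ.1).2.1, (chainStable_smallSummand ψ hψ.2).2.1⟩,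
      ⟨(chainStable_bigSummand ψ hψ.1).2.2, (chainStable_smallSummand ψ hψ.2).2.2⟩⟩
  rcases bigSummand_irreducible inf_le_left hst with h | h
  · exact h
  · exfalso
    have hle : bigSummand N ≤ smallSummand N := inf_eq_left.1 h
    have : FiniteDimensional ℂ (smallSummand N) :=
      FiniteDimensional.span_of_finite ℂ (Set.finite_range _)
    have := Submodule.finrank_mono hle
    rw [finrank_bigSummand, finrank_smallSummand] at this
    omega

lemma bigSummand_sup_smallSummand : bigSummand N ⊔ smallSummand N = omegaSpan N := by
  refine le_antisymm (sup_le (Submodule.span_le.2 ?_) (Submodule.span_le.2 ?_)) ?_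
  · rintro _ ⟨k, rfl⟩
    exact Submodule.sub_mem _ (omega_pow_mem _) (Submodule.smul_mem _ _ (y₁_mul_omega_pow_mem _))
  · rintro _ ⟨k, rfl⟩
    exact Submodule.add_mem _ (omega_pow_mem _) (Submodule.smul_mem _ _ (y₁_mul_omega_pow_mem _))
  -- The vectors `smallVec N k` and `bigVec N (k + 1)` have the same weight and differ by (N + 1) i
  -- y₁ ∧ ωᵏ. For k = N the second one alone is already a multiple of y₁ ∧ ω^N.
  · have hy : ∀ k, y₁ N * ω N ^ k ∈ bigSummand N ⊔ smallSummand N := by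
      intro k
      have hne : ((N : ℂ) + 1) * Complex.I ≠ 0 :=
        mul_ne_zero (by exact_mod_cast Nat.succ_ne_zero N) Complex.I_ne_zero
      rcases lt_trichotomy k N with h | h | h
      · have h1 : (((N : ℂ) + 1) * Complex.I) • (y₁ N * ω N ^ k) =
            smallVec N k - bigVec N (k + 1) := by
          simp only [smallVec, bigVec, Nat.add_sub_cancel]
          push_cast
          module
        refine (Submodule.smul_mem_iff _ hne).1 (h1 ▸ Submodule.sub_mem _
          (Submodule.mem_sup_right (smallVec_mem k h))
          (Submodule.mem_sup_left (bigVec_mem _ (by omega))))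
      · subst h
        have h1 : (((k : ℂ) + 1) * Complex.I) • (y₁ k * ω k ^ k) = -bigVec k (k + 1) := by
          simp only [bigVec, Nat.add_sub_cancel, omega_pow_eq_zero (Nat.lt_succ_self k)]
          push_cast
          module
        refine (Submodule.smul_mem_iff _ hne).1 (h1 ▸ Submodule.neg_mem _
          (Submodule.mem_sup_left (bigVec_mem _ (by omega))))
      · rw [omega_pow_eq_zero h, mul_zero]
        exact Submodule.zero_mem _
    refine sup_le (Submodule.span_le.2 ?_) (Submodule.span_le.2 ?_)
    · rintro _ ⟨k, rfl⟩
      change ω N ^ k ∈ bigSummand N ⊔ smallSummand N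
      rcases Nat.lt_or_ge N k with h | h
      · rw [omega_pow_eq_zero h]
        exact Submodule.zero_mem _
      · have h1 : ω N ^ k = bigVec N k + ((k : ℂ) * Complex.I) • (y₁ N * ω N ^ (k - 1)) := by
          rw [bigVec, sub_add_cancel]
        rw [h1]
        exact Submodule.add_mem _ (Submodule.mem_sup_left (bigVec_mem _ (by omega)))
          (Submodule.smul_mem _ _ (hy _))
    · rintro _ ⟨k, rfl⟩
      exact hy k

end Chain

/-! ### The spin representation of skew-symmetric matrices -/

section Spin

variable {A ι : Type*} [Ring A] [Algebra ℝ A] [Fintype ι] {γ : ι → A}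

/-- The element `(1/4) ∑ᵢⱼ aᵢⱼ γᵢ γⱼ`. -/
noncomputable def spinElt (γ : ι → A) (a : Matrix ι ι ℝ) : A :=
  ∑ i, ∑ j, (1 / 4 * a i j) • (γ i * γ j)

lemma spinElt_sub (a b : Matrix ι ι ℝ) : spinElt γ (a - b) = spinElt γ a - spinElt γ b := by
  simp only [spinElt, ← Finset.sum_sub_distrib, Matrix.sub_apply, mul_sub, sub_smul]

/-- Two uses of the Clifford relation give [γᵢγⱼ, γₖ] = -2δⱼₖγᵢ + 2δᵢₖγⱼ. By skew-symmetry both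
terms contribute equally, which the factor 1/4 compensates. -/
lemma spinElt_commutator_gen [DecidableEq ι]
    (hγ : ∀ i j, γ i * γ j + γ j * γ i = if i = j then -2 else 0)
    {a : Matrix ι ι ℝ} (ha : ∀ i j, a j i = -a i j) (k : ι) :
    spinElt γ a * γ k - γ k * spinElt γ a = ∑ j, a k j • γ j := by
  have h1 : ∀ i j, γ i * γ j * γ k - γ k * (γ i * γ j) =
      (if j = k then (-2 : ℝ) else 0) • γ i - (if i = k then (-2 : ℝ) else 0) • γ j := by
    intro i j
    have hγ' : ∀ i j, γ i * γ j + γ j * γ i = (if i = j then (-2 : ℝ) else 0) • 1 := by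
      intro i j
      rw [hγ]
      split_ifs
      · rw [← Algebra.algebraMap_eq_smul_one, map_neg, map_ofNat]
      · rw [zero_smul]
    have e1 := congrArg (fun x => γ i * x) (hγ' j k)
    have e2 := congrArg (fun x => x * γ j) (hγ' i k)
    simp only [mul_smul_comm, mul_one, smul_mul_assoc, one_mul] at e1 e2
    rw [← e1, ← e2]
    noncomm_ring
  simp only [spinElt, Finset.sum_mul, Finset.mul_sum, smul_mul_assoc, mul_smul_comm,
    ← Finset.sum_sub_distrib, ← smul_sub, h1]
  simp only [smul_sub, Finset.sum_sub_distrib, ite_smul, zero_smul, smul_ite, smul_zero, smul_smul,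
    Finset.sum_ite_eq', Finset.mem_univ, if_true]
  have h2 : ∑ i, ∑ j, (if i = k then (1 / 4 * a i j * -2) • γ j else 0) =
      ∑ j, (1 / 4 * a k j * -2) • γ j := by
    rw [Finset.sum_comm]
    simp
  rw [h2, ← Finset.sum_sub_distrib]
  refine Finset.sum_congr rfl fun i _ => ?_
  rw [← sub_smul, ha k i]
  congr 1
  ring

/-- The map `𝔰𝔬 → Cl` is a homomorphism of Lie algebras. -/
lemma spinElt_commutator [DecidableEq ι]
    (hγ : ∀ i j, γ i * γ j + γ j * γ i = if i = j then -2 else 0)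
    {a b : Matrix ι ι ℝ} (ha : ∀ i j, a j i = -a i j) :
    spinElt γ a * spinElt γ b - spinElt γ b * spinElt γ a = spinElt γ (b * a - a * b) := by
  -- The commutator is a derivation, so it acts on the two factors in turn.
  have h1 : ∀ i j, spinElt γ a * (γ i * γ j) - γ i * γ j * spinElt γ a =
      (∑ l, a i l • γ l) * γ j + γ i * ∑ l, a j l • γ l := by
    intro i j
    rw [← spinElt_commutator_gen hγ ha, ← spinElt_commutator_gen hγ ha]
    noncomm_ring
  have h2 : spinElt γ a * spinElt γ b - spinElt γ b * spinElt γ a =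
      ∑ i, ∑ j, (1 / 4 * b i j) • ((∑ l, a i l • γ l) * γ j + γ i * ∑ l, a j l • γ l) := by
    simp only [← h1]
    nth_rw 2 3 [spinElt]
    simp only [Finset.mul_sum, Finset.sum_mul, ← Finset.sum_sub_distrib, mul_smul_comm,
      smul_mul_assoc, smul_sub]
  rw [h2, spinElt_sub, sub_eq_add_neg, add_comm]
  simp only [smul_add, Finset.sum_add_distrib]
  congr 1
  · simp only [spinElt, Finset.sum_mul, Matrix.mul_apply, Finset.mul_sum, Finset.sum_smul,
      Finset.smul_sum, smul_mul_assoc, smul_smul, ← Finset.sum_neg_distrib, ← neg_smul]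
    refine Finset.sum_comm.trans (Eq.trans ?_ Finset.sum_comm)
    refine Finset.sum_congr rfl fun j _ => Finset.sum_comm.trans ?_
    refine Finset.sum_congr rfl fun l _ => Finset.sum_congr rfl fun i _ => ?_
    rw [ha l i]
    congr 1
    ring
  · simp only [spinElt, Finset.mul_sum, Matrix.mul_apply, Finset.sum_smul,
      Finset.smul_sum, mul_smul_comm, smul_smul]
    refine Finset.sum_congr rfl fun i _ => ?_
    rw [Finset.sum_comm]
    refine Finset.sum_congr rfl fun l _ => Finset.sum_congr rfl fun j _ => ?_
    congr 1
    ring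

/-- If Q moves the generators by the matrix o, it moves a quadratic element by changing its
coefficient matrix as a bilinear form. Applied to lifts of elements of H, this replaces
differentiation along the group. -/
lemma spinElt_conj {Q : A} {o : Matrix ι ι ℝ} (h : ∀ i, Q * γ i = (∑ k, o i k • γ k) * Q)
    (a : Matrix ι ι ℝ) : Q * spinElt γ a = spinElt γ (o.transpose * a * o) * Q := by
  have h1 : ∀ i j, Q * (γ i * γ j) = (∑ k, o i k • γ k) * (∑ l, o j l • γ l) * Q := by
    intro i j
    rw [← mul_assoc, h, mul_assoc, h, mul_assoc]
  have h2 : Q * spinElt γ a =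
      (∑ i, ∑ j, (1 / 4 * a i j) • ((∑ k, o i k • γ k) * ∑ l, o j l • γ l)) * Q := by
    rw [spinElt, Finset.mul_sum, Finset.sum_mul]
    refine Finset.sum_congr rfl fun i _ => ?_
    rw [Finset.mul_sum, Finset.sum_mul]
    refine Finset.sum_congr rfl fun j _ => ?_
    rw [mul_smul_comm, h1, smul_mul_assoc]
  rw [h2]
  congr 1
  simp only [spinElt, Finset.sum_mul, Finset.mul_sum, Finset.smul_sum, smul_mul_assoc,
    mul_smul_comm, smul_smul, Matrix.mul_apply, Matrix.transpose_apply, Finset.sum_smul]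
  calc _ = ∑ i, ∑ j, ∑ k, ∑ l, (1 / 4 * a i j * (o i k * o j l)) • (γ k * γ l) := by
        refine Finset.sum_congr rfl fun i _ => Finset.sum_congr rfl fun j _ => ?_
        rw [Finset.sum_comm]
        refine Finset.sum_congr rfl fun k _ => Finset.sum_congr rfl fun l _ => ?_
        congr 1
        ring
    _ = ∑ i, ∑ k, ∑ j, ∑ l, (1 / 4 * a i j * (o i k * o j l)) • (γ k * γ l) :=
        Finset.sum_congr rfl fun i _ => Finset.sum_comm
    _ = ∑ k, ∑ i, ∑ j, ∑ l, (1 / 4 * a i j * (o i k * o j l)) • (γ k * γ l) := Finset.sum_comm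
    _ = ∑ k, ∑ i, ∑ l, ∑ j, (1 / 4 * a i j * (o i k * o j l)) • (γ k * γ l) :=
        Finset.sum_congr rfl fun k _ => Finset.sum_congr rfl fun i _ => Finset.sum_comm
    _ = ∑ k, ∑ l, ∑ i, ∑ j, (1 / 4 * a i j * (o i k * o j l)) • (γ k * γ l) :=
        Finset.sum_congr rfl fun k _ => Finset.sum_comm
    _ = ∑ k, ∑ l, ∑ j, ∑ i, (1 / 4 * a i j * (o i k * o j l)) • (γ k * γ l) :=
        Finset.sum_congr rfl fun k _ => Finset.sum_congr rfl fun l _ => Finset.sum_comm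
    _ = _ := by
        refine Finset.sum_congr rfl fun k _ => Finset.sum_congr rfl fun l _ =>
          Finset.sum_congr rfl fun j _ => Finset.sum_congr rfl fun i _ => ?_
        congr 1
        ring

end Spin

/-! ### The metric in coordinates -/

section Metric

variable {N : ℕ}

/-- The two hypotheses make h block diagonal, so it preserves the splitting into the corner entry
and the rest. -/
lemma FixesAxis.vert_mul {h : Amb N} (hh : FixesAxis h) (hs : FixesAxis (star h)) (S : Amb N) :
    vert N (h * S) = h * vert N S := by
  have hrow : ∀ i, h.1 0 i = if i = 0 then h.2 else 0 := by
    intro i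
    have := congrArg star (hs i)
    simp only [Prod.fst_star, Matrix.star_apply, star_star, Prod.snd_star] at this
    rw [this]
    split_ifs <;> simp
  refine Prod.ext ?_ rfl
  ext1 i j
  simp only [vert, LinearMap.coe_mk, AddHom.coe_mk, Prod.fst_mul, Matrix.mul_apply, hrow,
    Matrix.single_apply]
  by_cases hj : 0 = j
  · subst hj
    by_cases hi : 0 = i
    · subst hi; simp [hrow]
    · have : i ≠ 0 := Ne.symm hi
      have h0 := hh i
      simp [hi, this] at h0 ⊢
      simp [h0]
  · simp [hj]

lemma FixesAxis.vert_mul_right {h : Amb N} (hh : FixesAxis h) (hs : FixesAxis (star h))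
    (S : Amb N) : vert N (S * h) = vert N S * h := by
  have hrow : ∀ i, h.1 0 i = if i = 0 then h.2 else 0 := by
    intro i
    have := congrArg star (hs i)
    simp only [Prod.fst_star, Matrix.star_apply, star_star, Prod.snd_star] at this
    rw [this]
    split_ifs <;> simp
  refine Prod.ext ?_ rfl
  ext1 i j
  have hcol := fun k => hh k
  simp only [vert, LinearMap.coe_mk, AddHom.coe_mk, Prod.fst_mul, Matrix.mul_apply, hcol,
    Matrix.single_apply]
  by_cases hi : 0 = i
  · subst hi
    by_cases hj : 0 = j
    · subst hj; simp [hrow]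
    · have : j ≠ 0 := Ne.symm hj
      simp [hj, this, hrow]
  · simp [hi]

lemma fixesAxis_star_of_mem_isoAlg {T : Amb N} (hT : T ∈ isoAlg N) : FixesAxis (star T) := by
  rw [hT.1]
  intro i
  have := hT.2 i
  simp only [Prod.fst_neg, Matrix.neg_apply, this, Prod.snd_neg]
  split_ifs <;> simp

lemma κ_comm (S T : Amb N) : κ N S T = κ N T S := by
  rw [κ_apply, κ_apply, B₀_comm, quat_re_mul_comm]

lemma metric_apply (a b : ℝ) (S T : 𝔪 N) : metric N a b S T = -a * κ N (vert N S) (vert N T) -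
    b * κ N ((S : Amb N) - vert N S) ((T : Amb N) - vert N T) := rfl

lemma metric_comm (a b : ℝ) (S T : 𝔪 N) : metric N a b S T = metric N a b T S := by
  rw [metric_apply, metric_apply, κ_comm, κ_comm (_ - _)]

lemma κ_lie (T S U : Amb N) : κ N (T * S - S * T) U = -κ N S (T * U - U * T) := by
  rw [map_sub, LinearMap.sub_apply, map_sub, κ_cyclic, κ_cyclic, κ_comm T, κ_cyclic]
  ring

lemma isotropyAlg_coe (T : isoAlg N) (S : 𝔪 N) : ((isotropyAlg N T S : 𝔪 N) : Amb N) =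
    (T : Amb N) * S - S * T := rfl

lemma isotropy_coe (h : H N) (S : 𝔪 N) : ((isotropy N h S : 𝔪 N) : Amb N) =
    toAmb (h : G N) * (S : Amb N) * star (toAmb (h : G N)) := rfl

/-- The form κ is ad-invariant and ad T respects 𝔪₁ ⊕ 𝔪₂, so ad T is skew for any rescaling of the
two parts. -/
lemma metric_isotropyAlg (a b : ℝ) (T : isoAlg N) (S U : 𝔪 N) :
    metric N a b (isotropyAlg N T S) U = -metric N a b S (isotropyAlg N T U) := by
  have hv : ∀ S : 𝔪 N, vert N (isotropyAlg N T S : 𝔪 N) = (T : Amb N) * vert N S -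
      vert N S * T := by
    intro S
    rw [isotropyAlg_coe, map_sub, T.2.2.vert_mul (fixesAxis_star_of_mem_isoAlg T.2),
      T.2.2.vert_mul_right (fixesAxis_star_of_mem_isoAlg T.2)]
  have hh : ∀ S : 𝔪 N, ((isotropyAlg N T S : 𝔪 N) : Amb N) - vert N (isotropyAlg N T S : 𝔪 N) =
      (T : Amb N) * (S - vert N S) - (S - vert N S) * T := by
    intro S
    rw [hv, isotropyAlg_coe]
    noncomm_ring
  rw [metric_apply, metric_apply, hh, hh, hv, hv, κ_lie, κ_lie]
  ring

lemma κ_conj {h : Amb N} (hh : star h * h = 1) (S T : Amb N) :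
    κ N (h * S * star h) (h * T * star h) = κ N S T := by
  rw [mul_assoc h S, κ_cyclic, κ_comm, mul_assoc (h * T), hh, mul_one, κ_cyclic, mul_assoc S, hh,
    mul_one, κ_comm]

lemma fixesAxis_star_toAmb (h : H N) : FixesAxis (star (toAmb (h : G N))) := by
  rw [← toAmb_inv]; exact fixesAxis_of_mem ((H N).inv_mem h.2)

lemma vert_isotropy (h : H N) (S : 𝔪 N) : vert N (isotropy N h S : 𝔪 N) =
    toAmb (h : G N) * vert N S * star (toAmb (h : G N)) := by
  have h1 := fixesAxis_of_mem h.2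
  have h2 := fixesAxis_star_toAmb h
  rw [isotropy_coe, h2.vert_mul_right (by rwa [star_star]), h1.vert_mul h2]

lemma metric_isotropy (a b : ℝ) (h : H N) (S T : 𝔪 N) :
    metric N a b (isotropy N h S) (isotropy N h T) = metric N a b S T := by
  have hh : ∀ S : 𝔪 N, ((isotropy N h S : 𝔪 N) : Amb N) - vert N (isotropy N h S : 𝔪 N) =
      toAmb (h : G N) * (S - vert N S) * star (toAmb (h : G N)) := by
    intro S
    rw [vert_isotropy, isotropy_coe]
    noncomm_ring
  rw [metric_apply, metric_apply, hh, hh, vert_isotropy, vert_isotropy,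
    κ_conj (star_mul_toAmb _), κ_conj (star_mul_toAmb _)]

lemma Ωc_pos {a : ℝ} (ha : 0 < a) : 0 < Ωc N a := Real.sqrt_pos.2 (by positivity)

lemma horCoeff_pos {b : ℝ} (hb : 0 < b) : 0 < horCoeff N b := by
  rw [horCoeff]
  have : 0 < Real.sqrt (2 * b * (((N + 1 : ℕ) : ℝ) + 1)) := Real.sqrt_pos.2 (by positivity)
  positivity

/-- The coordinates of an element of `𝔪`, up to the factors `Ω` and `c⁻¹`. -/
def coord : IdxE N → Amb N → ℝ
  | none, S => (S.1 0 0).imI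
  | some (none, 0), S => -(S.1 0 0).imK
  | some (none, 1), S => (S.1 0 0).imJ
  | some (some (p, 0), 0), S => (S.1 p.succ 0).imJ
  | some (some (p, 0), 1), S => (S.1 p.succ 0).imK
  | some (some (p, 1), 0), S => (S.1 p.succ 0).imI
  | some (some (p, 1), 1), S => (S.1 p.succ 0).re

/-- The factors by which the coordinates differ from the `g_{a,b}`-orthonormal ones. -/
noncomputable def scale (N : ℕ) (a b : ℝ) : IdxE N → ℝ
  | none => Ωc N a
  | some (none, _) => Ωc N a
  | some (some _, _) => (horCoeff N b)⁻¹

lemma scale_pos {a b : ℝ} (ha : 0 < a) (hb : 0 < b) : ∀ k, 0 < scale N a b k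
  | none => Ωc_pos ha
  | some (none, _) => Ωc_pos ha
  | some (some _, _) => inv_pos.2 (horCoeff_pos hb)

lemma metric_frame {a b : ℝ} (ha : 0 < a) (hb : 0 < b) (S : 𝔪 N) (k : IdxE N) :
    metric N a b S (frame N a b k) = scale N a b k * coord k (S : Amb N) := by
  have hΩ : (Ωc N a) ^ 2 = 2 * a * (((N + 1 : ℕ) : ℝ) + 1) * (((N + 1 : ℕ) : ℝ) + 3) :=
    Real.sq_sqrt (by positivity)
  have hΩ0 : Ωc N a ≠ 0 := (Ωc_pos ha).ne'
  have hc0 : horCoeff N b ≠ 0 := (horCoeff_pos hb).ne'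
  have hc : (horCoeff N b) ^ 2 * (8 * b * (((N + 1 : ℕ) : ℝ) + 1)) = 1 := by
    rw [horCoeff, div_pow, mul_pow, Real.sq_sqrt (by positivity)]
    field_simp
    ring
  -- Here Ω² = 2a(n+1)(n+3) turns the Killing constant divided by Ω into Ω; below, 8b(n+1)c² = 1
  -- plays the same role for the horizontal vectors.
  have hV : ∀ t : ℝ, -a * (1 / Ωc N a * (2 * (((N + 1 : ℕ) : ℝ) + 1) *
      (((N + 1 : ℕ) : ℝ) + 3) * t)) = Ωc N a * -t := by
    intro t
    field_simp
    rw [hΩ]; ring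
  have hH : ∀ t : ℝ, -b * (horCoeff N b * (-8 * (((N + 1 : ℕ) : ℝ) + 1) * t)) =
      (horCoeff N b)⁻¹ * t := by
    intro t
    field_simp
    linear_combination t * hc
  have hV' : ∀ (x : ℍ[ℝ]) (h : (1 / Ωc N a) • vertVec N x ∈ 𝔪 N),
      metric N a b S ⟨_, h⟩ = Ωc N a * -((S : Amb N).1 0 0 * x).re := fun x h => by
    rw [metric_vert, hV]
  have hH' : ∀ (p : Fin N) (q : ℍ[ℝ]) (Z : HMat N) (_ : Z = horVec p q)
      (h : horCoeff N b • ((Z, 0) : Amb N) ∈ 𝔪 N),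
      metric N a b S ⟨_, h⟩ = (horCoeff N b)⁻¹ * (star ((S : Amb N).1 p.succ 0) * q).re :=
    fun p q Z hZ h => by rw [metric_hor a b _ S p hZ h, hH]
  have hre : ((S : Amb N).1 0 0).re = 0 := by
    have := congrArg (fun q : ℍ[ℝ] => q.re) (mem_structure S).1
    simp only [Quaternion.re_star, Quaternion.re_neg] at this
    linarith
  match k with
  | none =>
    refine (hV' qi _).trans ?_
    simp [scale, coord, Quaternion.re_mul, qi_re, qi_imI, qi_imJ, qi_imK]
  | some (none, 0) =>
    refine (hV' (-qk) _).trans ?_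
    simp [scale, coord, Quaternion.re_mul, qk_re, qk_imI, qk_imJ, qk_imK]
  | some (none, 1) =>
    refine (hV' qj _).trans ?_
    simp [scale, coord, Quaternion.re_mul, qj_re, qj_imI, qj_imJ, qj_imK]
  | some (some (p, 0), 0) =>
    refine (hH' p qj _ (smul_symF_horVec p star_qj) _).trans ?_
    simp [scale, coord, Quaternion.re_mul, qj_re, qj_imI, qj_imJ, qj_imK]
  | some (some (p, 0), 1) =>
    refine (hH' p qk _ (smul_symF_horVec p star_qk) _).trans ?_
    simp [scale, coord, Quaternion.re_mul, qk_re, qk_imI, qk_imJ, qk_imK]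
  | some (some (p, 1), 0) =>
    refine (hH' p qi _ (smul_symF_horVec p star_qi) _).trans ?_
    simp [scale, coord, Quaternion.re_mul, qi_re, qi_imI, qi_imJ, qi_imK]
  | some (some (p, 1), 1) =>
    refine (hH' p 1 _ (skewE_horVec p) _).trans ?_
    simp [scale, coord]

/-- The quaternions by which the frame is indexed. -/
def unitOf : IdxE N → ℍ[ℝ]
  | none => qi
  | some (none, 0) => -qk
  | some (none, 1) => qj
  | some (some (_, 0), 0) => qj
  | some (some (_, 0), 1) => qk
  | some (some (_, 1), 0) => qi
  | some (some (_, 1), 1) => 1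

lemma frame_zero (a b : ℝ) (k : IdxE N) : ((frame N a b k : 𝔪 N) : Amb N).1 0 0 =
    match k with
    | some (some _, _) => 0
    | k => (scale N a b k)⁻¹ • unitOf k := by
  have h0 : ∀ p : Fin N, p.succ ≠ 0 := fun p => Fin.succ_ne_zero p
  have h0' : ∀ p : Fin N, 0 ≠ p.succ := fun p => (Fin.succ_ne_zero p).symm
  match k with
  | none => simp [frame, frameAmb, vertVec, smul_symF_zero, scale, unitOf]
  | some (none, 0) => simp [frame, frameAmb, vertVec, smul_symF_zero, scale, unitOf]
  | some (none, 1) => simp [frame, frameAmb, vertVec, smul_symF_zero, scale, unitOf]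
  | some (some (p, 0), 0) => simp [frame, frameAmb, symF, h0', h0]
  | some (some (p, 0), 1) => simp [frame, frameAmb, symF, h0', h0]
  | some (some (p, 1), 0) => simp [frame, frameAmb, symF, h0', h0]
  | some (some (p, 1), 1) => simp [frame, frameAmb, skewE, h0]

lemma frame_succ (a b : ℝ) (k : IdxE N) (r : Fin N) :
    ((frame N a b k : 𝔪 N) : Amb N).1 r.succ 0 =
    match k with
    | some (some (p, i), j) => if r = p then horCoeff N b • unitOf (some (some (p, i), j)) else 0
    | _ => 0 := by
  have h0 : ∀ p : Fin N, p.succ ≠ 0 := fun p => Fin.succ_ne_zero p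
  have h0' : ∀ p : Fin N, 0 ≠ p.succ := fun p => (Fin.succ_ne_zero p).symm
  match k with
  | none => simp [frame, frameAmb, vertVec, smul_symF_zero, h0']
  | some (none, 0) => simp [frame, frameAmb, vertVec, smul_symF_zero, h0']
  | some (none, 1) => simp [frame, frameAmb, vertVec, smul_symF_zero, h0']
  | some (some (p, 0), 0) =>
    by_cases h : r = p <;> simp [frame, frameAmb, symF, h0', h0, h, unitOf, eq_comm]
  | some (some (p, 0), 1) =>
    by_cases h : r = p <;> simp [frame, frameAmb, symF, h0', h0, h, unitOf, eq_comm]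
  | some (some (p, 1), 0) =>
    by_cases h : r = p <;> simp [frame, frameAmb, symF, h0', h0, h, unitOf, eq_comm]
  | some (some (p, 1), 1) =>
    by_cases h : r = p <;> simp [frame, frameAmb, skewE, h0', h0, h, unitOf, eq_comm]

end Metric

/-! ### Orthonormality of the frame and the spin representation in frame coordinates. -/

section Frame

variable {N : ℕ} {a b : ℝ}

lemma frame_orthonormal (ha : 0 < a) (hb : 0 < b) (k l : IdxE N) :
    metric N a b (frame N a b k) (frame N a b l) = if k = l then 1 else 0 := by
  have hΩ := (Ωc_pos (N := N) ha).ne'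
  have hc := (horCoeff_pos (N := N) hb).ne'
  rw [metric_frame ha hb]
  rcases k with _ | ⟨_ | ⟨p, i⟩, j⟩ <;> rcases l with _ | ⟨_ | ⟨r, i'⟩, j'⟩
  · simp [coord, frame_zero, scale, unitOf, qi_imI, hΩ]
  · fin_cases j' <;> simp [coord, frame_zero, scale, unitOf, qi_imJ, qi_imK]
  · fin_cases i' <;> fin_cases j' <;> simp [coord, frame_succ]
  · fin_cases j <;> simp [coord, frame_zero, scale, unitOf, qk_imI, qj_imI]
  · fin_cases j <;> fin_cases j' <;>
      simp [coord, frame_zero, scale, unitOf, qk_imK, qk_imJ, qj_imJ, qj_imK, hΩ]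
  · fin_cases i' <;> fin_cases j' <;> simp [coord, frame_succ]
  · simp [coord, frame_zero]
  · fin_cases j' <;> simp [coord, frame_zero]
  · by_cases h : r = p
    · subst h
      fin_cases i <;> fin_cases j <;> fin_cases i' <;> fin_cases j' <;>
        simp [coord, frame_succ, scale, unitOf, qi_re, qi_imI, qi_imJ, qi_imK, qj_re, qj_imI,
          qj_imJ, qj_imK, qk_re, qk_imI, qk_imJ, qk_imK, hc]
    · have h' : p ≠ r := Ne.symm h
      fin_cases i' <;> fin_cases j' <;> simp [coord, frame_succ, h, h']

lemma metric_self_pos (ha : 0 < a) (hb : 0 < b) {S : 𝔪 N} (hS : S ≠ 0) :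
    0 < metric N a b S S := by
  rw [parseval ha hb]
  refine lt_of_le_of_ne (Finset.sum_nonneg fun k _ => sq_nonneg _) fun h => hS ?_
  have h0 : ∀ k, coord k (S : Amb N) = 0 := by
    intro k
    have := (Finset.sum_eq_zero_iff_of_nonneg fun k _ => sq_nonneg _).1 h.symm k
      (Finset.mem_univ k)
    rw [metric_frame ha hb] at this
    exact (mul_eq_zero.1 (pow_eq_zero_iff two_ne_zero |>.1 this)).resolve_left
      (scale_pos ha hb k).ne'
  obtain ⟨h1, h2, h3⟩ := mem_structure S
  have hre : ((S : Amb N).1 0 0).re = 0 := by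
    have := congrArg (fun q : ℍ[ℝ] => q.re) h1
    simp only [Quaternion.re_star, Quaternion.re_neg] at this
    linarith
  have hx : (S : Amb N).1 0 0 = 0 := by
    ext
    · exact hre
    · exact h0 none
    · exact h0 (some (none, 1))
    · exact neg_eq_zero.1 (h0 (some (none, 0)))
  have hu : ∀ p : Fin N, (S : Amb N).1 p.succ 0 = 0 := by
    intro p
    ext
    · exact h0 (some (some (p, 1), 1))
    · exact h0 (some (some (p, 1), 0))
    · exact h0 (some (some (p, 0), 0))
    · exact h0 (some (some (p, 0), 1))
  apply Subtype.ext
  rw [← sub_add_cancel (S : Amb N) (vert N S), h3, h2, hx]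
  refine Prod.ext ?_ ?_
  · simp [hu, horVec, vertVec]
  · simp [vertVec]

/-- The remainder of the expansion has all frame coefficients zero, so by Parseval its norm is zero.
-/
lemma eq_sum_frame (ha : 0 < a) (hb : 0 < b) (S : 𝔪 N) :
    S = ∑ k, metric N a b S (frame N a b k) • frame N a b k := by
  by_contra hne
  have hpos := metric_self_pos ha hb (sub_ne_zero.2 hne)
  rw [parseval ha hb] at hpos
  refine hpos.ne' (Finset.sum_eq_zero fun l _ => ?_)
  simp only [map_sub, map_sum, LinearMap.sum_apply, LinearMap.sub_apply, map_smul,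
    LinearMap.smul_apply, frame_orthonormal ha hb, smul_eq_mul, mul_ite, mul_one, mul_zero,
    Finset.sum_ite_eq', Finset.mem_univ, if_true, sub_self]
  norm_num

lemma span_frame (ha : 0 < a) (hb : 0 < b) :
    Submodule.span ℝ (Set.range (frame N a b)) = ⊤ := by
  refine eq_top_iff.2 fun S _ => ?_
  rw [eq_sum_frame ha hb S]
  exact Submodule.sum_mem _ fun k _ => Submodule.smul_mem _ _ (Submodule.subset_span ⟨k, rfl⟩)

/-- The matrix of an endomorphism of `𝔪` with respect to the frame. -/
noncomputable def frameMatrix (a b : ℝ) (A : Module.End ℝ (𝔪 N)) : Matrix (IdxE N) (IdxE N) ℝ :=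
  Matrix.of fun i j => metric N a b (A (frame N a b i)) (frame N a b j)

/-- The images of the frame vectors are the rows, the transpose of the usual convention; hence the
reversed order. -/
lemma frameMatrix_mul (ha : 0 < a) (hb : 0 < b) (A B : Module.End ℝ (𝔪 N)) :
    frameMatrix a b (A * B) = frameMatrix a b B * frameMatrix a b A := by
  ext i j
  simp only [frameMatrix, Matrix.of_apply, Matrix.mul_apply, Module.End.mul_apply]
  conv_lhs => rw [eq_sum_frame ha hb (B (frame N a b i))]
  simp [map_sum, LinearMap.sum_apply]

lemma cliffMul_apply (S : 𝔪 N) :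
    cliffMul N a b S = ∑ k, metric N a b S (frame N a b k) • γ k := by
  simp [cliffMul]

lemma cliffMul_frame (ha : 0 < a) (hb : 0 < b) (k : IdxE N) :
    cliffMul N a b (frame N a b k) = γ k := by
  rw [cliffMul_apply]
  simp [frame_orthonormal ha hb]

lemma spinRep_eq_spinElt (ha : 0 < a) (hb : 0 < b) (T : isoAlg N) :
    spinRep ha hb T = spinElt γ (frameMatrix a b (isotropyAlg N T)) := by
  simp only [spinRep, LinearMap.comp_apply, soToCl, LinearMap.coe_mk, AddHom.coe_mk, spinElt,
    AlgHom.toLinearMap_apply, map_sum, map_smul, map_mul, cliffRep, CliffordAlgebra.lift_ι_apply,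
    cliffMul_frame ha hb, frameMatrix, Matrix.of_apply]

lemma spinRep_eq (ha : 0 < a) (hb : 0 < b) (T : isoAlg N) : spinRep ha hb T =
    ∑ k, (1 / 4 : ℝ) • (γ k * cliffMul N a b (isotropyAlg N T (frame N a b k))) := by
  rw [spinRep_eq_spinElt, spinElt]
  refine Finset.sum_congr rfl fun k _ => ?_
  rw [cliffMul_apply, Finset.mul_sum, Finset.smul_sum]
  refine Finset.sum_congr rfl fun l _ => ?_
  rw [mul_smul_comm, smul_smul, frameMatrix, Matrix.of_apply]

lemma γ_anticomm_eq (k l : IdxE N) : γ k * γ l + γ l * γ k =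
    if k = l then (-2 : Module.End ℂ (Spinor N)) else 0 := by
  rw [γ_anticomm]
  by_cases h : k = l
  · rw [if_pos h, if_pos h, ← Algebra.algebraMap_eq_smul_one, map_neg, map_ofNat]
  · rw [if_neg h, if_neg h, zero_smul]

lemma frameMatrix_skew (T : isoAlg N) (i j : IdxE N) :
    frameMatrix a b (isotropyAlg N T) j i = -frameMatrix a b (isotropyAlg N T) i j := by
  simp only [frameMatrix, Matrix.of_apply]
  rw [metric_isotropyAlg, metric_comm]

lemma isotropyAlg_lie (S T : isoAlg N) : isotropyAlg N ⁅S, T⁆ =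
    isotropyAlg N S * isotropyAlg N T - isotropyAlg N T * isotropyAlg N S := by
  refine LinearMap.ext fun U => Subtype.ext ?_
  change ((⁅S, T⁆ : isoAlg N) : Amb N) * U - U * (⁅S, T⁆ : isoAlg N) =
    (S : Amb N) * (T * U - U * T) - (T * U - U * T) * S -
      ((T : Amb N) * (S * U - U * S) - (S * U - U * S) * T)
  rw [LieSubalgebra.coe_bracket, LieRing.of_associative_ring_bracket]
  noncomm_ring

lemma spinRep_lie (ha : 0 < a) (hb : 0 < b) (S T : isoAlg N) : spinRep ha hb ⁅S, T⁆ =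
    spinRep ha hb S * spinRep ha hb T - spinRep ha hb T * spinRep ha hb S := by
  simp only [spinRep_eq_spinElt]
  rw [spinElt_commutator γ_anticomm_eq (frameMatrix_skew S), ← frameMatrix_mul ha hb,
    ← frameMatrix_mul ha hb, isotropyAlg_lie]
  congr 1
  ext i j
  simp [frameMatrix]

lemma spinRepC_tmul (ha : 0 < a) (hb : 0 < b) (z : ℂ) (T : isoAlg N) :
    spinRepC ha hb (z ⊗ₜ T) = z • spinRep ha hb T := by
  simp [spinRepC]

lemma spinRepC_lie (ha : 0 < a) (hb : 0 < b) (S T : ℂ ⊗[ℝ] isoAlg N) : spinRepC ha hb ⁅S, T⁆ =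
    spinRepC ha hb S * spinRepC ha hb T - spinRepC ha hb T * spinRepC ha hb S := by
  induction S using TensorProduct.induction_on with
  | zero => simp
  | add S S' hS hS' => rw [add_lie, map_add, hS, hS', map_add]; noncomm_ring
  | tmul z S =>
    induction T using TensorProduct.induction_on with
    | zero =>
      have h : ⁅(z ⊗ₜ S : ℂ ⊗[ℝ] isoAlg N), (0 : ℂ ⊗[ℝ] isoAlg N)⁆ = 0 :=
        lie_zero (L := ℂ ⊗[ℝ] isoAlg N) (M := ℂ ⊗[ℝ] isoAlg N) _
      rw [h]; simp
    | add T T' hT hT' =>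
      have h : ⁅(z ⊗ₜ S : ℂ ⊗[ℝ] isoAlg N), T + T'⁆ = ⁅(z ⊗ₜ S : ℂ ⊗[ℝ] isoAlg N), T⁆ +
        ⁅(z ⊗ₜ S : ℂ ⊗[ℝ] isoAlg N), T'⁆ :=
          lie_add (L := ℂ ⊗[ℝ] isoAlg N) (M := ℂ ⊗[ℝ] isoAlg N) _ _ _
      rw [h, map_add, hT, hT', map_add]; noncomm_ring
    | tmul w T =>
      rw [LieAlgebra.ExtendScalars.bracket_tmul, spinRepC_tmul, spinRepC_tmul, spinRepC_tmul,
        spinRep_lie, smul_mul_smul_comm, smul_mul_smul_comm, mul_comm w, smul_sub]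

/-! ### Clifford multiplication and the spin representation in coordinates -/

/-- The first complex coordinate `re + i imI` of a quaternion. -/
noncomputable def cA (q : ℍ[ℝ]) : ℂ := q.re + q.imI * Complex.I

/-- The second complex coordinate `imK + i imJ` of a quaternion. -/
noncomputable def cB (q : ℍ[ℝ]) : ℂ := q.imK + q.imJ * Complex.I

/-- The conjugate of `cA q`. -/
noncomputable def cA' (q : ℍ[ℝ]) : ℂ := q.re - q.imI * Complex.I

/-- The conjugate of `cB q`. -/
noncomputable def cB' (q : ℍ[ℝ]) : ℂ := q.imK - q.imJ * Complex.I

/-- Clifford multiplication by the unit horizontal vector with entry `q` at `(p + 1, 1)`. -/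
noncomputable def horCl (p : Fin N) (q : ℍ[ℝ]) : Module.End ℂ (Spinor N) :=
  cB q • wedgeY (some (p, 0)) - cB' q • contrX (some (p, 0)) + cA q • wedgeY (some (p, 1)) -
    cA' q • contrX (some (p, 1))

/-- Clifford multiplication by the unit vertical vector given by the imaginary quaternion `x`. -/
noncomputable def vertCl (x : ℍ[ℝ]) : Module.End ℂ (Spinor N) :=
  (x.imI * Complex.I) • parity N + (x.imJ - x.imK * Complex.I) • wedgeY none -
    (x.imJ + x.imK * Complex.I) • contrX none

lemma cliffMul_eq (ha : 0 < a) (hb : 0 < b) (S : 𝔪 N) : cliffMul N a b S =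
    (Ωc N a : ℂ) • vertCl ((S : Amb N).1 0 0) +
      ((horCoeff N b)⁻¹ : ℂ) • ∑ p : Fin N, horCl p ((S : Amb N).1 p.succ 0) := by
  rw [cliffMul_apply]
  simp only [metric_frame ha hb, ← Complex.coe_smul]
  rw [Fintype.sum_option, Fintype.sum_prod_type, Fintype.sum_option, Fintype.sum_prod_type,
    ← add_assoc, Finset.smul_sum]
  congr 1
  · simp only [Fin.sum_univ_two, scale, coord, γ, vertCl]
    push_cast
    module
  · refine Finset.sum_congr rfl fun p _ => ?_
    simp only [Fin.sum_univ_two, scale, coord, γ, horCl, cA, cB, cA', cB']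
    push_cast
    module

lemma isotropyAlg_zero (T : isoAlg N) (S : 𝔪 N) :
    ((isotropyAlg N T S : 𝔪 N) : Amb N).1 0 0 =
      (T : Amb N).2 * (S : Amb N).1 0 0 - (S : Amb N).1 0 0 * (T : Amb N).2 := by
  have hrow : ∀ i, (T : Amb N).1 0 i = if i = 0 then (T : Amb N).2 else 0 := by
    intro i
    have := congrArg star (fixesAxis_star_of_mem_isoAlg T.2 i)
    simp only [Prod.fst_star, Matrix.star_apply, star_star, Prod.snd_star] at this
    rw [this]
    split_ifs <;> simp
  have hcol := T.2.2
  rw [isotropyAlg_coe]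
  simp only [Prod.fst_sub, Prod.fst_mul, Matrix.sub_apply, Matrix.mul_apply, hrow, hcol _]
  simp

/-- On 𝔪₂ ≅ ℍ^{n-1}, the lower right block acts by left and the 𝔰𝔭(1)-part by right multiplication;
`block_left` and `block_right` treat these two actions separately. -/
lemma isotropyAlg_succ (T : isoAlg N) (S : 𝔪 N) (p : Fin N) :
    ((isotropyAlg N T S : 𝔪 N) : Amb N).1 p.succ 0 =
      ∑ r : Fin N, (T : Amb N).1 p.succ r.succ * (S : Amb N).1 r.succ 0 -
        (S : Amb N).1 p.succ 0 * (T : Amb N).2 := by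
  have hcol := T.2.2
  rw [isotropyAlg_coe]
  simp only [Prod.fst_sub, Prod.fst_mul, Matrix.sub_apply, Matrix.mul_apply]
  congr 1
  · rw [Fin.sum_univ_succ, hcol p.succ]
    simp [Fin.succ_ne_zero]
  · simp [hcol _]

end Frame

/-! ### The spin representation through creation and annihilation operators. -/

section Explicit

variable {N : ℕ} {a b : ℝ}

/-- The infinitesimal action of the quaternionic matrix unit `x E_{r,p}` on `Λ^• L'`. -/
noncomputable def lowTerm (r p : Fin N) (x : ℍ[ℝ]) : Module.End ℂ (Spinor N) :=
  cA' x • (wedgeY (some (r, 0)) * contrX (some (p, 0))) +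
    cA x • (wedgeY (some (r, 1)) * contrX (some (p, 1))) +
    cB x • (wedgeY (some (r, 0)) * contrX (some (p, 1))) -
    cB' x • (wedgeY (some (r, 1)) * contrX (some (p, 0)))

/-- The action of the element `(ζ F₁₁, ζ)` of `𝔰𝔭(1)`. -/
noncomputable def diagTerm (N : ℕ) (ζ : ℍ[ℝ]) : Module.End ℂ (Spinor N) :=
  (ζ.imI * Complex.I) • cartanOp N +
    (ζ.imJ : ℂ) • (Complex.I • (omegaWedge N - omegaContr N) -
      parity N * (contrX none + wedgeY none)) +
    (ζ.imK : ℂ) • (omegaWedge N + omegaContr N +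
      Complex.I • (parity N * (wedgeY none - contrX none)))

lemma horCl_zero (p : Fin N) : horCl p 0 = 0 := by
  simp [horCl, cA, cB, cA', cB']

lemma horCl_sub (p : Fin N) (x x' : ℍ[ℝ]) : horCl p (x - x') = horCl p x - horCl p x' := by
  simp only [horCl, cA, cB, cA', cB', Quaternion.re_sub, Quaternion.imI_sub, Quaternion.imJ_sub,
    Quaternion.imK_sub]
  push_cast
  module

lemma horCl_smul (p : Fin N) (t : ℝ) (x : ℍ[ℝ]) : horCl p (t • x) = (t : ℂ) • horCl p x := by
  simp only [horCl, cA, cB, cA', cB', Quaternion.re_smul, Quaternion.imI_smul, Quaternion.imJ_smul,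
    Quaternion.imK_smul, smul_eq_mul]
  push_cast
  module

lemma vertCl_smul (t : ℝ) (x : ℍ[ℝ]) : vertCl (N := N) (t • x) = (t : ℂ) • vertCl x := by
  simp only [vertCl, Quaternion.imI_smul, Quaternion.imJ_smul,
    Quaternion.imK_smul, smul_eq_mul]
  push_cast
  module

/-- The sum over the four unit directions of the p-th quaternionic line. A skew-Hermitian matrix has
entry -x̄ in the transposed place, so the result pairs each entry with its partner; the scalar
vanishes for the imaginary entries on the diagonal. -/
lemma block_left (p r : Fin N) (x : ℍ[ℝ]) :
    γ (some (some (p, 0), 0)) * horCl r (x * qj) + γ (some (some (p, 0), 1)) * horCl r (x * qk) +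
      (γ (some (some (p, 1), 0)) * horCl r (x * qi) + γ (some (some (p, 1), 1)) * horCl r x) =
    (2 : ℂ) • lowTerm r p x + (2 : ℂ) • lowTerm p r (-star x) -
      (if p = r then (4 * x.re : ℂ) else 0) • 1 := by
  -- Clifford products appear with γ on the left, so one of the two terms is reordered with
  -- contractions first; then coefficients of equal words can be compared.
  have h : ∀ i j : Fin 2, wedgeY (some (r, i)) * contrX (some (p, j)) =
      (if j = i then (if p = r then (1 : ℂ) else 0) else 0) • 1 -
        contrX (some (p, j)) * wedgeY (some (r, i)) := by
    intro i j
    rw [eq_sub_iff_add_eq', contr_wedge]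
    by_cases h1 : p = r <;> by_cases h2 : j = i <;> simp [h1, h2]
  have e1 : lowTerm r p x = (if p = r then (2 * x.re : ℂ) else 0) • 1 -
      (cA' x • (contrX (some (p, 0)) * wedgeY (some (r, 0))) +
      cA x • (contrX (some (p, 1)) * wedgeY (some (r, 1))) +
      cB x • (contrX (some (p, 1)) * wedgeY (some (r, 0))) -
      cB' x • (contrX (some (p, 0)) * wedgeY (some (r, 1)))) := by
    simp only [lowTerm, h, cA, cA']
    by_cases h1 : p = r
    · simp only [h1]
      simp
      module
    · simp only [h1, if_false]
      simp
      module
  rw [e1]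
  simp only [lowTerm, horCl, γ, cA, cB, cA', cB', Quaternion.re_mul, Quaternion.imI_mul,
    Quaternion.imJ_mul, Quaternion.imK_mul, qi_re, qi_imI, qi_imJ, qi_imK, qj_re, qj_imI, qj_imJ,
    qj_imK, qk_re, qk_imI, qk_imJ, qk_imK, Quaternion.re_neg, Quaternion.imI_neg,
    Quaternion.imJ_neg, Quaternion.imK_neg, Quaternion.re_star, Quaternion.imI_star,
    Quaternion.imJ_star, Quaternion.imK_star]
  simp only [mul_zero, mul_one, zero_sub, sub_zero, zero_add, add_zero, mul_add, mul_sub, add_mul,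
    sub_mul, smul_mul_assoc, mul_smul_comm]
  by_cases h1 : p = r
  · simp only [h1, if_true]
    match_scalars <;> apply Complex.ext <;> simp <;> ring
  · simp only [h1, if_false]
    match_scalars <;> apply Complex.ext <;> simp <;> ring

/-- Right multiplication by ζ on one quaternionic line gives the 𝔰𝔩₂ that creates and destroys the
pair of modes (p, 0), (p, 1). -/
lemma block_right (p : Fin N) {ζ : ℍ[ℝ]} (hζ : ζ.re = 0) :
    γ (some (some (p, 0), 0)) * horCl p (qj * ζ) + γ (some (some (p, 0), 1)) * horCl p (qk * ζ) +
      (γ (some (some (p, 1), 0)) * horCl p (qi * ζ) + γ (some (some (p, 1), 1)) * horCl p ζ) =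
    (-4 : ℂ) • ((ζ.imI * Complex.I) • (1 - num (some (p, 0)) - num (some (p, 1))) +
      (ζ.imJ * Complex.I) • (wedgeY (some (p, 0)) * wedgeY (some (p, 1)) -
        contrX (some (p, 0)) * contrX (some (p, 1))) +
      (ζ.imK : ℂ) • (wedgeY (some (p, 0)) * wedgeY (some (p, 1)) +
        contrX (some (p, 0)) * contrX (some (p, 1)))) := by
  have h1 := wedgeY_comm (some (p, 1)) (some (p, 0))
  have h2 := contrX_comm (some (p, 1)) (some (p, 0))
  have h3 := contrX_wedgeY_self (some (p, 0))
  have h4 := contrX_wedgeY_self (some (p, 1))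
  have h5 := contrX_wedgeY_of_ne (some_zero_ne_some_one p p)
  have h6 := contrX_wedgeY_of_ne (some_zero_ne_some_one p p).symm
  simp only [horCl, γ, cA, cB, cA', cB', Quaternion.re_mul, Quaternion.imI_mul,
    Quaternion.imJ_mul, Quaternion.imK_mul, qi_re, qi_imI, qi_imJ, qi_imK, qj_re, qj_imI, qj_imJ,
    qj_imK, qk_re, qk_imI, qk_imJ, qk_imK, hζ, num]
  simp only [zero_mul, mul_zero, one_mul, zero_sub, sub_zero, zero_add, add_zero, mul_add, mul_sub,
    add_mul, sub_mul, smul_mul_assoc, mul_smul_comm, h1, h2, h3, h4, h5, h6, wedgeY_sq, contrX_sq]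
  match_scalars <;> apply Complex.ext <;> simp <;> ring

/-- The adjoint action of ζ on 𝔪₁ ≅ Im ℍ gives the two-dimensional spin representation on the mode
y₁. -/
lemma block_vert {ζ : ℍ[ℝ]} :
    γ none * vertCl (ζ * qi - qi * ζ) + (γ (some (none, 0)) * vertCl (ζ * -qk - -qk * ζ) +
      γ (some (none, 1)) * vertCl (ζ * qj - qj * ζ)) =
    (4 : ℂ) • ((ζ.imI * Complex.I) • (1 - (2 : ℂ) • num (N := N) none) -
      (ζ.imJ : ℂ) • (parity N * (contrX none + wedgeY none)) +
      (ζ.imK * Complex.I : ℂ) • (parity N * (wedgeY none - contrX none))) := by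
  have h1 := eq_neg_of_add_eq_zero_right (parity_wedge (N := N) none)
  have h2 := eq_neg_of_add_eq_zero_right (parity_contr (N := N) none)
  have h3 := contrX_wedgeY_self (N := N) none
  simp only [vertCl, γ, Quaternion.imI_mul, Quaternion.imI_neg,
    Quaternion.imJ_neg, Quaternion.imK_neg, Quaternion.re_neg, Quaternion.imI_sub,
    Quaternion.imJ_sub, Quaternion.imK_sub,
    Quaternion.imJ_mul, Quaternion.imK_mul, qi_re, qi_imI, qi_imJ, qi_imK, qj_re, qj_imI, qj_imJ,
    qj_imK, qk_re, qk_imI, qk_imJ, qk_imK, num]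
  simp only [zero_mul, mul_zero, one_mul, zero_sub, sub_zero, zero_add, add_zero, mul_add, mul_sub,
    add_mul, sub_mul, smul_mul_assoc, mul_smul_comm, h1, h2, h3, wedgeY_sq, contrX_sq]
  match_scalars <;> apply Complex.ext <;> simp <;> ring

end Explicit

section Explicit

variable {N : ℕ} {a b : ℝ}

/-- The factor Ω of Clifford multiplication cancels the Ω⁻¹ in the frame vector; with the horizontal
analogue below, this makes the spin representation independent of a and b. -/
lemma cliffMul_isotropyAlg_vert (ha : 0 < a) (hb : 0 < b) (T : isoAlg N) {k : IdxE N} {x : ℍ[ℝ]}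
    (h0 : ((frame N a b k : 𝔪 N) : Amb N).1 0 0 = (Ωc N a)⁻¹ • x)
    (h1 : ∀ p : Fin N, ((frame N a b k : 𝔪 N) : Amb N).1 p.succ 0 = 0) :
    cliffMul N a b (isotropyAlg N T (frame N a b k)) =
      vertCl ((T : Amb N).2 * x - x * (T : Amb N).2) := by
  have hΩ : (Ωc N a : ℂ) ≠ 0 := Complex.ofReal_ne_zero.2 (Ωc_pos ha).ne'
  rw [cliffMul_eq ha hb, isotropyAlg_zero, h0, mul_smul_comm, smul_mul_assoc, ← smul_sub,
    vertCl_smul, smul_smul, Complex.ofReal_inv, mul_inv_cancel₀ hΩ, one_smul]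
  simp [isotropyAlg_succ, h1, horCl_zero]

lemma cliffMul_isotropyAlg_hor (ha : 0 < a) (hb : 0 < b) (T : isoAlg N) {k : IdxE N} {p : Fin N}
    {q : ℍ[ℝ]} (h0 : ((frame N a b k : 𝔪 N) : Amb N).1 0 0 = 0)
    (h1 : ∀ r : Fin N, ((frame N a b k : 𝔪 N) : Amb N).1 r.succ 0 =
      if r = p then horCoeff N b • q else 0) :
    cliffMul N a b (isotropyAlg N T (frame N a b k)) =
      ∑ r : Fin N, horCl r ((T : Amb N).1 r.succ p.succ * q) - horCl p (q * (T : Amb N).2) := by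
  have hc : (horCoeff N b : ℂ) ≠ 0 := Complex.ofReal_ne_zero.2 (horCoeff_pos hb).ne'
  have hv : vertCl (N := N) 0 = 0 := by simp [vertCl]
  rw [cliffMul_eq ha hb, isotropyAlg_zero, h0, mul_zero, zero_mul, sub_zero, hv, smul_zero,
    zero_add]
  have h2 : ∀ r : Fin N, horCl r (((isotropyAlg N T (frame N a b k) : 𝔪 N) : Amb N).1 r.succ 0) =
      (horCoeff N b : ℂ) • (horCl r ((T : Amb N).1 r.succ p.succ * q) -
        if r = p then horCl p (q * (T : Amb N).2) else 0) := by
    intro r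
    rw [isotropyAlg_succ]
    simp only [h1, mul_ite, mul_zero, Finset.sum_ite_eq', Finset.mem_univ, if_true]
    by_cases h : r = p
    · subst h
      rw [if_pos rfl, if_pos rfl, mul_smul_comm, smul_mul_assoc, ← smul_sub, horCl_smul, horCl_sub]
    · rw [if_neg h, if_neg h, zero_mul, sub_zero, sub_zero, mul_smul_comm, horCl_smul]
  simp only [h2]
  rw [← Finset.smul_sum, smul_smul, inv_mul_cancel₀ hc, one_smul, Finset.sum_sub_distrib]
  simp

lemma snd_re_eq_zero (T : isoAlg N) : (T : Amb N).2.re = 0 := by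
  have := congrArg (fun q : ℍ[ℝ] => q.re) (congrArg Prod.snd T.2.1)
  simp only [Prod.snd_star, Prod.snd_neg, Quaternion.re_star, Quaternion.re_neg] at this
  linarith

lemma skew_entry (T : isoAlg N) (i j : Fin (N + 1)) :
    -star ((T : Amb N).1 i j) = (T : Amb N).1 j i := by
  have := congrFun (congrFun (congrArg Prod.fst T.2.1) j) i
  simp only [Prod.fst_star, Matrix.star_apply, Prod.fst_neg, Matrix.neg_apply] at this
  rw [this, neg_neg]

/-- The operator by which the lower right block of a matrix acts. -/
noncomputable def lowOp (X : HMat N) : Module.End ℂ (Spinor N) :=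
  ∑ p : Fin N, ∑ r : Fin N, lowTerm r p (X r.succ p.succ)

/-- The spin representation of `𝔥` in terms of creation and annihilation operators. -/
lemma spinRep_explicit (ha : 0 < a) (hb : 0 < b) (T : isoAlg N) :
    spinRep ha hb T = lowOp (T : Amb N).1 + diagTerm N (T : Amb N).2 := by
  rw [spinRep_eq]
  simp only [← Complex.coe_smul]
  rw [← Finset.smul_sum, Fintype.sum_option, Fintype.sum_prod_type, Fintype.sum_option,
    Fintype.sum_prod_type, ← add_assoc]
  simp only [Fin.sum_univ_two]
  rw [cliffMul_isotropyAlg_vert (x := qi) ha hb T (frame_zero a b _) (frame_succ a b _),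
    cliffMul_isotropyAlg_vert (x := -qk) ha hb T (frame_zero a b _) (frame_succ a b _),
    cliffMul_isotropyAlg_vert (x := qj) ha hb T (frame_zero a b _) (frame_succ a b _), block_vert]
  have hH : ∀ p : Fin N,
      γ (some (some (p, 0), 0)) *
        cliffMul N a b (isotropyAlg N T (frame N a b (some (some (p, 0), 0)))) +
      γ (some (some (p, 0), 1)) *
        cliffMul N a b (isotropyAlg N T (frame N a b (some (some (p, 0), 1)))) +
      (γ (some (some (p, 1), 0)) *
        cliffMul N a b (isotropyAlg N T (frame N a b (some (some (p, 1), 0)))) +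
      γ (some (some (p, 1), 1)) *
        cliffMul N a b (isotropyAlg N T (frame N a b (some (some (p, 1), 1))))) =
      ∑ r : Fin N, ((2 : ℂ) • lowTerm r p ((T : Amb N).1 r.succ p.succ) +
        (2 : ℂ) • lowTerm p r ((T : Amb N).1 p.succ r.succ)) +
      (4 : ℂ) • (((T : Amb N).2.imI * Complex.I) • (1 - num (some (p, 0)) - num (some (p, 1))) +
        ((T : Amb N).2.imJ * Complex.I) • (wedgeY (some (p, 0)) * wedgeY (some (p, 1)) -
          contrX (some (p, 0)) * contrX (some (p, 1))) +
        ((T : Amb N).2.imK : ℂ) • (wedgeY (some (p, 0)) * wedgeY (some (p, 1)) +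
          contrX (some (p, 0)) * contrX (some (p, 1)))) := by
    intro p
    rw [cliffMul_isotropyAlg_hor (q := qj) (p := p) ha hb T (frame_zero a b _) (frame_succ a b _),
      cliffMul_isotropyAlg_hor (q := qk) (p := p) ha hb T (frame_zero a b _) (frame_succ a b _),
      cliffMul_isotropyAlg_hor (q := qi) (p := p) ha hb T (frame_zero a b _) (frame_succ a b _),
      cliffMul_isotropyAlg_hor (q := 1) (p := p) ha hb T (frame_zero a b _) (frame_succ a b _)]
    have h1 := block_right p (snd_re_eq_zero T)
    have h2 : ∀ r : Fin N, _ := fun r => block_left p r ((T : Amb N).1 r.succ p.succ)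
    simp only [skew_entry] at h2
    -- The scalar correction of `block_left` only concerns r = p, and diagonal entries of a
    -- skew-Hermitian matrix have no real part.
    have h3 : ∑ r : Fin N, ((2 : ℂ) • lowTerm r p ((T : Amb N).1 r.succ p.succ) +
        (2 : ℂ) • lowTerm p r ((T : Amb N).1 p.succ r.succ)) =
        ∑ r : Fin N, ((2 : ℂ) • lowTerm r p ((T : Amb N).1 r.succ p.succ) +
        (2 : ℂ) • lowTerm p r ((T : Amb N).1 p.succ r.succ) - (if p = r then
          (4 * ((T : Amb N).1 r.succ p.succ).re : ℂ) else 0) • 1) := by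
      refine Finset.sum_congr rfl fun r _ => ?_
      by_cases h : p = r
      · subst h
        have := congrArg (fun q : ℍ[ℝ] => q.re) (skew_entry T p.succ p.succ)
        simp only [Quaternion.re_star, Quaternion.re_neg] at this
        have h0 : ((T : Amb N).1 p.succ p.succ).re = 0 := by linarith
        simp [h0]
      · simp [h]
    rw [h3, Finset.sum_congr rfl fun r _ => (h2 r).symm]
    rw [neg_smul, eq_neg_iff_add_eq_zero, add_comm, ← eq_neg_iff_add_eq_zero] at h1
    rw [h1]
    simp only [Finset.sum_add_distrib, ← Finset.mul_sum, mul_sub, mul_one, one_mul]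
    abel
  simp only [hH]
  rw [Finset.sum_add_distrib, ← Finset.smul_sum]
  -- Every entry is met twice with coefficient 2, which cancels the factor 1/4 of the spin
  -- representation.
  have hsym : ∑ p : Fin N, ∑ r : Fin N, ((2 : ℂ) • lowTerm r p ((T : Amb N).1 r.succ p.succ) +
      (2 : ℂ) • lowTerm p r ((T : Amb N).1 p.succ r.succ)) = (4 : ℂ) • lowOp (T : Amb N).1 := by
    simp only [Finset.sum_add_distrib, ← Finset.smul_sum]
    rw [Finset.sum_comm (f := fun p r => lowTerm p r ((T : Amb N).1 p.succ r.succ)), ← lowOp]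
    module
  rw [hsym]
  have hK : cartanOp N = (1 - (2 : ℂ) • num none) +
      ∑ p : Fin N, (1 - num (some (p, 0)) - num (some (p, 1))) := by
    rw [cartanOp, weightOp, Fintype.sum_option, Fintype.sum_prod_type]
    simp only [Fin.sum_univ_two, diagWeight, Finset.sum_sub_distrib, Finset.sum_add_distrib,
      Finset.sum_const, Finset.card_univ, Fintype.card_fin, Int.cast_one, one_smul]
    rw [← Nat.cast_smul_eq_nsmul ℂ]
    push_cast
    module
  rw [diagTerm, hK, omegaWedge, omegaContr]
  simp only [Finset.sum_add_distrib, ← Finset.smul_sum, Finset.sum_sub_distrib]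
  push_cast
  module

lemma diagTerm_eq (ζ : ℍ[ℝ]) : diagTerm N ζ = (ζ.imI * Complex.I) • cartanOp N +
    (ζ.imJ * Complex.I) • (raiseOp N - lowerOp N) + (ζ.imK : ℂ) • (raiseOp N + lowerOp N) := by
  rw [diagTerm, raiseOp, lowerOp, mul_add, mul_sub]
  match_scalars <;> apply Complex.ext <;> simp

/-! ### Elements of the isotropy algebra -/

lemma diagElt_mem {ζ : ℍ[ℝ]} (hζ : star ζ = -ζ) :
    ((Matrix.single 0 0 ζ, ζ) : Amb N) ∈ isoAlg N := by
  refine ⟨Prod.ext ?_ hζ, fun i => ?_⟩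
  · simp [Matrix.star_eq_conjTranspose, Matrix.conjTranspose_single, hζ, Matrix.single_neg]
  · by_cases hi : i = 0
    · subst hi; simp
    · simp [hi, Ne.symm hi]

lemma lowElt_mem (r p : Fin N) (x : ℍ[ℝ]) :
    ((Matrix.single r.succ p.succ x - Matrix.single p.succ r.succ (star x), 0) : Amb N) ∈
      isoAlg N := by
  refine ⟨Prod.ext ?_ (by simp), fun i => ?_⟩
  · simp [Matrix.star_eq_conjTranspose, Matrix.conjTranspose_single]
  · simp [Fin.succ_ne_zero]

/-- The element `x E_{r,p} - x̄ E_{p,r}` of `𝔰𝔭(n-1)`. -/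
noncomputable def lowElt (r p : Fin N) (x : ℍ[ℝ]) : isoAlg N := ⟨_, lowElt_mem r p x⟩

/-- The element `(ζ F₁₁, ζ)` of `𝔰𝔭(1)`. -/
noncomputable def diagElt (N : ℕ) (ζ : ℍ[ℝ]) (hζ : star ζ = -ζ) : isoAlg N := ⟨_, diagElt_mem hζ⟩

lemma diagElt_mem_spDiag {ζ : ℍ[ℝ]} (hζ : star ζ = -ζ) : diagElt N ζ hζ ∈ spDiag N := rfl

lemma lowElt_mem_spLower (r p : Fin N) (x : ℍ[ℝ]) : lowElt r p x ∈ spLower N := rfl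

lemma lowTerm_zero (r p : Fin N) : lowTerm r p 0 = 0 := by
  simp [lowTerm, cA, cB, cA', cB']

lemma lowTerm_add (r p : Fin N) (x x' : ℍ[ℝ]) :
    lowTerm r p (x + x') = lowTerm r p x + lowTerm r p x' := by
  simp only [lowTerm, cA, cB, cA', cB', Quaternion.re_add, Quaternion.imI_add, Quaternion.imJ_add,
    Quaternion.imK_add]
  push_cast
  module

lemma diagTerm_zero : diagTerm N 0 = 0 := by simp [diagTerm]

lemma lowOp_add (X Y : HMat N) : lowOp (X + Y) = lowOp X + lowOp Y := by
  simp only [lowOp, Matrix.add_apply, lowTerm_add, Finset.sum_add_distrib]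

lemma lowOp_single (r p : Fin N) (x : ℍ[ℝ]) :
    lowOp (Matrix.single r.succ p.succ x) = lowTerm r p x := by
  rw [lowOp, Finset.sum_eq_single p, Finset.sum_eq_single r]
  · simp
  · intro r' _ h; simp [Ne.symm h, lowTerm_zero]
  · simp
  · intro p' _ h
    refine Finset.sum_eq_zero fun r' _ => ?_
    simp [Ne.symm h, lowTerm_zero]
  · simp

lemma spinRep_lowElt (ha : 0 < a) (hb : 0 < b) (r p : Fin N) (x : ℍ[ℝ]) :
    spinRep ha hb (lowElt r p x) = lowTerm r p x + lowTerm p r (-star x) := by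
  rw [spinRep_explicit]
  simp only [lowElt]
  rw [diagTerm_zero, add_zero, sub_eq_add_neg, Matrix.single_neg, lowOp_add, lowOp_single,
    lowOp_single]

lemma spinRep_of_mem_spDiag (ha : 0 < a) (hb : 0 < b) {T : isoAlg N} (hT : T ∈ spDiag N) :
    spinRep ha hb T = diagTerm N (T : Amb N).2 := by
  rw [spinRep_explicit, show (T : Amb N).1 = _ from hT]
  have : lowOp (Matrix.single 0 0 (T : Amb N).2 : HMat N) = 0 := by
    refine Finset.sum_eq_zero fun p _ => Finset.sum_eq_zero fun r _ => ?_
    simp [(Fin.succ_ne_zero _).symm, lowTerm_zero]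
  rw [this, zero_add]

lemma spinRep_of_mem_spLower (ha : 0 < a) (hb : 0 < b) {T : isoAlg N} (hT : T ∈ spLower N) :
    spinRep ha hb T = lowOp (T : Amb N).1 := by
  rw [spinRep_explicit, show (T : Amb N).2 = 0 from hT, diagTerm_zero, add_zero]

end Explicit

/-! ### Invariants of 𝔰𝔭_ℂ(2n-2) and of 𝔥_ℂ. -/

section Invariants

variable {N : ℕ} {a b : ℝ}

lemma wedgeY_mul_contrX_mul_wedgeY (r p s : IdxY N) : wedgeY r * contrX p * wedgeY s =
    wedgeY s * (wedgeY r * contrX p) + if p = s then wedgeY r else 0 := by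
  rw [mul_assoc, eq_sub_of_add_eq (contr_wedge p s), mul_sub, mul_smul_comm, mul_one,
    ← mul_assoc, wedgeY_comm r s, neg_mul, sub_neg_eq_add, mul_assoc, add_comm]
  split_ifs <;> simp

lemma lowTerm_mul_wedgeY_zero (r p s : Fin N) (x : ℍ[ℝ]) :
    lowTerm r p x * wedgeY (some (s, 0)) = wedgeY (some (s, 0)) * lowTerm r p x +
      if p = s then cA' x • wedgeY (some (r, 0)) - cB' x • wedgeY (some (r, 1)) else 0 := by
  simp only [lowTerm, add_mul, sub_mul, smul_mul_assoc, wedgeY_mul_contrX_mul_wedgeY, mul_add,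
    mul_sub, mul_smul_comm]
  by_cases h : p = s
  · simp [h]; abel
  · simp [h]

lemma lowTerm_mul_wedgeY_one (r p s : Fin N) (x : ℍ[ℝ]) :
    lowTerm r p x * wedgeY (some (s, 1)) = wedgeY (some (s, 1)) * lowTerm r p x +
      if p = s then cA x • wedgeY (some (r, 1)) + cB x • wedgeY (some (r, 0)) else 0 := by
  simp only [lowTerm, add_mul, sub_mul, smul_mul_assoc, wedgeY_mul_contrX_mul_wedgeY, mul_add,
    mul_sub, mul_smul_comm]
  by_cases h : p = s
  · simp [h]; abel
  · simp [h]

lemma lowOp_mul_wedgeY_none (X : HMat N) : lowOp X * wedgeY none = wedgeY none * lowOp X := by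
  simp only [lowOp, Finset.sum_mul, Finset.mul_sum]
  refine Finset.sum_congr rfl fun p _ => Finset.sum_congr rfl fun r _ => ?_
  simp only [lowTerm, add_mul, sub_mul, smul_mul_assoc, wedgeY_mul_contrX_mul_wedgeY, mul_add,
    mul_sub, mul_smul_comm]
  simp

lemma lowOp_mul_wedgeY_zero (X : HMat N) (s : Fin N) : lowOp X * wedgeY (some (s, 0)) =
    wedgeY (some (s, 0)) * lowOp X + ∑ r : Fin N, (cA' (X r.succ s.succ) • wedgeY (some (r, 0)) -
      cB' (X r.succ s.succ) • wedgeY (some (r, 1))) := by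
  simp only [lowOp, Finset.sum_mul, Finset.mul_sum, lowTerm_mul_wedgeY_zero,
    Finset.sum_add_distrib]
  congr 1
  rw [Finset.sum_comm]
  simp

lemma lowOp_mul_wedgeY_one (X : HMat N) (s : Fin N) : lowOp X * wedgeY (some (s, 1)) =
    wedgeY (some (s, 1)) * lowOp X + ∑ r : Fin N, (cA (X r.succ s.succ) • wedgeY (some (r, 1)) +
      cB (X r.succ s.succ) • wedgeY (some (r, 0))) := by
  simp only [lowOp, Finset.sum_mul, Finset.mul_sum, lowTerm_mul_wedgeY_one,
    Finset.sum_add_distrib]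
  congr 1
  rw [Finset.sum_comm]
  simp [Finset.sum_add_distrib]

/-- The form `ω` is invariant under `𝔰𝔭(n-1)`. -/
lemma lowOp_mul_omegaWedge {X : HMat N} (hX : ∀ i j, -star (X i j) = X j i) :
    lowOp X * omegaWedge N = omegaWedge N * lowOp X := by
  set f : Fin N → Fin N → Module.End ℂ (Spinor N) := fun r s =>
    (cA' (X r.succ s.succ) • wedgeY (some (r, 0)) - cB' (X r.succ s.succ) • wedgeY (some (r, 1))) *
      wedgeY (some (s, 1)) + wedgeY (some (s, 0)) *
      (cA (X r.succ s.succ) • wedgeY (some (r, 1)) + cB (X r.succ s.succ) • wedgeY (some (r, 0)))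
    with hf
  have h1 : lowOp X * omegaWedge N = omegaWedge N * lowOp X + ∑ s, ∑ r, f r s := by
    rw [omegaWedge, Finset.mul_sum, Finset.sum_mul, ← Finset.sum_add_distrib]
    refine Finset.sum_congr rfl fun s _ => ?_
    rw [← mul_assoc, lowOp_mul_wedgeY_zero, add_mul, mul_assoc, lowOp_mul_wedgeY_one, mul_add,
      ← mul_assoc, add_assoc, Finset.sum_mul, Finset.mul_sum, ← Finset.sum_add_distrib]
    congr 1
    exact Finset.sum_congr rfl fun r _ => add_comm _ _
  -- The failure to commute is a double sum that is antisymmetric because X is skew-Hermitian, so it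
  -- vanishes.
  have h2 : ∀ r s, f s r = -f r s := by
    intro r s
    have hA : cA (X s.succ r.succ) = -cA' (X r.succ s.succ) := by
      rw [← hX r.succ s.succ]; simp [cA, cA']; ring
    have hA' : cA' (X s.succ r.succ) = -cA (X r.succ s.succ) := by
      rw [← hX r.succ s.succ]; simp [cA, cA']; ring
    have hB : cB (X s.succ r.succ) = cB (X r.succ s.succ) := by
      rw [← hX r.succ s.succ]; simp [cB]
    have hB' : cB' (X s.succ r.succ) = cB' (X r.succ s.succ) := by
      rw [← hX r.succ s.succ]; simp [cB']
    simp only [hf, hA, hA', hB, hB', mul_add, sub_mul, smul_mul_assoc, mul_smul_comm]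
    rw [wedgeY_comm (some (s, 1)) (some (r, 1)), wedgeY_comm (some (r, 0)) (some (s, 0))]
    module
  have h3 : ∑ s, ∑ r, f r s = 0 := by
    have h4 : ∑ s, ∑ r, f r s = -∑ s, ∑ r, f r s := by
      rw [← Finset.sum_neg_distrib, Finset.sum_comm]
      refine Finset.sum_congr rfl fun s _ => ?_
      rw [← Finset.sum_neg_distrib]
      exact Finset.sum_congr rfl fun r _ => h2 r s
    rw [eq_neg_iff_add_eq_zero, ← two_smul ℂ] at h4
    exact (smul_eq_zero.1 h4).resolve_left two_ne_zero
  rw [h1, h3, add_zero]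

lemma lowOp_one (X : HMat N) : lowOp X (1 : Spinor N) = 0 := by
  simp [lowOp, lowTerm, LinearMap.sum_apply, contrX_one]

lemma lowOp_of_mem_omegaSpan {X : HMat N} (hX : ∀ i j, -star (X i j) = X j i) {ψ : Spinor N}
    (h : ψ ∈ omegaSpan N) : lowOp X ψ = 0 := by
  have hpow : ∀ k, lowOp X (ω N ^ k) = 0 := by
    intro k
    induction k with
    | zero => rw [pow_zero, lowOp_one]
    | succ k ih =>
      rw [pow_succ', ← omegaWedge_apply, ← Module.End.mul_apply, lowOp_mul_omegaWedge hX,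
        Module.End.mul_apply, ih, map_zero]
  refine (sup_le (Submodule.span_le.2 ?_) (Submodule.span_le.2 ?_) :
    omegaSpan N ≤ LinearMap.ker (lowOp X)) h
  · rintro _ ⟨k, rfl⟩
    exact hpow k
  · rintro _ ⟨k, rfl⟩
    change lowOp X (wedgeY none (ω N ^ k)) = 0
    rw [← Module.End.mul_apply, lowOp_mul_wedgeY_none, Module.End.mul_apply, hpow, map_zero]

/-- The entries 1 and i suffice: their complex combination is the matrix unit of 𝔤𝔩_{n-1} ⊂
𝔰𝔭_ℂ(2n-2), acting on the modes (p, 0) as on V and on the modes (p, 1) as on V*. -/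
lemma isSpInvariant_of_lowElt (ha : 0 < a) (hb : 0 < b) {ψ : Spinor N}
    (h1 : ∀ r p, spinRep ha hb (lowElt r p 1) ψ = 0)
    (hi : ∀ r p, spinRep ha hb (lowElt r p qi) ψ = 0) : IsSpInvariant ψ := by
  intro p r
  have key : spinRep ha hb (lowElt r p 1) + Complex.I • spinRep ha hb (lowElt r p qi) =
      (2 : ℂ) • (wedgeY (some (r, 0)) * contrX (some (p, 0)) -
        wedgeY (some (p, 1)) * contrX (some (r, 1))) := by
    rw [spinRep_lowElt, spinRep_lowElt]
    simp only [lowTerm, cA, cB, cA', cB', star_qi, neg_neg, qi_re, qi_imI, qi_imJ, qi_imK, star_one,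
      Quaternion.re_neg, Quaternion.imI_neg, Quaternion.imJ_neg, Quaternion.imK_neg,
      Quaternion.re_one, Quaternion.imI_one, Quaternion.imJ_one, Quaternion.imK_one]
    match_scalars <;> apply Complex.ext <;> simp <;> norm_num
  have h2 := LinearMap.congr_fun key ψ
  rw [LinearMap.add_apply, LinearMap.smul_apply, h1, hi, smul_zero, add_zero, LinearMap.smul_apply]
    at h2
  exact sub_eq_zero.1 ((smul_eq_zero.1 h2.symm).resolve_left two_ne_zero)

lemma mem_annihilated (ha : 0 < a) (hb : 0 < b) {K : Submodule ℂ (ℂ ⊗[ℝ] isoAlg N)}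
    {ψ : Spinor N} : ψ ∈ annihilated ha hb K ↔ ∀ T ∈ K, spinRepC ha hb T ψ = 0 := by
  simp [annihilated, Submodule.mem_iInf]

/-- By complex linearity, only real elements have to be tested. -/
lemma mem_annihilated_baseChange (ha : 0 < a) (hb : 0 < b) {K : Submodule ℝ (isoAlg N)}
    {ψ : Spinor N} :
    ψ ∈ annihilated ha hb (K.baseChange ℂ) ↔ ∀ T ∈ K, spinRep ha hb T ψ = 0 := by
  rw [mem_annihilated]
  constructor
  · intro h T hT
    have := h _ (Submodule.tmul_mem_baseChange_of_mem 1 hT)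
    rwa [spinRepC_tmul, one_smul] at this
  · intro h T hT
    rw [Submodule.baseChange_eq_span] at hT
    induction hT using Submodule.span_induction with
    | mem x hx =>
      obtain ⟨S, hS, rfl⟩ := hx
      change spinRepC ha hb (1 ⊗ₜ S) ψ = 0
      rw [spinRepC_tmul, one_smul, h S hS]
    | zero => simp
    | add x y _ _ hx hy => rw [map_add, LinearMap.add_apply, hx, hy, add_zero]
    | smul c x _ hx => rw [map_smul, LinearMap.smul_apply, hx, smul_zero]

lemma mem_annihilated_top (ha : 0 < a) (hb : 0 < b) {ψ : Spinor N} :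
    ψ ∈ annihilated ha hb (⊤ : Submodule ℂ (ℂ ⊗[ℝ] isoAlg N)) ↔
      ∀ T : isoAlg N, spinRep ha hb T ψ = 0 := by
  rw [← Submodule.baseChange_top (A := ℂ) (R := ℝ) (M := isoAlg N), mem_annihilated_baseChange]
  simp

/-- The `𝔰𝔭_ℂ(2n-2)`-invariant spinors. -/
lemma annihilated_spLowerC (ha : 0 < a) (hb : 0 < b) :
    annihilated ha hb (spLowerC N) = omegaSpan N := by
  ext ψ
  rw [spLowerC, mem_annihilated_baseChange]
  refine ⟨fun h => ?_, fun h T hT => ?_⟩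
  · exact (isSpInvariant_of_lowElt ha hb (fun r p => h _ (lowElt_mem_spLower r p 1))
      fun r p => h _ (lowElt_mem_spLower r p qi)).mem_omegaSpan
  · rw [spinRep_of_mem_spLower ha hb hT]
    exact lowOp_of_mem_omegaSpan (fun i j => skew_entry T i j) h

/-- The actions of (ζF₁₁, ζ) for ζ = i, j, k and the weight, raising and lowering operators have the
same complex span. -/
lemma isStable_spDiagC (ha : 0 < a) (hb : 0 < b) {U : Submodule ℂ (Spinor N)} :
    IsStable ha hb (spDiagC N) U ↔ ChainStable U := by
  constructor
  · intro h ψ hψ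
    have hT : ∀ ζ (hζ : star ζ = -ζ), diagTerm N ζ ψ ∈ U := by
      intro ζ hζ
      have := h _ (Submodule.tmul_mem_baseChange_of_mem 1 (diagElt_mem_spDiag hζ)) ψ hψ
      rwa [spinRepC_tmul, one_smul, spinRep_of_mem_spDiag ha hb (diagElt_mem_spDiag hζ)] at this
    have hi := hT qi star_qi
    have hj := hT qj star_qj
    have hk := hT qk star_qk
    have ei : diagTerm N qi = Complex.I • cartanOp N := by
      rw [diagTerm_eq]; simp [qi_imI, qi_imJ, qi_imK]
    have ej : diagTerm N qj = Complex.I • (raiseOp N - lowerOp N) := by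
      rw [diagTerm_eq]; simp [qj_imI, qj_imJ, qj_imK]
    have ek : diagTerm N qk = raiseOp N + lowerOp N := by
      rw [diagTerm_eq]; simp [qk_imI, qk_imJ, qk_imK]
    rw [ei, LinearMap.smul_apply, U.smul_mem_iff Complex.I_ne_zero] at hi
    rw [ej, LinearMap.smul_apply, U.smul_mem_iff Complex.I_ne_zero] at hj
    rw [ek] at hk
    refine ⟨hi, ?_, ?_⟩
    · have h2 := U.add_mem hk hj
      rw [← LinearMap.add_apply, show raiseOp N + lowerOp N + (raiseOp N - lowerOp N) =
        (2 : ℂ) • raiseOp N by module, LinearMap.smul_apply, U.smul_mem_iff two_ne_zero] at h2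
      exact h2
    · have h2 := U.sub_mem hk hj
      rw [← LinearMap.sub_apply, show raiseOp N + lowerOp N - (raiseOp N - lowerOp N) =
        (2 : ℂ) • lowerOp N by module, LinearMap.smul_apply, U.smul_mem_iff two_ne_zero] at h2
      exact h2
  · intro h T hT ψ hψ
    rw [spDiagC, Submodule.baseChange_eq_span] at hT
    induction hT using Submodule.span_induction with
    | mem x hx =>
      obtain ⟨S, hS, rfl⟩ := hx
      change spinRepC ha hb (1 ⊗ₜ S) ψ ∈ U
      rw [spinRepC_tmul, one_smul, spinRep_of_mem_spDiag ha hb hS, diagTerm_eq]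
      obtain ⟨h1, h2, h3⟩ := h ψ hψ
      exact U.add_mem (U.add_mem (U.smul_mem _ h1) (U.smul_mem _ (U.sub_mem h2 h3)))
        (U.smul_mem _ (U.add_mem h2 h3))
    | zero => simp
    | add x y _ _ hx hy => rw [map_add, LinearMap.add_apply]; exact U.add_mem hx hy
    | smul c x _ hx => rw [map_smul, LinearMap.smul_apply]; exact U.smul_mem _ hx

lemma isIrred_bigSummand (ha : 0 < a) (hb : 0 < b) :
    IsIrred ha hb (spDiagC N) (bigSummand N) := by
  refine ⟨(isStable_spDiagC ha hb).2 chainStable_bigSummand, fun h => ?_, fun U hU hst =>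
    bigSummand_irreducible hU ((isStable_spDiagC ha hb).1 hst)⟩
  have := finrank_bigSummand (N := N)
  rw [h, finrank_bot] at this
  omega

lemma isIrred_smallSummand (ha : 0 < a) (hb : 0 < b) (hN : N ≠ 0) :
    IsIrred ha hb (spDiagC N) (smallSummand N) := by
  refine ⟨(isStable_spDiagC ha hb).2 chainStable_smallSummand, fun h => ?_, fun U hU hst =>
    smallSummand_irreducible hU ((isStable_spDiagC ha hb).1 hst)⟩
  have := finrank_smallSummand (N := N)
  rw [h, finrank_bot] at this
  omega

/-- The spinors annihilated by the operators that generate the action of `𝔰𝔭_ℂ(2)`. -/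
def ChainInvariant (ψ : Spinor N) : Prop := cartanOp N ψ = 0 ∧ raiseOp N ψ = 0 ∧ lowerOp N ψ = 0

lemma mem_annihilated_top_iff (ha : 0 < a) (hb : 0 < b) {ψ : Spinor N} :
    ψ ∈ annihilated ha hb (⊤ : Submodule ℂ (ℂ ⊗[ℝ] isoAlg N)) ↔
      ψ ∈ omegaSpan N ∧ ChainInvariant ψ := by
  rw [mem_annihilated_top]
  constructor
  · intro h
    refine ⟨?_, ?_⟩
    · rw [← annihilated_spLowerC ha hb, spLowerC, mem_annihilated_baseChange]
      exact fun T _ => h T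
    · have hT : ∀ ζ (hζ : star ζ = -ζ), diagTerm N ζ ψ = 0 := fun ζ hζ => by
        rw [← h (diagElt N ζ hζ), spinRep_of_mem_spDiag ha hb (diagElt_mem_spDiag hζ)]; rfl
      have hi := hT qi star_qi
      have hj := hT qj star_qj
      have hk := hT qk star_qk
      rw [diagTerm_eq] at hi hj hk
      simp only [qi_imI, qi_imJ, qi_imK, qj_imI, qj_imJ, qj_imK, qk_imI, qk_imJ, qk_imK,
        Complex.ofReal_zero, Complex.ofReal_one, zero_mul, zero_smul, one_mul, one_smul, add_zero,
        zero_add, LinearMap.smul_apply, LinearMap.add_apply, LinearMap.sub_apply,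
        smul_eq_zero, Complex.I_ne_zero, false_or] at hi hj hk
      have hr : raiseOp N ψ = 0 := by
        rw [← sub_eq_zero.1 hj, ← two_smul ℂ] at hk
        exact (smul_eq_zero.1 hk).resolve_left two_ne_zero
      exact ⟨hi, hr, by rw [← sub_eq_zero.1 hj, hr]⟩
  · rintro ⟨h1, h2, h3, h4⟩ T
    rw [spinRep_explicit, LinearMap.add_apply,
      lowOp_of_mem_omegaSpan (fun i j => skew_entry T i j) h1, diagTerm_eq]
    simp [h2, h3, h4]

/-- A nonzero invariant spans a stable line, which irreducibility would make equal to W. -/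
lemma eq_zero_of_chainInvariant {W : Submodule ℂ (Spinor N)}
    (hirr : ∀ U ≤ W, ChainStable U → U = ⊥ ∨ U = W) (hdim : Module.finrank ℂ W ≠ 1)
    {ψ : Spinor N} (hψ : ψ ∈ W) (h : ChainInvariant ψ) : ψ = 0 := by
  by_contra hne
  have hst : ChainStable (Submodule.span ℂ {ψ}) := by
    intro φ hφ
    obtain ⟨r, rfl⟩ := Submodule.mem_span_singleton.1 hφ
    rw [map_smul, map_smul, map_smul, h.1, h.2.1, h.2.2, smul_zero]
    exact ⟨Submodule.zero_mem _, Submodule.zero_mem _, Submodule.zero_mem _⟩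
  rcases hirr _ ((Submodule.span_singleton_le_iff_mem _ _).2 hψ) hst with h1 | h1
  · exact hne (Submodule.span_singleton_eq_bot.1 h1)
  · rw [← h1, finrank_span_singleton hne] at hdim
    exact hdim rfl

/-- The components of an invariant are invariant, and the big summand, of dimension N + 2 ≠ 1, has
none. -/
lemma mem_smallSummand_of_chainInvariant {ψ : Spinor N} (hψ : ψ ∈ omegaSpan N)
    (h : ChainInvariant ψ) : ψ ∈ smallSummand N := by
  rw [← bigSummand_sup_smallSummand] at hψ
  obtain ⟨u, hu, v, hv, rfl⟩ := Submodule.mem_sup.1 hψ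
  have key : ∀ f : Module.End ℂ (Spinor N), f u ∈ bigSummand N → f v ∈ smallSummand N →
      f (u + v) = 0 → f u = 0 := by
    intro f h1 h2 h3
    rw [map_add] at h3
    have h4 : f u ∈ bigSummand N ⊓ smallSummand N :=
      ⟨h1, by rw [eq_neg_of_add_eq_zero_left h3]; exact Submodule.neg_mem _ h2⟩
    rw [bigSummand_inf_smallSummand] at h4
    exact h4
  have su := chainStable_bigSummand u hu
  have sv := chainStable_smallSummand v hv
  have hu0 : u = 0 := eq_zero_of_chainInvariant (fun U hU => bigSummand_irreducible hU)
    (by rw [finrank_bigSummand]; omega) hu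
    ⟨key _ su.1 sv.1 h.1, key _ su.2.1 sv.2.1 h.2.1, key _ su.2.2 sv.2.2 h.2.2⟩
  rw [hu0, zero_add]
  exact hv

lemma annihilated_top_eq_bot (ha : 0 < a) (hb : 0 < b) (hN : N ≠ 1) :
    annihilated ha hb (⊤ : Submodule ℂ (ℂ ⊗[ℝ] isoAlg N)) = ⊥ := by
  refine eq_bot_iff.2 fun ψ hψ => ?_
  obtain ⟨h1, h2⟩ := (mem_annihilated_top_iff ha hb).1 hψ
  exact eq_zero_of_chainInvariant (fun U hU => smallSummand_irreducible hU)
    (by rwa [finrank_smallSummand]) (mem_smallSummand_of_chainInvariant h1 h2) h2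

lemma annihilated_top_eq_span {a b : ℝ} (ha : 0 < a) (hb : 0 < b) :
    annihilated ha hb (⊤ : Submodule ℂ (ℂ ⊗[ℝ] isoAlg 1)) =
      Submodule.span ℂ {smallVec 1 0} := by
  have hs : smallSummand 1 = Submodule.span ℂ {smallVec 1 0} := by
    rw [smallSummand, Set.range_unique]; rfl
  refine le_antisymm (fun ψ hψ => ?_) ?_
  · obtain ⟨h1, h2⟩ := (mem_annihilated_top_iff ha hb).1 hψ
    rw [← hs]
    exact mem_smallSummand_of_chainInvariant h1 h2
  · rw [Submodule.span_singleton_le_iff_mem, mem_annihilated_top_iff]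
    refine ⟨?_, ?_, ?_, lowerOp_smallVec_zero⟩
    · rw [← bigSummand_sup_smallSummand]
      exact Submodule.mem_sup_right (smallVec_mem 0 one_pos)
    · rw [cartanOp_smallVec]; simp
    · rw [raiseOp_smallVec]; exact smallVec_eq_zero

lemma smallVec_mem_span : smallVec 1 0 ∈ Submodule.span ℂ {y₁ 1, ω 1} := by
  rw [smallVec]
  refine Submodule.add_mem _ ?_ (Submodule.smul_mem _ _ ?_)
  · rw [zero_add, pow_one]
    exact Submodule.subset_span (by simp)
  · rw [pow_zero, mul_one]
    exact Submodule.subset_span (by simp)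

end Invariants

/-! ### Explicit elements of H and their action on 𝔪. -/

section Group

variable {N : ℕ}

lemma mem_H_of_fixesAxis {g : G N} (hg : FixesAxis (toAmb g)) : g ∈ H N := by
  refine MulAction.mem_stabilizer_iff.2 (Subtype.ext (funext fun i => ?_))
  change ((g.1 : HMat N).mulVec (Pi.single 0 1)) i * star (g.2 : ℍ[ℝ]) =
    (Pi.single 0 1 : Fin (N + 1) → ℍ[ℝ]) i
  rw [Matrix.mulVec_single_one]
  have h := hg i
  change (g.1 : HMat N) i 0 = if i = 0 then (g.2 : ℍ[ℝ]) else 0 at h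
  change (g.1 : HMat N) i 0 * star (g.2 : ℍ[ℝ]) = _
  rw [h]
  by_cases hi : i = 0
  · subst hi
    simp
  · simp [hi]

lemma diagonal_mem_unitary (d : Fin (N + 1) → unitary ℍ[ℝ]) :
    (Matrix.diagonal fun i => (d i : ℍ[ℝ])) ∈ unitary (HMat N) := by
  rw [Unitary.mem_iff]
  constructor
  · rw [Matrix.star_eq_conjTranspose, Matrix.diagonal_conjTranspose, Matrix.diagonal_mul_diagonal,
      ← Matrix.diagonal_one]
    congr 1
    funext i
    exact Unitary.coe_star_mul_self (d i)
  · rw [Matrix.star_eq_conjTranspose, Matrix.diagonal_conjTranspose, Matrix.diagonal_mul_diagonal,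
      ← Matrix.diagonal_one]
    congr 1
    funext i
    exact Unitary.coe_mul_star_self (d i)

/-- The element `(diag(d₁, …, dₙ), d₁)` of `H`. -/
noncomputable def diagH (d : Fin (N + 1) → unitary ℍ[ℝ]) : H N :=
  ⟨(⟨_, diagonal_mem_unitary d⟩, d 0), mem_H_of_fixesAxis fun i => by
    change Matrix.diagonal (fun i => (d i : ℍ[ℝ])) i 0 = if i = 0 then (d 0 : ℍ[ℝ]) else 0
    by_cases hi : i = 0
    · subst hi; simp
    · simp [hi]⟩

lemma toAmb_diagH (d : Fin (N + 1) → unitary ℍ[ℝ]) :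
    toAmb (diagH d : G N) = (Matrix.diagonal fun i => (d i : ℍ[ℝ]), (d 0 : ℍ[ℝ])) := rfl

lemma toAmb_injective : Function.Injective (toAmb (N := N)) := fun _ _ hgh =>
  Prod.ext (Subtype.ext (congrArg Prod.fst hgh)) (Subtype.ext (congrArg Prod.snd hgh))

lemma diagH_mul (d d' : Fin (N + 1) → unitary ℍ[ℝ]) : diagH (d * d') = diagH d * diagH d' := by
  refine Subtype.ext (toAmb_injective ?_)
  change (_, _) = (_, _)
  refine Prod.ext ?_ rfl
  change Matrix.diagonal _ = Matrix.diagonal _ * Matrix.diagonal _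
  rw [Matrix.diagonal_mul_diagonal]
  rfl

/-- The rotation matrix in the plane of the coordinates `p` and `r`. -/
noncomputable def rotMat (p r : Fin N) (c s : ℝ) : HMat N :=
  1 + (c - 1) • (Matrix.single p.succ p.succ 1 + Matrix.single r.succ r.succ 1) +
    s • (Matrix.single r.succ p.succ 1 - Matrix.single p.succ r.succ 1)

/-- With P the projection to the plane and J the quarter turn in it, J² = -P, so the product is 1 +
(c² + s² - 1)P. -/
lemma rotMat_mul {p r : Fin N} (hpr : p ≠ r) {c s : ℝ} (h : c ^ 2 + s ^ 2 = 1) :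
    rotMat p r c s * rotMat p r c (-s) = 1 := by
  have h1 : (p.succ : Fin (N + 1)) ≠ r.succ := fun h => hpr (Fin.succ_injective _ h)
  have h2 := h1.symm
  set P : HMat N := Matrix.single p.succ p.succ 1 + Matrix.single r.succ r.succ 1 with hP
  set J : HMat N := Matrix.single r.succ p.succ 1 - Matrix.single p.succ r.succ 1 with hJ
  have hPP : P * P = P := by
    simp [hP, mul_add, add_mul, h1, h2]
  have hPJ : P * J = J := by
    simp [hP, hJ, mul_sub, add_mul, h1, h2]
  have hJP : J * P = J := by
    simp only [hP, hJ, sub_mul, mul_add]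
    simp [h1, h2]
    abel
  have hJJ : J * J = -P := by
    simp [hP, hJ, sub_mul, mul_sub, h1, h2]
    abel
  have e : rotMat p r c s * rotMat p r c (-s) = 1 + (c ^ 2 + s ^ 2 - 1) • P := by
    simp only [rotMat, ← hP, ← hJ, mul_add, add_mul, mul_one, one_mul, smul_mul_smul_comm, hPP, hPJ,
      hJP, hJJ]
    module
  rw [e, h]
  simp

lemma star_smul_HMat (t : ℝ) (X : HMat N) : star (t • X) = t • star X := by
  ext i j <;> simp [Matrix.star_apply]

lemma star_single (i j : Fin (N + 1)) (x : ℍ[ℝ]) :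
    star (Matrix.single i j x : HMat N) = Matrix.single j i (star x) :=
  Matrix.conjTranspose_single i j x

lemma star_rotMat (p r : Fin N) (c s : ℝ) : star (rotMat p r c s) = rotMat p r c (-s) := by
  simp only [rotMat, star_add, star_sub, star_one, star_smul_HMat, star_single]
  module

lemma rotMat_mem_unitary {p r : Fin N} (hpr : p ≠ r) {c s : ℝ} (h : c ^ 2 + s ^ 2 = 1) :
    rotMat p r c s ∈ unitary (HMat N) := by
  rw [Unitary.mem_iff, star_rotMat]
  refine ⟨?_, rotMat_mul hpr h⟩
  have := rotMat_mul hpr (c := c) (s := -s) (by rw [neg_sq, h])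
  rwa [neg_neg] at this

/-- The rotation in the plane of the coordinates `p` and `r`, as an element of `H`. -/
noncomputable def rotH {p r : Fin N} (hpr : p ≠ r) {c s : ℝ} (h : c ^ 2 + s ^ 2 = 1) : H N :=
  ⟨(⟨_, rotMat_mem_unitary hpr h⟩, 1), mem_H_of_fixesAxis fun i => by
    change rotMat p r c s i 0 = if i = 0 then (1 : ℍ[ℝ]) else 0
    simp [rotMat, Matrix.one_apply, Fin.succ_ne_zero]⟩

lemma toAmb_rotH {p r : Fin N} (hpr : p ≠ r) {c s : ℝ} (h : c ^ 2 + s ^ 2 = 1) :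
    toAmb (rotH hpr h : G N) = (rotMat p r c s, 1) := rfl

/-! ### The isotropy representation in coordinates -/

/-- Orthogonality to 𝔥 and skew-Hermiticity make an element of 𝔪 a function of its first column. -/
lemma ext_𝔪 {S T : 𝔪 N} (h0 : (S : Amb N).1 0 0 = (T : Amb N).1 0 0)
    (h1 : ∀ p : Fin N, (S : Amb N).1 p.succ 0 = (T : Amb N).1 p.succ 0) : S = T := by
  obtain ⟨-, hS, hS'⟩ := mem_structure S
  obtain ⟨-, hT, hT'⟩ := mem_structure T
  apply Subtype.ext
  rw [← sub_add_cancel (S : Amb N) (vert N S), ← sub_add_cancel (T : Amb N) (vert N T), hS', hT',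
    hS, hT, h0]
  simp only [h1]

lemma isotropy_zero (h : H N) (S : 𝔪 N) : ((isotropy N h S : 𝔪 N) : Amb N).1 0 0 =
    (toAmb (h : G N)).2 * (S : Amb N).1 0 0 * star (toAmb (h : G N)).2 := by
  have h1 := fixesAxis_star_toAmb h
  have hrow : ∀ i, (toAmb (h : G N)).1 0 i = if i = 0 then (toAmb (h : G N)).2 else 0 := by
    intro i
    have := congrArg star (h1 i)
    simp only [Prod.fst_star, Matrix.star_apply, star_star, Prod.snd_star] at this
    rw [this]
    split_ifs <;> simp
  rw [isotropy_coe]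
  simp only [Prod.fst_mul, Matrix.mul_apply, hrow, h1 _, Prod.snd_star]
  simp

lemma isotropy_succ (h : H N) (S : 𝔪 N) (p : Fin N) :
    ((isotropy N h S : 𝔪 N) : Amb N).1 p.succ 0 =
      (∑ r : Fin N, (toAmb (h : G N)).1 p.succ r.succ * (S : Amb N).1 r.succ 0) *
        star (toAmb (h : G N)).2 := by
  have h1 := fixesAxis_star_toAmb h
  have h2 := fixesAxis_of_mem h.2
  rw [isotropy_coe]
  simp only [Prod.fst_mul, Matrix.mul_apply, h1 _, Prod.snd_star]
  simp [Fin.sum_univ_succ, h2 p.succ, Fin.succ_ne_zero]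

lemma isotropy_diagH_succ (d : Fin (N + 1) → unitary ℍ[ℝ]) (S : 𝔪 N) (p : Fin N) :
    ((isotropy N (diagH d) S : 𝔪 N) : Amb N).1 p.succ 0 =
      d p.succ * (S : Amb N).1 p.succ 0 * star (d 0 : ℍ[ℝ]) := by
  rw [isotropy_succ, toAmb_diagH]
  simp only [Matrix.diagonal_apply, Fin.succ_inj]
  simp

/-- The vertical element given by an imaginary quaternion. -/
noncomputable def vElt (N : ℕ) (x : ℍ[ℝ]) (hx : star x = -x) : 𝔪 N := ⟨_, vertVec_mem hx⟩

/-- The horizontal element with entry `q` at `(p + 1, 1)`. -/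
noncomputable def hElt (p : Fin N) (q : ℍ[ℝ]) : 𝔪 N := ⟨_, horVec_mem p q⟩

lemma vElt_zero {x : ℍ[ℝ]} (hx : star x = -x) : (vElt N x hx : Amb N).1 0 0 = x := by
  simp [vElt, vertVec, smul_symF_zero]

lemma vElt_succ {x : ℍ[ℝ]} (hx : star x = -x) (p : Fin N) :
    (vElt N x hx : Amb N).1 p.succ 0 = 0 := by
  simp [vElt, vertVec, smul_symF_zero, (Fin.succ_ne_zero _).symm]

lemma hElt_zero (p : Fin N) (q : ℍ[ℝ]) : (hElt p q : Amb N).1 0 0 = 0 := by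
  simp [hElt, horVec, (Fin.succ_ne_zero _)]

lemma hElt_succ (p r : Fin N) (q : ℍ[ℝ]) :
    (hElt p q : Amb N).1 r.succ 0 = if r = p then q else 0 := by
  by_cases h : r = p
  · subst h; simp [hElt, horVec, (Fin.succ_ne_zero _).symm]
  · simp [hElt, horVec, (Fin.succ_ne_zero _).symm, h, Ne.symm h]

lemma isotropy_vElt (h : H N) {x x' : ℍ[ℝ]} (hx : star x = -x) (hx' : star x' = -x')
    (hh : (toAmb (h : G N)).2 * x * star (toAmb (h : G N)).2 = x') :
    isotropy N h (vElt N x hx) = vElt N x' hx' := by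
  refine ext_𝔪 ?_ fun p => ?_
  · rw [isotropy_zero, vElt_zero, vElt_zero, hh]
  · rw [isotropy_succ, vElt_succ]
    simp [vElt_succ]

lemma isotropy_diagH_hElt (d : Fin (N + 1) → unitary ℍ[ℝ]) (p : Fin N) (q : ℍ[ℝ]) :
    isotropy N (diagH d) (hElt p q) = hElt p (d p.succ * q * star (d 0 : ℍ[ℝ])) := by
  refine ext_𝔪 ?_ fun r => ?_
  · rw [isotropy_zero, hElt_zero, hElt_zero, mul_zero, zero_mul]
  · rw [isotropy_diagH_succ, hElt_succ, hElt_succ]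
    by_cases h : r = p
    · subst h; simp
    · simp [h]

lemma isotropy_rotH_hElt {p r : Fin N} (hpr : p ≠ r) (q : ℍ[ℝ]) :
    isotropy N (rotH hpr (c := 0) (s := 1) (by norm_num)) (hElt p q) = hElt r q := by
  refine ext_𝔪 ?_ fun t => ?_
  · rw [isotropy_zero, hElt_zero, hElt_zero, mul_zero, zero_mul]
  · rw [isotropy_succ, toAmb_rotH, hElt_succ]
    simp only [hElt_succ, mul_ite, mul_zero, Finset.sum_ite_eq', Finset.mem_univ, if_true, star_one,
      mul_one]
    by_cases h1 : t = r
    · subst h1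
      simp [rotMat, hpr, hpr.symm]
    · by_cases h2 : t = p
      · subst h2
        simp [rotMat, hpr, hpr.symm]
      · simp [rotMat, hpr.symm, h1, h2, Ne.symm h1,
          Ne.symm h2]

/-! ### Unit quaternions -/

lemma mem_unitary_of_normSq {q : ℍ[ℝ]} (h : Quaternion.normSq q = 1) : q ∈ unitary ℍ[ℝ] := by
  rw [Unitary.mem_iff, Quaternion.star_mul_self, Quaternion.self_mul_star, h]
  simp

/-- The quaternion `q` as a unit quaternion. -/
def unitQ (q : ℍ[ℝ]) (h : Quaternion.normSq q = 1) : unitary ℍ[ℝ] := ⟨q, mem_unitary_of_normSq h⟩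

lemma normSq_qi : Quaternion.normSq qi = 1 := by
  rw [Quaternion.normSq_def']; simp [qi_re, qi_imI, qi_imJ, qi_imK]
lemma normSq_qj : Quaternion.normSq qj = 1 := by
  rw [Quaternion.normSq_def']; simp [qj_re, qj_imI, qj_imJ, qj_imK]
lemma normSq_qk : Quaternion.normSq qk = 1 := by
  rw [Quaternion.normSq_def']; simp [qk_re, qk_imI, qk_imJ, qk_imK]

/-- `(i + j) / √2`, which conjugates `i` to `j`. -/
noncomputable def qij : ℍ[ℝ] := ⟨0, (Real.sqrt 2)⁻¹, (Real.sqrt 2)⁻¹, 0⟩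

/-- `(i + k) / √2`, which conjugates `i` to `k`. -/
noncomputable def qik : ℍ[ℝ] := ⟨0, (Real.sqrt 2)⁻¹, 0, (Real.sqrt 2)⁻¹⟩

lemma inv_sqrt_two_sq : (Real.sqrt 2)⁻¹ * (Real.sqrt 2)⁻¹ = 1 / 2 := by
  rw [← mul_inv, Real.mul_self_sqrt (by norm_num)]
  norm_num

lemma qij_re : qij.re = 0 := rfl
lemma qij_imI : qij.imI = (Real.sqrt 2)⁻¹ := rfl
lemma qij_imJ : qij.imJ = (Real.sqrt 2)⁻¹ := rfl
lemma qij_imK : qij.imK = 0 := rfl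
lemma qik_re : qik.re = 0 := rfl
lemma qik_imI : qik.imI = (Real.sqrt 2)⁻¹ := rfl
lemma qik_imJ : qik.imJ = 0 := rfl
lemma qik_imK : qik.imK = (Real.sqrt 2)⁻¹ := rfl

lemma normSq_qij : Quaternion.normSq qij = 1 := by
  have := inv_sqrt_two_sq
  rw [Quaternion.normSq_def', qij_re, qij_imI, qij_imJ, qij_imK]
  nlinarith

lemma normSq_qik : Quaternion.normSq qik = 1 := by
  have := inv_sqrt_two_sq
  rw [Quaternion.normSq_def', qik_re, qik_imI, qik_imJ, qik_imK]
  nlinarith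

lemma qij_conj : qij * qi * star qij = qj := by
  have := inv_sqrt_two_sq
  ext <;> simp only [Quaternion.re_mul, Quaternion.imI_mul, Quaternion.imJ_mul, Quaternion.imK_mul,
    Quaternion.re_star, Quaternion.imI_star, Quaternion.imJ_star, Quaternion.imK_star, qij_re,
    qij_imI, qij_imJ, qij_imK, qi_re, qi_imI, qi_imJ, qi_imK, qj_re, qj_imI, qj_imJ, qj_imK] <;>
    linarith

lemma qik_conj : qik * qi * star qik = qk := by
  have := inv_sqrt_two_sq
  ext <;> simp only [Quaternion.re_mul, Quaternion.imI_mul, Quaternion.imJ_mul, Quaternion.imK_mul,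
    Quaternion.re_star, Quaternion.imI_star, Quaternion.imJ_star, Quaternion.imK_star, qik_re,
    qik_imI, qik_imJ, qik_imK, qi_re, qi_imI, qi_imJ, qi_imK, qk_re, qk_imI, qk_imJ, qk_imK] <;>
    linarith

end Group

/-! ### Classification of the invariant metrics. -/

section InvariantMetric

variable {N : ℕ}

lemma vElt_neg {x : ℍ[ℝ]} (hx : star x = -x) (hx' : star (-x) = - -x) :
    vElt N (-x) hx' = -vElt N x hx := by
  refine ext_𝔪 ?_ fun p => ?_
  · rw [vElt_zero, Submodule.coe_neg, Prod.fst_neg, Matrix.neg_apply, vElt_zero]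
  · rw [vElt_succ, Submodule.coe_neg, Prod.fst_neg, Matrix.neg_apply, vElt_succ, neg_zero]

lemma hElt_add (p : Fin N) (q q' : ℍ[ℝ]) : hElt p (q + q') = hElt p q + hElt p q' := by
  refine ext_𝔪 ?_ fun r => ?_
  · rw [Submodule.coe_add, Prod.fst_add, Matrix.add_apply, hElt_zero, hElt_zero, hElt_zero,
      add_zero]
  · rw [Submodule.coe_add, Prod.fst_add, Matrix.add_apply, hElt_succ, hElt_succ, hElt_succ]
    split_ifs <;> simp

lemma hElt_smul (p : Fin N) (t : ℝ) (q : ℍ[ℝ]) : hElt p (t • q) = t • hElt p q := by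
  refine ext_𝔪 ?_ fun r => ?_
  · rw [Submodule.coe_smul, Prod.smul_fst, Matrix.smul_apply, hElt_zero, hElt_zero, smul_zero]
  · rw [Submodule.coe_smul, Prod.smul_fst, Matrix.smul_apply, hElt_succ, hElt_succ]
    split_ifs <;> simp

lemma hElt_neg (p : Fin N) (q : ℍ[ℝ]) : hElt p (-q) = -hElt p q := by
  have := hElt_smul p (-1) q
  rw [neg_smul, one_smul] at this
  exact this.trans (neg_one_smul ℝ (hElt p q))

lemma hElt_eq (p : Fin N) (q : ℍ[ℝ]) : hElt p q =
    q.re • hElt p 1 + q.imI • hElt p qi + q.imJ • hElt p qj + q.imK • hElt p qk := by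
  simp only [← hElt_smul, ← hElt_add]
  congr 1
  ext <;> simp [qi_re, qi_imI, qi_imJ, qi_imK, qj_re, qj_imI, qj_imJ, qj_imK, qk_re, qk_imI,
    qk_imJ, qk_imK]

lemma frame_eq_vElt (a b : ℝ) (k : IdxE N) (hk : ∀ s j, k ≠ some (some s, j))
    (hx : star (unitOf k) = -unitOf k) :
    frame N a b k = (scale N a b k)⁻¹ • vElt N (unitOf k) hx := by
  refine ext_𝔪 ?_ fun p => ?_
  · rw [Submodule.coe_smul, Prod.smul_fst, Matrix.smul_apply, vElt_zero, frame_zero]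
    rcases k with _ | ⟨_ | s, j⟩
    · rfl
    · rfl
    · exact absurd rfl (hk s j)
  · rw [Submodule.coe_smul, Prod.smul_fst, Matrix.smul_apply, vElt_succ, frame_succ]
    rcases k with _ | ⟨_ | s, j⟩
    · simp
    · simp
    · exact absurd rfl (hk s j)

lemma frame_eq_hElt (a b : ℝ) (p : Fin N) (i j : Fin 2) :
    frame N a b (some (some (p, i), j)) =
      horCoeff N b • hElt p (unitOf (some (some (p, i), j))) := by
  refine ext_𝔪 ?_ fun r => ?_
  · rw [Submodule.coe_smul, Prod.smul_fst, Matrix.smul_apply, hElt_zero, frame_zero, smul_zero]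
  · rw [Submodule.coe_smul, Prod.smul_fst, Matrix.smul_apply, hElt_succ, frame_succ]
    by_cases h : r = p <;> simp [h]

lemma qi_conj_qj : qi * qj * star qi = -qj := by
  ext <;> simp [qi_re, qi_imI, qi_imJ, qi_imK, qj_re, qj_imI, qj_imJ, qj_imK]
lemma qi_conj_qk : qi * qk * star qi = -qk := by
  ext <;> simp [qi_re, qi_imI, qi_imJ, qi_imK, qk_re, qk_imI, qk_imJ, qk_imK]
lemma qj_conj_qi : qj * qi * star qj = -qi := by
  ext <;> simp [qi_re, qi_imI, qi_imJ, qi_imK, qj_re, qj_imI, qj_imJ, qj_imK]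
lemma qj_conj_qk : qj * qk * star qj = -qk := by
  ext <;> simp [qk_re, qk_imI, qk_imJ, qk_imK, qj_re, qj_imI, qj_imJ, qj_imK]

lemma self_conj {u : ℍ[ℝ]} (hu : Quaternion.normSq u = 1) : u * u * star u = u := by
  rw [mul_assoc, Quaternion.self_mul_star, hu]
  simp

variable {D : LinearMap.BilinForm ℝ (𝔪 N)}

section

variable (hD : ∀ (h : H N) (S T : 𝔪 N), D (isotropy N h S) (isotropy N h T) = D S T)
include hD

/-- Source of all orthogonality relations: an isometry fixing S and negating T gives D(S, T) = -D(S,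
T). -/
lemma eq_zero_of_isotropy {h : H N} {S T : 𝔪 N} (hS : isotropy N h S = S)
    (hT : isotropy N h T = -T) : D S T = 0 := by
  have := hD h S T
  rw [hS, hT, map_neg] at this
  linarith

lemma vElt_orthogonal {u x x' : ℍ[ℝ]} (hx : star x = -x) (hx' : star x' = -x')
    (hu : Quaternion.normSq u = 1) (h : u * x * star u = x) (h' : u * x' * star u = -x') :
    D (vElt N x hx) (vElt N x' hx') = 0 := by
  refine eq_zero_of_isotropy hD (h := diagH fun _ => unitQ u hu) (isotropy_vElt _ hx hx h) ?_
  rw [← vElt_neg hx' (by rw [star_neg, hx'])]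
  exact isotropy_vElt _ hx' _ h'

/-- The element diag(1, -1, …, -1) fixes 𝔪₁ and negates 𝔪₂. -/
lemma vElt_hElt_orthogonal {x : ℍ[ℝ]} (hx : star x = -x) (p : Fin N) (q : ℍ[ℝ]) :
    D (vElt N x hx) (hElt p q) = 0 := by
  refine eq_zero_of_isotropy hD (h := diagH fun i => if i = 0 then 1 else -1)
    (isotropy_vElt _ hx hx ?_) ?_
  · simp [toAmb_diagH]
  · rw [isotropy_diagH_hElt, ← hElt_neg]
    simp [Fin.succ_ne_zero, Unitary.coe_neg]

/-- Change the sign of the coordinate r alone. -/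
lemma hElt_orthogonal_of_ne {p r : Fin N} (hpr : p ≠ r) (q q' : ℍ[ℝ]) :
    D (hElt p q) (hElt r q') = 0 := by
  refine eq_zero_of_isotropy hD (h := diagH fun i => if i = r.succ then -1 else 1) ?_ ?_
  · rw [isotropy_diagH_hElt]
    simp [hpr, (Fin.succ_ne_zero _).symm]
  · rw [isotropy_diagH_hElt, ← hElt_neg]
    simp [(Fin.succ_ne_zero _).symm, Unitary.coe_neg]

lemma hElt_one_orthogonal {p : Fin N} {u x : ℍ[ℝ]} (hu : Quaternion.normSq u = 1)
    (h : u * x * star u = -x) : D (hElt p 1) (hElt p x) = 0 := by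
  refine eq_zero_of_isotropy hD (h := diagH fun _ => unitQ u hu) ?_ ?_
  · rw [isotropy_diagH_hElt]
    congr 1
    change u * 1 * star u = 1
    rw [mul_one, Quaternion.self_mul_star, hu]
    simp
  · rw [isotropy_diagH_hElt, ← hElt_neg]
    congr 1

lemma hElt_one_apply (p : Fin N) (q : ℍ[ℝ]) :
    D (hElt p 1) (hElt p q) = q.re * D (hElt p 1) (hElt p 1) := by
  rw [hElt_eq p q]
  simp only [map_add, map_smul, hElt_one_orthogonal hD normSq_qj qj_conj_qi,
    hElt_one_orthogonal hD normSq_qi qi_conj_qj, hElt_one_orthogonal hD normSq_qi qi_conj_qk,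
    smul_eq_mul, mul_zero, add_zero]

/-- Left multiplication by q̄ in the coordinates other than the first belongs to H and moves q to 1.
-/
lemma hElt_apply (p : Fin N) {q : ℍ[ℝ]} (hq : Quaternion.normSq q = 1) (q' : ℍ[ℝ]) :
    D (hElt p q) (hElt p q') = (star q * q').re * D (hElt p 1) (hElt p 1) := by
  have hq' : Quaternion.normSq (star q) = 1 := by rw [Quaternion.normSq_star, hq]
  rw [← hD (diagH fun i => if i = 0 then 1 else unitQ (star q) hq'), isotropy_diagH_hElt,
    isotropy_diagH_hElt, ← hElt_one_apply hD]
  have : star q * q = 1 := by rw [Quaternion.star_mul_self, hq]; simp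
  simp [Fin.succ_ne_zero, unitQ, this]

lemma hElt_one_eq (p r : Fin N) :
    D (hElt r 1) (hElt r 1) = D (hElt p 1) (hElt p 1) := by
  by_cases hpr : p = r
  · rw [hpr]
  · rw [← hD (rotH hpr (c := 0) (s := 1) (by norm_num)) (hElt p 1) (hElt p 1), isotropy_rotH_hElt]

lemma vElt_conj_apply {u x x' : ℍ[ℝ]} (hx : star x = -x) (hx' : star x' = -x')
    (hu : Quaternion.normSq u = 1) (h : u * x * star u = x') :
    D (vElt N x' hx') (vElt N x' hx') = D (vElt N x hx) (vElt N x hx) := by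
  have := isotropy_vElt (N := N) (diagH fun _ => unitQ u hu) hx hx' h
  rw [← hD (diagH fun _ => unitQ u hu) (vElt N x hx) (vElt N x hx), this]

/-- A symmetric invariant form on `𝔪` is determined by its values on one vector of each of the
two summands. -/
lemma invariant_eq_zero (hsymm : ∀ S T, D S T = D T S)
    (hv : D (vElt N qi star_qi) (vElt N qi star_qi) = 0)
    (hh : ∀ p : Fin N, D (hElt p 1) (hElt p 1) = 0) : D = 0 := by
  have hvj : D (vElt N qj star_qj) (vElt N qj star_qj) = 0 := by
    rw [vElt_conj_apply hD star_qi star_qj normSq_qij qij_conj, hv]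
  have hvk : D (vElt N qk star_qk) (vElt N qk star_qk) = 0 := by
    rw [vElt_conj_apply hD star_qi star_qk normSq_qik qik_conj, hv]
  have hij : D (vElt N qi star_qi) (vElt N qj star_qj) = 0 :=
    vElt_orthogonal hD _ _ normSq_qi (self_conj normSq_qi) qi_conj_qj
  have hik : D (vElt N qi star_qi) (vElt N qk star_qk) = 0 :=
    vElt_orthogonal hD _ _ normSq_qi (self_conj normSq_qi) qi_conj_qk
  have hjk : D (vElt N qj star_qj) (vElt N qk star_qk) = 0 :=
    vElt_orthogonal hD _ _ normSq_qj (self_conj normSq_qj) qj_conj_qk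
  have hji : D (vElt N qj star_qj) (vElt N qi star_qi) = 0 := by rw [hsymm, hij]
  have hki : D (vElt N qk star_qk) (vElt N qi star_qi) = 0 := by rw [hsymm, hik]
  have hkj : D (vElt N qk star_qk) (vElt N qj star_qj) = 0 := by rw [hsymm, hjk]
  have hnk : star (-qk) = - -qk := by rw [star_neg, star_qk]
  -- Any a and b would do: the frame only serves as a basis of 𝔪 here.
  have f0 : frame N 1 1 none = (scale N 1 1 none)⁻¹ • vElt N qi star_qi :=
    frame_eq_vElt 1 1 none (by simp) star_qi
  have f1 : frame N 1 1 (some (none, 1)) = (scale N 1 1 (some (none, 1)))⁻¹ • vElt N qj star_qj :=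
    frame_eq_vElt 1 1 (some (none, 1)) (by simp) star_qj
  have f2 : frame N 1 1 (some (none, 0)) =
      (scale N 1 1 (some (none, 0)))⁻¹ • -vElt N qk star_qk := by
    rw [← vElt_neg star_qk hnk]
    exact frame_eq_vElt 1 1 (some (none, 0)) (by simp) hnk
  have hvh : ∀ {x : ℍ[ℝ]} (hx : star x = -x) (p : Fin N) (q : ℍ[ℝ]),
      D (vElt N x hx) (hElt p q) = 0 := vElt_hElt_orthogonal hD
  have hhv : ∀ {x : ℍ[ℝ]} (hx : star x = -x) (p : Fin N) (q : ℍ[ℝ]),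
      D (hElt p q) (vElt N x hx) = 0 := fun hx p q => by rw [hsymm, hvh hx]
  have hn : ∀ (p : Fin N) (i j : Fin 2),
      Quaternion.normSq (unitOf (some (some (p, i), j))) = 1 := by
    intro p i j
    fin_cases i <;> fin_cases j <;> simp [unitOf, normSq_qi, normSq_qj, normSq_qk]
  have key : ∀ k l : IdxE N, D (frame N 1 1 k) (frame N 1 1 l) = 0 := by
    intro k l
    rcases k with _ | ⟨_ | ⟨p, i⟩, j⟩ <;> rcases l with _ | ⟨_ | ⟨r, i'⟩, j'⟩
    · simp [f0, hv]
    · fin_cases j' <;> simp [f0, f1, f2, hij, hik]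
    · simp [f0, frame_eq_hElt, hvh]
    · fin_cases j <;> simp [f0, f1, f2, hji, hki]
    · fin_cases j <;> fin_cases j' <;> simp [f1, f2, hvj, hvk, hjk, hkj]
    · fin_cases j <;> simp [f1, f2, frame_eq_hElt, hvh]
    · simp [f0, frame_eq_hElt, hhv]
    · fin_cases j' <;> simp [f1, f2, frame_eq_hElt, hhv]
    · rw [frame_eq_hElt, frame_eq_hElt]
      by_cases h : p = r
      · subst h
        simp [hElt_apply hD p (hn p i j), hh]
      · simp [hElt_orthogonal_of_ne hD h]
  refine LinearMap.ext fun S => LinearMap.ext fun T => ?_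
  rw [eq_sum_frame one_pos one_pos S, eq_sum_frame one_pos one_pos T]
  simp [map_sum, LinearMap.sum_apply, key]

end

lemma metric_vElt (a b : ℝ) {x : ℍ[ℝ]} (hx : star x = -x) : metric N a b (vElt N x hx)
    (vElt N x hx) = a * metric N 1 1 (vElt N x hx) (vElt N x hx) := by
  have h : (vElt N x hx : Amb N) - vert N (vElt N x hx) = 0 := by
    change vertVec N x - vert N (vertVec N x) = 0
    simp [vertVec, vert, smul_symF_zero]
  rw [metric_apply, metric_apply, h]
  simp

lemma metric_hElt (a b : ℝ) (p : Fin N) (q : ℍ[ℝ]) :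
    metric N a b (hElt p q) (hElt p q) = b * metric N 1 1 (hElt p q) (hElt p q) := by
  have h : vert N (hElt p q : Amb N) = 0 := by
    change (Matrix.single 0 0 ((hElt p q : Amb N).1 0 0), (hElt p q : Amb N).2) = 0
    rw [hElt_zero]
    simp [hElt]
  rw [metric_apply, metric_apply, h]
  simp

lemma vElt_qi_ne_zero : vElt N qi star_qi ≠ 0 := by
  intro h
  have := congrArg (fun S : 𝔪 N => (S : Amb N).1 0 0) h
  simp only [vElt_zero] at this
  have := congrArg (fun q : ℍ[ℝ] => q.imI) this
  simp [qi_imI] at this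

lemma hElt_one_ne_zero (p : Fin N) : hElt p 1 ≠ 0 := by
  intro h
  have := congrArg (fun S : 𝔪 N => (S : Amb N).1 p.succ 0) h
  simp [hElt_succ] at this

/-- The invariant metrics are the metrics `g_{a,b}`. -/
lemma isInvariantMetric_iff (B : LinearMap.BilinForm ℝ (𝔪 N)) :
    IsInvariantMetric B ↔ ∃ a b : ℝ, 0 < a ∧ 0 < b ∧ B = metric N a b := by
  constructor
  · rintro ⟨hsymm, hpos, hinv⟩
    have hm : ∀ {S : 𝔪 N}, S ≠ 0 → 0 < metric N 1 1 S S := metric_self_pos one_pos one_pos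
    -- The parameters are the ratios of B to g_{1,1} on one vertical and one horizontal vector.
    have ha := div_pos (hpos _ (vElt_qi_ne_zero (N := N))) (hm vElt_qi_ne_zero)
    have hb : ∃ b : ℝ, 0 < b ∧ ∀ p : Fin N,
        B (hElt p 1) (hElt p 1) = b * metric N 1 1 (hElt p 1) (hElt p 1) := by
      rcases isEmpty_or_nonempty (Fin N) with hN | ⟨⟨p⟩⟩
      -- For n = 1 there is no horizontal part, and b is arbitrary.
      · exact ⟨1, one_pos, fun p => (hN.false p).elim⟩
      · refine ⟨_, div_pos (hpos _ (hElt_one_ne_zero p)) (hm (hElt_one_ne_zero p)), fun r => ?_⟩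
        rw [hElt_one_eq hinv p r, hElt_one_eq (metric_isotropy 1 1) p r,
          div_mul_cancel₀ _ (hm (hElt_one_ne_zero p)).ne']
    obtain ⟨b, hb, hb'⟩ := hb
    refine ⟨_, b, ha, hb, sub_eq_zero.1 (invariant_eq_zero (fun h S T => ?_) (fun S T => ?_) ?_
      fun p => ?_)⟩
    · rw [LinearMap.sub_apply, LinearMap.sub_apply, LinearMap.sub_apply, LinearMap.sub_apply,
        hinv, metric_isotropy]
    · rw [LinearMap.sub_apply, LinearMap.sub_apply, LinearMap.sub_apply, LinearMap.sub_apply,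
        hsymm, metric_comm]
    · rw [LinearMap.sub_apply, LinearMap.sub_apply, metric_vElt,
        div_mul_cancel₀ _ (hm vElt_qi_ne_zero).ne', sub_self]
    · rw [LinearMap.sub_apply, LinearMap.sub_apply, metric_hElt, hb', sub_self]
  · rintro ⟨a, b, ha, hb, rfl⟩
    exact ⟨metric_comm a b, fun T hT => metric_self_pos ha hb hT, metric_isotropy a b⟩

end InvariantMetric

/-! ### Lifts of the isotropy representation acting on spinors. -/

section SpinLift

variable {N : ℕ} {a b : ℝ}

/-- The operator on spinors given by a lift of the isotropy representation. -/
noncomputable def liftOp (ha : 0 < a) (hb : 0 < b) (ρ : H N →* spinGroup (cliffForm N a b))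
    (h : H N) : Module.End ℂ (Spinor N) :=
  cliffRep ha hb (ρ h : CliffordAlgebra (cliffForm N a b))

variable {ha : 0 < a} {hb : 0 < b} {ρ : H N →* spinGroup (cliffForm N a b)}

lemma liftOp_mul (g h : H N) :
    liftOp ha hb ρ (g * h) = liftOp ha hb ρ g * liftOp ha hb ρ h := by
  simp [liftOp]

lemma liftOp_one : liftOp ha hb ρ 1 = 1 := by simp [liftOp]

lemma liftOp_cliffMul (hρ : IsSpinLift ρ) (h : H N) (v : 𝔪 N) :
    liftOp ha hb ρ h * cliffMul N a b v =
      cliffMul N a b (isotropy N h v) * liftOp ha hb ρ h := by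
  have hι : ∀ w, cliffRep ha hb (CliffordAlgebra.ι _ w) = cliffMul N a b w := fun w => by
    simp [cliffRep]
  rw [← hι, ← hι, ← hρ h v, liftOp, ← map_mul, ← map_mul]
  congr 1
  have : (((ρ h)⁻¹ : spinGroup (cliffForm N a b)) : CliffordAlgebra (cliffForm N a b)) * ρ h = 1 := by
    rw [← Submonoid.coe_mul, inv_mul_cancel, Submonoid.coe_one]
  rw [mul_assoc, this, mul_one]

lemma liftOp_γ (hρ : IsSpinLift ρ) (h : H N) (i : IdxE N) : liftOp ha hb ρ h * γ i =
    (∑ k, frameMatrix a b (isotropy N h) i k • γ k) * liftOp ha hb ρ h := by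
  rw [← cliffMul_frame ha hb, liftOp_cliffMul hρ, cliffMul_apply]
  rfl

/-- Ad(h) is orthogonal, so transposing its matrix inverts it. -/
lemma frameMatrix_isotropy_transpose (h : H N) :
    (frameMatrix a b (isotropy N h)).transpose = frameMatrix a b (isotropy N h⁻¹) := by
  ext i j
  simp only [frameMatrix, Matrix.transpose_apply, Matrix.of_apply]
  rw [← metric_isotropy a b h (isotropy N h⁻¹ _), ← Module.End.mul_apply, ← map_mul,
    mul_inv_cancel, map_one, Module.End.one_apply, metric_comm]

lemma adElt_mem (h : H N) (T : isoAlg N) :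
    toAmb (h : G N) * (T : Amb N) * star (toAmb (h : G N)) ∈ isoAlg N := by
  refine ⟨?_, ((fixesAxis_of_mem h.2).mul T.2.2).mul (fixesAxis_star_toAmb h)⟩
  simp only [star_mul, star_star, T.2.1]
  simp [mul_assoc]

/-- The adjoint action of `H` on its Lie algebra. -/
noncomputable def adElt (h : H N) (T : isoAlg N) : isoAlg N := ⟨_, adElt_mem h T⟩

lemma isotropyAlg_adElt (h : H N) (T : isoAlg N) : isotropyAlg N (adElt h T) =
    isotropy N h * (isotropyAlg N T * isotropy N h⁻¹) := by
  refine LinearMap.ext fun U => Subtype.ext ?_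
  rw [Module.End.mul_apply, Module.End.mul_apply, isotropy_coe, isotropyAlg_coe, isotropyAlg_coe,
    isotropy_coe]
  change toAmb (h : G N) * T * star (toAmb (h : G N)) * U -
    U * (toAmb (h : G N) * T * star (toAmb (h : G N))) =
    toAmb (h : G N) * (T * (star (toAmb (h : G N)) * U * star (star (toAmb (h : G N)))) -
      star (toAmb (h : G N)) * U * star (star (toAmb (h : G N))) * T) * star (toAmb (h : G N))
  have h1 := toAmb_mul_star (h : G N)
  set x := toAmb (h : G N)
  have h2 : ∀ y, x * (star x * y) = y := fun y => by rw [← mul_assoc, h1, one_mul]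
  simp only [star_star, mul_sub, sub_mul, mul_assoc, h1, h2, mul_one]

/-- The spin representation is equivariant under the lift. -/
lemma liftOp_spinRep (hρ : IsSpinLift ρ) (h : H N) (T : isoAlg N) :
    liftOp ha hb ρ h * spinRep ha hb T = spinRep ha hb (adElt h T) * liftOp ha hb ρ h := by
  rw [spinRep_eq_spinElt, spinRep_eq_spinElt, spinElt_conj (liftOp_γ hρ h),
    frameMatrix_isotropy_transpose, isotropyAlg_adElt, frameMatrix_mul ha hb,
    frameMatrix_mul ha hb]

/-- The annihilator in 𝔥 of a fixed spinor is Ad(H)-stable, which reduces the problem to a torus. -/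
lemma spinRep_adElt_eq_zero (hρ : IsSpinLift ρ) {ψ : Spinor N}
    (hψ : ∀ h, liftOp ha hb ρ h ψ = ψ) {T : isoAlg N} (hT : spinRep ha hb T ψ = 0) (h : H N) :
    spinRep ha hb (adElt h T) ψ = 0 := by
  rw [← hψ h, ← Module.End.mul_apply, ← liftOp_spinRep hρ, Module.End.mul_apply, hT, map_zero]

/-! ### The action of the maximal torus -/

lemma wedgeY_eq_γ (s : IdxY N) :
    wedgeY s = (1 / 2 : ℂ) • (γ (some (s, 1)) - Complex.I • γ (some (s, 0))) := by
  simp only [γ, smul_smul, Complex.I_mul_I]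
  module

lemma contrX_eq_γ (s : IdxY N) :
    contrX s = (-1 / 2 : ℂ) • (γ (some (s, 1)) + Complex.I • γ (some (s, 0))) := by
  simp only [γ, smul_smul, Complex.I_mul_I]
  module

/-- Schur's lemma in terms of Clifford multiplication. -/
lemma eq_smul_one_of_commute_cliffMul (ha : 0 < a) (hb : 0 < b) {Q : Module.End ℂ (Spinor N)}
    (h : ∀ v, Q * cliffMul N a b v = cliffMul N a b v * Q) : ∃ r : ℂ, Q = r • 1 := by
  have hγ : ∀ k, Q * γ k = γ k * Q := fun k => by rw [← cliffMul_frame ha hb, h]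
  refine eq_smul_one_of_commute (fun s => ?_) fun s => ?_
  · rw [wedgeY_eq_γ, mul_smul_comm, mul_sub, mul_smul_comm, hγ, hγ, smul_mul_assoc, sub_mul,
      smul_mul_assoc]
  · rw [contrX_eq_γ, mul_smul_comm, mul_add, mul_smul_comm, hγ, hγ, smul_mul_assoc, add_mul,
      smul_mul_assoc]

/-- The quaternion `cos θ + i sin θ`. -/
noncomputable def qcis (θ : ℝ) : ℍ[ℝ] := ⟨Real.cos θ, Real.sin θ, 0, 0⟩

lemma qcis_re (θ : ℝ) : (qcis θ).re = Real.cos θ := rfl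
lemma qcis_imI (θ : ℝ) : (qcis θ).imI = Real.sin θ := rfl
lemma qcis_imJ (θ : ℝ) : (qcis θ).imJ = 0 := rfl
lemma qcis_imK (θ : ℝ) : (qcis θ).imK = 0 := rfl

lemma normSq_qcis (θ : ℝ) : Quaternion.normSq (qcis θ) = 1 := by
  rw [Quaternion.normSq_def', qcis_re, qcis_imI, qcis_imJ, qcis_imK]
  have := Real.cos_sq_add_sin_sq θ
  linarith

/-- Under q ↦ e^{iθ} q e^{-iθ₀}, the coordinate `cA q` rotates by θ - θ₀ and `cB q` by -(θ + θ₀),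
since i anticommutes with j and k. -/
lemma diagOp_mul_horCl {z : IdxY N → ℂ} {p : Fin N} {θ θ₀ : ℝ}
    (h0 : z (some (p, 0)) = Complex.exp (-(θ + θ₀ : ℝ) * Complex.I))
    (h1 : z (some (p, 1)) = Complex.exp ((θ - θ₀ : ℝ) * Complex.I)) (q : ℍ[ℝ]) :
    diagOp z * horCl p q = horCl p (qcis θ * q * star (qcis θ₀)) * diagOp z := by
  have e : ∀ t : ℝ, Complex.exp (t * Complex.I) = (Real.cos t + Real.sin t * Complex.I : ℂ) :=
    fun t => by rw [Complex.exp_mul_I, Complex.ofReal_cos, Complex.ofReal_sin]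
  have h0' : z (some (p, 0)) = Real.cos (θ + θ₀) - Real.sin (θ + θ₀) * Complex.I := by
    rw [h0, ← Complex.ofReal_neg, e, Real.cos_neg, Real.sin_neg]
    push_cast; ring
  have i0 : (z (some (p, 0)))⁻¹ = Real.cos (θ + θ₀) + Real.sin (θ + θ₀) * Complex.I := by
    rw [h0, ← Complex.exp_neg, ← neg_mul, neg_neg, e]
  have h1' : z (some (p, 1)) = Real.cos (θ - θ₀) + Real.sin (θ - θ₀) * Complex.I := by
    rw [h1, e]
  have i1 : (z (some (p, 1)))⁻¹ = Real.cos (θ - θ₀) - Real.sin (θ - θ₀) * Complex.I := by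
    rw [h1, ← Complex.exp_neg, ← neg_mul, ← Complex.ofReal_neg, e, Real.cos_neg, Real.sin_neg]
    push_cast; ring
  have n0 : z (some (p, 0)) ≠ 0 := by rw [h0]; exact Complex.exp_ne_zero _
  have n1 : z (some (p, 1)) ≠ 0 := by rw [h1]; exact Complex.exp_ne_zero _
  have c0 := diagOp_mul_contrX n0
  have c1 := diagOp_mul_contrX n1
  rw [i0] at c0
  rw [i1] at c1
  simp only [horCl, mul_add, mul_sub, add_mul, sub_mul, mul_smul_comm, smul_mul_assoc,
    diagOp_mul_wedgeY, c0, c1, h0', h1', smul_smul]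
  simp only [cA, cB, cA', cB', Quaternion.re_mul, Quaternion.imI_mul, Quaternion.imJ_mul,
    Quaternion.imK_mul, Quaternion.re_star, Quaternion.imI_star, Quaternion.imJ_star,
    Quaternion.imK_star, qcis_re, qcis_imI, qcis_imJ, qcis_imK, Real.cos_add, Real.sin_add,
    Real.cos_sub, Real.sin_sub]
  generalize Real.cos θ = c
  generalize Real.sin θ = s
  generalize Real.cos θ₀ = c₀
  generalize Real.sin θ₀ = s₀
  push_cast
  match_scalars <;> ring_nf <;> simp only [Complex.I_sq] <;> ring

lemma diagOp_mul_vertCl {z : IdxY N → ℂ} {θ₀ : ℝ}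
    (h0 : z none = Complex.exp (-(2 * θ₀ : ℝ) * Complex.I)) (x : ℍ[ℝ]) :
    diagOp z * vertCl x = vertCl (qcis θ₀ * x * star (qcis θ₀)) * diagOp z := by
  have e : ∀ t : ℝ, Complex.exp (t * Complex.I) = (Real.cos t + Real.sin t * Complex.I : ℂ) :=
    fun t => by rw [Complex.exp_mul_I, Complex.ofReal_cos, Complex.ofReal_sin]
  have h0' : z none = Real.cos (2 * θ₀) - Real.sin (2 * θ₀) * Complex.I := by
    rw [h0, ← Complex.ofReal_neg, e, Real.cos_neg, Real.sin_neg]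
    push_cast; ring
  have i0 : (z none)⁻¹ = Real.cos (2 * θ₀) + Real.sin (2 * θ₀) * Complex.I := by
    rw [h0, ← Complex.exp_neg, ← neg_mul, neg_neg, e]
  have n0 : z none ≠ 0 := by rw [h0]; exact Complex.exp_ne_zero _
  have c0 := diagOp_mul_contrX n0
  rw [i0] at c0
  have hcs := Real.cos_sq_add_sin_sq θ₀
  simp only [vertCl, mul_add, mul_sub, add_mul, sub_mul, mul_smul_comm, smul_mul_assoc,
    diagOp_mul_wedgeY, c0, diagOp_mul_parity, h0', smul_smul]
  simp only [Quaternion.re_mul, Quaternion.imI_mul, Quaternion.imJ_mul,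
    Quaternion.imK_mul, Quaternion.re_star, Quaternion.imI_star, Quaternion.imJ_star,
    Quaternion.imK_star, qcis_re, qcis_imI, qcis_imJ, qcis_imK, Real.cos_two_mul',
    Real.sin_two_mul]
  generalize Real.cos θ₀ = c at *
  generalize Real.sin θ₀ = s at *
  have hcs' : (c : ℂ) ^ 2 + (s : ℂ) ^ 2 = 1 := by exact_mod_cast hcs
  push_cast
  match_scalars
  · linear_combination (-(x.imI : ℂ) * Complex.I) * hcs'
  · ring_nf
    simp only [Complex.I_sq]
    ring
  · ring_nf
    simp only [Complex.I_sq]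
    ring

end SpinLift

/-! ### The maximal torus of H and its weights. -/

section Torus

variable {N : ℕ} {a b : ℝ}

/-- A coincidence of two powers would make an integer a nonzero integral multiple of 2π, against the
irrationality of π. Hence a single torus element with integer angles separates all weights. -/
lemma exp_I_zpow_injective : Function.Injective fun k : ℤ => Complex.exp Complex.I ^ k := by
  intro k l h
  simp only [← Complex.exp_int_mul] at h
  obtain ⟨n, hn⟩ := Complex.exp_eq_exp_iff_exists_int.1 h
  have h1 : (k : ℝ) = l + n * (2 * Real.pi) := by
    have h2 := congrArg Complex.im hn
    simpa using h2
  by_cases h0 : n = 0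
  · rw [h0] at h1
    exact_mod_cast (by simpa using h1 : (k : ℝ) = l)
  · exfalso
    refine irrational_pi ⟨((k - l : ℤ) : ℚ) / ((2 * n : ℤ) : ℚ), ?_⟩
    have hn0 : (n : ℝ) ≠ 0 := Int.cast_ne_zero.2 h0
    push_cast
    rw [div_eq_iff (by positivity)]
    linarith

/-- The weights of `L'` under the maximal torus of `H`. -/
def torusWeight (m : Fin (N + 1) → ℤ) : IdxY N → ℤ
  | none => -(2 * m 0)
  | some (p, 0) => -(m p.succ + m 0)
  | some (p, 1) => m p.succ - m 0

lemma torusElt_mem (m : Fin (N + 1) → ℤ) :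
    ((Matrix.diagonal fun i => (m i : ℝ) • qi, (m 0 : ℝ) • qi) : Amb N) ∈ isoAlg N := by
  refine ⟨Prod.ext ?_ ?_, fun i => ?_⟩
  · rw [Prod.fst_star, Matrix.star_eq_conjTranspose, Matrix.diagonal_conjTranspose, Prod.fst_neg,
      Matrix.diagonal_neg]
    congr 1
    funext i
    change star ((m i : ℝ) • qi) = -((m i : ℝ) • qi)
    simp [star_qi]
  · simp [star_qi]
  · by_cases hi : i = 0
    · subst hi; simp
    · simp [hi]

/-- An integral element of the Lie algebra of the maximal torus of `H`. -/
noncomputable def torusElt (m : Fin (N + 1) → ℤ) : isoAlg N := ⟨_, torusElt_mem m⟩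

/-- The constant is the shift N + 1 of `cartanOp`. The operator `diagOp` does not see it, but
Schur's lemma only compares operators up to a scalar. -/
lemma spinRep_torusElt (ha : 0 < a) (hb : 0 < b) (m : Fin (N + 1) → ℤ) :
    spinRep ha hb (torusElt m) = Complex.I • weightOp (torusWeight m) +
      (Complex.I * m 0 * (N + 1)) • 1 := by
  have h1 : lowOp ((torusElt m : isoAlg N) : Amb N).1 = ∑ p : Fin N, (m p.succ * Complex.I) •
      (num (some (p, 1)) - num (some (p, 0))) := by
    refine Finset.sum_congr rfl fun p _ => ?_
    rw [Finset.sum_eq_single p]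
    · simp only [torusElt, Matrix.diagonal_apply_eq, lowTerm, cA, cB, cA', cB', num,
        Quaternion.re_smul, Quaternion.imI_smul, Quaternion.imJ_smul, Quaternion.imK_smul, qi_re,
        qi_imI, qi_imJ, qi_imK, smul_eq_mul]
      push_cast
      module
    · intro r _ hr
      have : (r.succ : Fin (N + 1)) ≠ p.succ := fun h => hr (Fin.succ_injective _ h)
      simp only [torusElt]
      rw [Matrix.diagonal_apply_ne _ this, lowTerm_zero]
    · simp
  have h2 : diagTerm N ((torusElt m : isoAlg N) : Amb N).2 = (m 0 * Complex.I) • cartanOp N := by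
    rw [diagTerm_eq]
    simp [torusElt, qi_imI, qi_imJ, qi_imK]
  rw [spinRep_explicit, h1, h2, cartanOp, weightOp, weightOp, Fintype.sum_option,
    Fintype.sum_option, Fintype.sum_prod_type, Fintype.sum_prod_type]
  simp only [Fin.sum_univ_two, torusWeight, diagWeight, smul_add, smul_sub, Finset.smul_sum,
    Finset.sum_add_distrib, Finset.sum_sub_distrib, smul_smul]
  push_cast
  simp only [mul_neg, neg_smul, mul_add, mul_sub, add_smul, sub_smul, Finset.sum_add_distrib,
    Finset.sum_sub_distrib, Finset.sum_neg_distrib, mul_one]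
  simp only [mul_comm Complex.I, mul_assoc, neg_add]
  module

/-- The element of the maximal torus of `H` with parameters `m`. -/
noncomputable def torusH (m : Fin (N + 1) → ℤ) : H N :=
  diagH fun i => unitQ (qcis (m i)) (normSq_qcis _)

lemma diagOp_mul_cliffMul (ha : 0 < a) (hb : 0 < b) (m : Fin (N + 1) → ℤ) (S : 𝔪 N) :
    diagOp (fun s => Complex.exp Complex.I ^ torusWeight m s) * cliffMul N a b S =
      cliffMul N a b (isotropy N (torusH m) S) *
        diagOp (fun s => Complex.exp Complex.I ^ torusWeight m s) := by
  have hv := diagOp_mul_vertCl (N := N)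
    (z := fun s => Complex.exp Complex.I ^ torusWeight m s) (θ₀ := m 0) (by
      simp only [torusWeight, ← Complex.exp_int_mul]; push_cast; rfl)
  have hh := fun p : Fin N => diagOp_mul_horCl
    (z := fun s => Complex.exp Complex.I ^ torusWeight m s) (p := p) (θ := m p.succ) (θ₀ := m 0)
    (by simp only [torusWeight, ← Complex.exp_int_mul]; push_cast; rfl)
    (by simp only [torusWeight, ← Complex.exp_int_mul]; push_cast; rfl)
  rw [cliffMul_eq ha hb, cliffMul_eq ha hb, isotropy_zero, torusH, toAmb_diagH, mul_add,
    mul_smul_comm, mul_smul_comm, Finset.mul_sum, hv, add_mul, smul_mul_assoc, smul_mul_assoc,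
    Finset.sum_mul]
  simp only [hh, isotropy_diagH_succ]
  rfl

end Torus

/-! ### Fixed spinors have weight zero. -/

section FixedSpinors

variable {N : ℕ} {a b : ℝ} {ha : 0 < a} {hb : 0 < b} {ρ : H N →* spinGroup (cliffForm N a b)}

lemma qj_smul_qi_conj (t : ℝ) : qj * (t • qi) * star qj = -(t • qi) := by
  rw [mul_smul_comm, smul_mul_assoc, qj_conj_qi, smul_neg]

/-- Conjugation by j in every coordinate is the Weyl group element -1. -/
lemma adElt_diagH_torusElt (m : Fin (N + 1) → ℤ) :
    adElt (diagH fun _ => unitQ qj normSq_qj) (torusElt m) = -torusElt m := by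
  refine Subtype.ext (Prod.ext ?_ (qj_smul_qi_conj _))
  change Matrix.diagonal _ * Matrix.diagonal _ * star (Matrix.diagonal _) = -Matrix.diagonal _
  rw [Matrix.star_eq_conjTranspose, Matrix.diagonal_conjTranspose, Matrix.diagonal_mul_diagonal,
    Matrix.diagonal_mul_diagonal, Matrix.diagonal_neg]
  congr 1
  funext i
  exact qj_smul_qi_conj _

variable (hρ : IsSpinLift ρ) {ψ : Spinor N} (hψ : ∀ h, liftOp ha hb ρ h ψ = ψ)
include hρ hψ

lemma spinRep_torusElt_eq_zero (m : Fin (N + 1) → ℤ) : spinRep ha hb (torusElt m) ψ = 0 := by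
  set R := diagOp (fun s : IdxY N => Complex.exp Complex.I ^ torusWeight m s) with hR
  -- R and the lift of `torusH m` move Clifford multiplication in the same way, so they differ by a
  -- scalar, and a fixed spinor is an eigenvector of R.
  obtain ⟨r, hr⟩ := eq_smul_one_of_commute_cliffMul ha hb
    (Q := R * liftOp ha hb ρ (torusH m)⁻¹) fun v => by
      rw [mul_assoc, liftOp_cliffMul hρ, ← mul_assoc, diagOp_mul_cliffMul ha hb,
        ← Module.End.mul_apply, ← map_mul, mul_inv_cancel, map_one, Module.End.one_apply,
        mul_assoc]
  have hRψ : R ψ = r • ψ := by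
    have := congrArg (fun f : Module.End ℂ (Spinor N) => f ψ) hr
    simpa [hψ] using this
  obtain ⟨k, hk⟩ := weightOp_of_diagOp (m := torusWeight m) (Complex.exp_ne_zero Complex.I)
    exp_I_zpow_injective (r := r)
  obtain ⟨μ, hμ⟩ : ∃ μ : ℂ, spinRep ha hb (torusElt m) ψ = μ • ψ := by
    refine ⟨Complex.I * k + Complex.I * m 0 * (N + 1), ?_⟩
    rw [spinRep_torusElt, LinearMap.add_apply, LinearMap.smul_apply, hk ψ hRψ]
    simp [add_smul, smul_smul]
  -- The torus element acts on ψ by a scalar μ. Conjugation by j fixes ψ and reverses the torus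
  -- element, so μ = -μ.
  have h1 := congrArg (fun f : Module.End ℂ (Spinor N) => f ψ)
    (liftOp_spinRep hρ (ha := ha) (hb := hb) (diagH fun _ => unitQ qj normSq_qj) (torusElt m))
  simp only [Module.End.mul_apply, adElt_diagH_torusElt, map_neg, LinearMap.neg_apply, hψ, hμ,
    map_smul] at h1
  rw [hμ]
  have h2 : (2 : ℂ) • μ • ψ = 0 := by rw [two_smul]; exact eq_neg_iff_add_eq_zero.1 h1
  exact (smul_eq_zero.1 h2).resolve_left two_ne_zero

end FixedSpinors

/-! ### Generating elements of 𝔥 from the torus by adjoint conjugation. -/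

section AdjointOrbits

variable {N : ℕ}

lemma adElt_diagH_diagElt {u x x' : ℍ[ℝ]} (hu : Quaternion.normSq u = 1) (hx : star x = -x)
    (hx' : star x' = -x') (h : u * x * star u = x') :
    adElt (diagH fun _ => unitQ u hu) (diagElt N x hx) = diagElt N x' hx' := by
  refine Subtype.ext (Prod.ext ?_ h)
  change Matrix.diagonal (fun _ => u) * Matrix.single 0 0 x * star (Matrix.diagonal fun _ => u) =
    Matrix.single 0 0 x'
  rw [Matrix.star_eq_conjTranspose, Matrix.diagonal_conjTranspose]
  ext1 i j
  rw [Matrix.mul_diagonal, Matrix.diagonal_mul]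
  by_cases hi : 0 = i <;> by_cases hj : 0 = j <;> simp [Matrix.single_apply, hi, hj, ← h]

lemma adElt_diagH_lowElt (d : Fin (N + 1) → unitary ℍ[ℝ]) (r p : Fin N) (x : ℍ[ℝ]) :
    adElt (diagH d) (lowElt r p x) = lowElt r p (d r.succ * x * star (d p.succ : ℍ[ℝ])) := by
  refine Subtype.ext (Prod.ext ?_ ?_)
  · change Matrix.diagonal (fun i => (d i : ℍ[ℝ])) *
      (Matrix.single r.succ p.succ x - Matrix.single p.succ r.succ (star x)) *
      star (Matrix.diagonal fun i => (d i : ℍ[ℝ])) = Matrix.single r.succ p.succ _ -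
        Matrix.single p.succ r.succ (star _)
    have key : ∀ (i j : Fin (N + 1)) (w : ℍ[ℝ]), Matrix.diagonal (fun i => (d i : ℍ[ℝ])) *
        Matrix.single i j w * star (Matrix.diagonal fun i => (d i : ℍ[ℝ])) =
        Matrix.single i j (d i * w * star (d j : ℍ[ℝ])) := by
      intro i j w
      rw [Matrix.star_eq_conjTranspose, Matrix.diagonal_conjTranspose]
      ext1 k l
      rw [Matrix.mul_diagonal, Matrix.diagonal_mul]
      by_cases hi : i = k <;> by_cases hj : j = l <;> simp [hi, hj]
    rw [mul_sub, sub_mul, key, key]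
    congr 2
    simp [mul_assoc]
  · change (d 0 : ℍ[ℝ]) * 0 * star (d 0 : ℍ[ℝ]) = 0
    simp

lemma diagElt_eq_torusElt : diagElt N qi star_qi = torusElt (Pi.single 0 1) := by
  refine Subtype.ext (Prod.ext ?_ ?_)
  · change Matrix.single 0 0 qi = Matrix.diagonal _
    ext1 i j
    by_cases hi : i = 0
    · subst hi
      by_cases hj : j = 0
      · subst hj; simp
      · simp [Ne.symm hj]
    · by_cases hj : i = j
      · subst hj; simp [hi, Ne.symm hi]
      · simp [Ne.symm hi, hj]
  · change qi = ((Pi.single 0 1 : Fin (N + 1) → ℤ) 0 : ℝ) • qi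
    simp

lemma coe_torusElt_succ (p : Fin N) :
    ((torusElt (Pi.single p.succ 1) : isoAlg N) : Amb N) = (Matrix.single p.succ p.succ qi, 0) := by
  refine Prod.ext ?_ ?_
  · change Matrix.diagonal _ = Matrix.single _ _ _
    ext1 i j
    by_cases hi : i = p.succ
    · subst hi
      by_cases hj : j = p.succ
      · subst hj; simp
      · simp [Ne.symm hj]
    · by_cases hj : i = j
      · subst hj; simp [hi, Ne.symm hi]
      · simp [Ne.symm hi, hj]
  · change ((Pi.single p.succ 1 : Fin (N + 1) → ℤ) 0 : ℝ) • qi = 0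
    simp [(Fin.succ_ne_zero p).symm]

lemma lowElt_self_one (p : Fin N) : lowElt p p 1 = 0 := by
  refine Subtype.ext (Prod.ext ?_ rfl)
  change Matrix.single p.succ p.succ 1 - Matrix.single p.succ p.succ (star 1) = 0
  simp

lemma lowElt_self_qi (p : Fin N) : lowElt p p qi = (2 : ℝ) • torusElt (Pi.single p.succ 1) := by
  refine Subtype.ext ?_
  change _ = (2 : ℝ) • ((torusElt (Pi.single p.succ 1) : isoAlg N) : Amb N)
  rw [coe_torusElt_succ]
  refine Prod.ext ?_ ?_
  · change Matrix.single p.succ p.succ qi - Matrix.single p.succ p.succ (star qi) =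
      (2 : ℝ) • Matrix.single p.succ p.succ qi
    rw [star_qi, ← Matrix.single_neg, sub_neg_eq_add, two_smul]
  · change (0 : ℍ[ℝ]) = (2 : ℝ) • 0
    simp

/-- The rotation by 45 degrees produces the off-diagonal elements from the torus. -/
lemma lowElt_qi_eq {p r : Fin N} (hpr : p ≠ r) : lowElt r p qi =
    (2 : ℝ) • adElt (rotH hpr (c := (Real.sqrt 2)⁻¹) (s := (Real.sqrt 2)⁻¹)
      (by rw [sq, inv_sqrt_two_sq]; norm_num)) (torusElt (Pi.single p.succ 1)) -
      torusElt (Pi.single p.succ 1) - torusElt (Pi.single r.succ 1) := by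
  have h1 : (p.succ : Fin (N + 1)) ≠ r.succ := fun h => hpr (Fin.succ_injective _ h)
  have h2 := h1.symm
  refine Subtype.ext ?_
  change _ = (2 : ℝ) • ((rotMat p r (Real.sqrt 2)⁻¹ (Real.sqrt 2)⁻¹, 1) *
    ((torusElt (Pi.single p.succ 1) : isoAlg N) : Amb N) *
    (star (rotMat p r (Real.sqrt 2)⁻¹ (Real.sqrt 2)⁻¹), star 1)) -
    ((torusElt (Pi.single p.succ 1) : isoAlg N) : Amb N) -
    ((torusElt (Pi.single r.succ 1) : isoAlg N) : Amb N)
  rw [coe_torusElt_succ, coe_torusElt_succ, star_rotMat]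
  have hs := inv_sqrt_two_sq
  generalize (Real.sqrt 2)⁻¹ = c at hs ⊢
  refine Prod.ext ?_ ?_
  · change Matrix.single r.succ p.succ qi - Matrix.single p.succ r.succ (star qi) =
      (2 : ℝ) • (rotMat p r c c * Matrix.single p.succ p.succ qi * rotMat p r c (-c)) -
        Matrix.single p.succ p.succ qi - Matrix.single r.succ r.succ qi
    have e1 : rotMat p r c c * Matrix.single p.succ p.succ qi =
        c • Matrix.single p.succ p.succ qi + c • Matrix.single r.succ p.succ qi := by
      simp only [rotMat, add_mul, sub_mul, smul_mul_assoc, one_mul, Matrix.single_mul_single_same,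
        Matrix.single_mul_single_of_ne _ _ _ _ h2, add_zero, sub_zero]
      module
    have e2 : ∀ t : Fin (N + 1), Matrix.single t p.succ qi * rotMat p r c (-c) =
        c • Matrix.single t p.succ qi + c • Matrix.single t r.succ qi := by
      intro t
      simp only [rotMat, mul_add, mul_sub, mul_smul_comm, mul_one, Matrix.single_mul_single_same,
        Matrix.single_mul_single_of_ne _ _ _ _ h1, add_zero, zero_sub]
      module
    rw [e1, add_mul, smul_mul_assoc, smul_mul_assoc, e2, e2, star_qi, ← Matrix.single_neg,
      sub_neg_eq_add]
    simp only [smul_add, smul_smul, hs]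
    module
  · change (0 : ℍ[ℝ]) = (2 : ℝ) • (1 * 0 * star 1) - 0 - 0
    simp

end AdjointOrbits

section FixedSpinors

variable {N : ℕ} {a b : ℝ} {ha : 0 < a} {hb : 0 < b} {ρ : H N →* spinGroup (cliffForm N a b)}
  (hρ : IsSpinLift ρ) {ψ : Spinor N} (hψ : ∀ h, liftOp ha hb ρ h ψ = ψ)
include hρ hψ

lemma spinRep_lowElt_qi_eq_zero (r p : Fin N) : spinRep ha hb (lowElt r p qi) ψ = 0 := by
  have hT := spinRep_torusElt_eq_zero hρ hψ
  by_cases h : p = r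
  · subst h
    rw [lowElt_self_qi, map_smul, LinearMap.smul_apply, hT, smul_zero]
  · rw [lowElt_qi_eq h, map_sub, map_sub, map_smul, LinearMap.sub_apply, LinearMap.sub_apply,
      LinearMap.smul_apply, hT, hT, spinRep_adElt_eq_zero hρ hψ (hT _)]
    simp

/-- For r ≠ p, multiplying the coordinate r by -i turns the entry i into 1. -/
lemma spinRep_lowElt_one_eq_zero (r p : Fin N) : spinRep ha hb (lowElt r p 1) ψ = 0 := by
  by_cases h : r = p
  · subst h
    rw [lowElt_self_one, map_zero, LinearMap.zero_apply]
  · have h1 := spinRep_adElt_eq_zero hρ hψ (spinRep_lowElt_qi_eq_zero hρ hψ r p)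
      (diagH fun i => if i = r.succ then unitQ (star qi)
        (by rw [Quaternion.normSq_star, normSq_qi]) else 1)
    rw [adElt_diagH_lowElt] at h1
    have h2 : star qi * qi = 1 := by rw [Quaternion.star_mul_self, normSq_qi]; simp
    simpa [unitQ, h2, Ne.symm h] using h1

/-- A spinor fixed by the group `H` is annihilated by its Lie algebra. -/
lemma mem_annihilated_top_of_fixed :
    ψ ∈ annihilated ha hb (⊤ : Submodule ℂ (ℂ ⊗[ℝ] isoAlg N)) := by
  have hi : spinRep ha hb (diagElt N qi star_qi) ψ = 0 := by
    rw [diagElt_eq_torusElt]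
    exact spinRep_torusElt_eq_zero hρ hψ _
  -- The elements for j and k are Ad(H)-conjugate to the torus element for i.
  have hj : spinRep ha hb (diagElt N qj star_qj) ψ = 0 := by
    rw [← adElt_diagH_diagElt normSq_qij star_qi star_qj qij_conj]
    exact spinRep_adElt_eq_zero hρ hψ hi _
  have hk : spinRep ha hb (diagElt N qk star_qk) ψ = 0 := by
    rw [← adElt_diagH_diagElt normSq_qik star_qi star_qk qik_conj]
    exact spinRep_adElt_eq_zero hρ hψ hi _
  rw [spinRep_of_mem_spDiag ha hb (diagElt_mem_spDiag _)] at hi hj hk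
  have hlow : ψ ∈ annihilated ha hb (spLowerC N) := by
    rw [annihilated_spLowerC]
    exact (isSpInvariant_of_lowElt ha hb (spinRep_lowElt_one_eq_zero hρ hψ)
      (spinRep_lowElt_qi_eq_zero hρ hψ)).mem_omegaSpan
  refine (mem_annihilated_top_iff ha hb).2 ⟨by rwa [annihilated_spLowerC] at hlow, ?_⟩
  change diagTerm N qi ψ = 0 at hi
  change diagTerm N qj ψ = 0 at hj
  change diagTerm N qk ψ = 0 at hk
  rw [diagTerm_eq] at hi hj hk
  simp only [qi_imI, qi_imJ, qi_imK, qj_imI, qj_imJ, qj_imK, qk_imI, qk_imJ, qk_imK,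
    Complex.ofReal_zero, Complex.ofReal_one, zero_mul, one_mul, zero_smul, one_smul, zero_add,
    add_zero, LinearMap.smul_apply, LinearMap.add_apply, LinearMap.sub_apply, smul_eq_zero,
    Complex.I_ne_zero, false_or] at hi hj hk
  rw [sub_eq_zero] at hj
  rw [hj, ← two_smul ℂ, smul_eq_zero] at hk
  have := hk.resolve_left two_ne_zero
  exact ⟨hi, hj.trans this, this⟩

end FixedSpinors

/-! ### Commutators of unit quaternions and the group H for n = 2. -/

section Commutator

/-- The normalized bisector of 1 and u squares to u, since (1 + u)² = |1 + u|² u; for u = -1 take i.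
-/
lemma exists_sq_eq {u : ℍ[ℝ]} (hu : Quaternion.normSq u = 1) :
    ∃ w : ℍ[ℝ], Quaternion.normSq w = 1 ∧ w * w = u := by
  by_cases h : 1 + u = 0
  · refine ⟨qi, normSq_qi, ?_⟩
    rw [eq_neg_of_add_eq_zero_right h]
    ext <;> simp [qi_re, qi_imI, qi_imJ, qi_imK]
  · have hu' := hu
    rw [Quaternion.normSq_def'] at hu'
    have h1 : (1 + u) * (1 + u) = Quaternion.normSq (1 + u) • u := by
      rw [Quaternion.normSq_def']
      ext
      · simp
        linear_combination (-1 - u.re) * hu'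
      · simp
        linear_combination -u.imI * hu'
      · simp
        linear_combination -u.imJ * hu'
      · simp
        linear_combination -u.imK * hu'
    have h2 : 0 < Quaternion.normSq (1 + u) :=
      lt_of_le_of_ne Quaternion.normSq_nonneg (Ne.symm (Quaternion.normSq_ne_zero.2 h))
    set t := Quaternion.normSq (1 + u) with ht
    have h3 : (Real.sqrt t)⁻¹ * (Real.sqrt t)⁻¹ * t = 1 := by
      rw [← mul_inv, Real.mul_self_sqrt h2.le, inv_mul_cancel₀ h2.ne']
    refine ⟨(Real.sqrt t)⁻¹ • (1 + u), ?_, ?_⟩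
    · rw [Quaternion.normSq_smul, sq, ← ht, h3]
    · rw [smul_mul_smul_comm, h1, smul_smul, h3, one_smul]

/-- An imaginary unit orthogonal to Im w anticommutes with it, hence conjugates w to its conjugate.
-/
lemma exists_mul_eq_star_mul (w : ℍ[ℝ]) :
    ∃ v : ℍ[ℝ], Quaternion.normSq v = 1 ∧ v * star w = w * v := by
  have key : ∀ v : ℍ[ℝ], v.re = 0 → v.imI * w.imI + v.imJ * w.imJ + v.imK * w.imK = 0 →
      v * star w = w * v := by
    intro v h1 h2
    ext <;> simp [h1]
    · linear_combination 2 * h2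
    all_goals ring
  by_cases h : w.imI = 0 ∧ w.imJ = 0
  · exact ⟨qi, normSq_qi, key qi qi_re (by simp [qi_imI, qi_imJ, qi_imK, h.1])⟩
  · set v : ℍ[ℝ] := ⟨0, -w.imJ, w.imI, 0⟩ with hv
    have hr : v.re = 0 := rfl
    have hi : v.imI = -w.imJ := rfl
    have hj : v.imJ = w.imI := rfl
    have hk : v.imK = 0 := rfl
    have hv0 : v ≠ 0 := by
      intro h0
      refine h ⟨?_, ?_⟩
      · rw [← hj, h0]; rfl
      · rw [← neg_neg w.imJ, ← hi, h0]; simp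
    have h2 : 0 < Quaternion.normSq v :=
      lt_of_le_of_ne Quaternion.normSq_nonneg (Ne.symm (Quaternion.normSq_ne_zero.2 hv0))
    refine ⟨(Real.sqrt (Quaternion.normSq v))⁻¹ • v, ?_, ?_⟩
    · rw [Quaternion.normSq_smul, sq, ← mul_inv, Real.mul_self_sqrt h2.le, inv_mul_cancel₀ h2.ne']
    · rw [smul_mul_assoc, mul_smul_comm, key v hr (by rw [hi, hj, hk]; ring)]

lemma normSq_coe_unitary (u : unitary ℍ[ℝ]) : Quaternion.normSq (u : ℍ[ℝ]) = 1 := by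
  have : (u : ℍ[ℝ]) * star (u : ℍ[ℝ]) = 1 := Unitary.coe_mul_star_self u
  rw [Quaternion.self_mul_star] at this
  have := congrArg (fun q : ℍ[ℝ] => q.re) this
  simpa using this

/-- Every unit quaternion is a commutator. -/
lemma exists_commutator (u : unitary ℍ[ℝ]) : ∃ s t : unitary ℍ[ℝ], u * (t * s) = s * t := by
  obtain ⟨w, hw, hwu⟩ := exists_sq_eq (normSq_coe_unitary u)
  obtain ⟨v, hv, hvw⟩ := exists_mul_eq_star_mul w
  -- Since u = w² and v w̄ v⁻¹ = w, the unit u is the commutator of v and w̄.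
  refine ⟨unitQ v hv, unitQ (star w) (by rw [Quaternion.normSq_star, hw]), Subtype.ext ?_⟩
  change (u : ℍ[ℝ]) * (star w * v) = v * star w
  rw [hvw, ← hwu, mul_assoc, ← mul_assoc w (star w), Quaternion.self_mul_star, hw]
  simp

/-- For n = 2 the blocks of H are 1 × 1, so H is a product of two copies of Sp(1). -/
lemma exists_eq_diagH (h : H 1) : ∃ d, h = diagH d := by
  have hcol := fixesAxis_of_mem h.2
  have hrow := fixesAxis_star_toAmb h
  have h10 : ((h : G 1).1 : HMat 1) 1 0 = 0 := hcol 1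
  have h01 : ((h : G 1).1 : HMat 1) 0 1 = 0 := star_eq_zero.1 (hrow 1)
  have h00 : ((h : G 1).1 : HMat 1) 0 0 = (h : G 1).2 := hcol 0
  have hA : ((h : G 1).1 : HMat 1) = Matrix.diagonal fun i => ((h : G 1).1 : HMat 1) i i := by
    ext1 i j
    fin_cases i <;> fin_cases j
    · simp
    · simpa using h01
    · simpa using h10
    · simp
  have hd : ∀ i, ((h : G 1).1 : HMat 1) i i ∈ unitary ℍ[ℝ] := by
    intro i
    have h1 : star ((h : G 1).1 : HMat 1) * ((h : G 1).1 : HMat 1) = 1 :=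
      Unitary.coe_star_mul_self (h : G 1).1
    have h2 : ((h : G 1).1 : HMat 1) * star ((h : G 1).1 : HMat 1) = 1 :=
      Unitary.coe_mul_star_self (h : G 1).1
    rw [hA, Matrix.star_eq_conjTranspose, Matrix.diagonal_conjTranspose,
      Matrix.diagonal_mul_diagonal, ← Matrix.diagonal_one] at h1 h2
    exact Unitary.mem_iff.2 ⟨congrFun (Matrix.diagonal_injective h1) i,
      congrFun (Matrix.diagonal_injective h2) i⟩
  refine ⟨fun i => ⟨_, hd i⟩, Subtype.ext (toAmb_injective ?_)⟩
  rw [toAmb_diagH]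
  exact Prod.ext hA h00.symm

end Commutator

/-! ### Invariant sections of the spinor bundle. -/

section Sections

variable {N : ℕ} {a b : ℝ} {ha : 0 < a} {hb : 0 < b} {ρ : H N →* spinGroup (cliffForm N a b)}

/-- Invariance under translations makes φ constant, and equivariance then says that its value is
fixed by H. -/
lemma mem_invSpinors_iff {φ : G N → Spinor N} : φ ∈ invSpinors ha hb ρ ↔
    ∃ ψ, (∀ h, liftOp ha hb ρ h ψ = ψ) ∧ φ = fun _ => ψ := by
  constructor
  · rintro ⟨h1, h2⟩
    have hc : ∀ g, φ g = φ 1 := fun g => by simpa using h2 g⁻¹ 1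
    refine ⟨φ 1, fun h => ?_, funext hc⟩
    have := h1 1 h⁻¹
    rw [hc, inv_inv] at this
    exact this.symm
  · rintro ⟨ψ, hψ, rfl⟩
    exact ⟨fun g h => (hψ h⁻¹).symm, fun g g' => rfl⟩

lemma adElt_adElt_inv (h : H N) (T : isoAlg N) : adElt h (adElt h⁻¹ T) = T := by
  refine Subtype.ext ?_
  change toAmb (h : G N) * (star (toAmb (h : G N)) * T * star (star (toAmb (h : G N)))) *
    star (toAmb (h : G N)) = T
  have h1 := toAmb_mul_star (h : G N)
  set x := toAmb (h : G N)
  rw [star_star, mul_assoc, mul_assoc, mul_assoc, h1, mul_one, ← mul_assoc, h1, one_mul]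

lemma liftOp_mem_annihilated (hρ : IsSpinLift ρ) {ψ : Spinor N}
    (hψ : ψ ∈ annihilated ha hb (⊤ : Submodule ℂ (ℂ ⊗[ℝ] isoAlg N))) (h : H N) :
    liftOp ha hb ρ h ψ ∈ annihilated ha hb (⊤ : Submodule ℂ (ℂ ⊗[ℝ] isoAlg N)) := by
  rw [mem_annihilated_top] at hψ ⊢
  intro T
  rw [← adElt_adElt_inv h T, ← Module.End.mul_apply, ← liftOp_spinRep hρ, Module.End.mul_apply,
    hψ, map_zero]

/-- H preserves the line of 𝔥_ℂ-invariants and acts on it by nonzero scalars; these commute, so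
commutators act trivially, and every element of H is one. No continuity of ρ enters. -/
lemma liftOp_smallVec {ρ : H 1 →* spinGroup (cliffForm 1 a b)} (hρ : IsSpinLift ρ) (h : H 1) :
    liftOp ha hb ρ h (smallVec 1 0) = smallVec 1 0 := by
  set ψ := smallVec 1 0 with hψ
  have hne : ψ ≠ 0 := smallVec_zero_ne_zero one_pos
  have hχ : ∀ g : H 1, ∃ r : ℂ, r ≠ 0 ∧ liftOp ha hb ρ g ψ = r • ψ := by
    intro g
    have h1 : liftOp ha hb ρ g ψ ∈ annihilated ha hb (⊤ : Submodule ℂ (ℂ ⊗[ℝ] isoAlg 1)) :=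
      liftOp_mem_annihilated hρ (by
        rw [annihilated_top_eq_span]; exact Submodule.mem_span_singleton_self _) g
    rw [annihilated_top_eq_span, Submodule.mem_span_singleton] at h1
    obtain ⟨r, hr⟩ := h1
    refine ⟨r, ?_, hr.symm⟩
    rintro rfl
    apply hne
    rw [zero_smul] at hr
    have h2 : liftOp ha hb ρ (g⁻¹ * g) ψ = ψ := by
      rw [inv_mul_cancel, liftOp_one, Module.End.one_apply]
    rw [← h2, liftOp_mul, Module.End.mul_apply, ← hr, map_zero]
  obtain ⟨d, rfl⟩ := exists_eq_diagH h
  -- Commutators are found separately in the two diagonal entries.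
  choose s t hst using fun i => exists_commutator (d i)
  have hd : diagH d * (diagH t * diagH s) = diagH s * diagH t := by
    rw [← diagH_mul, ← diagH_mul, ← diagH_mul]
    congr 1
    exact funext hst
  obtain ⟨x, hx, hx'⟩ := hχ (diagH s)
  obtain ⟨z, hz, hz'⟩ := hχ (diagH t)
  have h1 := congrArg (fun g => liftOp ha hb ρ g ψ) hd
  simp only [liftOp_mul, Module.End.mul_apply, hx', hz', map_smul] at h1
  rw [smul_comm z x] at h1
  exact smul_right_injective _ hz (smul_right_injective _ hx h1)

lemma invSpinors_eq_span {ρ : H 1 →* spinGroup (cliffForm 1 a b)} (hρ : IsSpinLift ρ) :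
    invSpinors ha hb ρ = Submodule.span ℂ {fun _ => smallVec 1 0} := by
  ext φ
  rw [mem_invSpinors_iff, Submodule.mem_span_singleton]
  constructor
  · rintro ⟨ψ, hψ, rfl⟩
    have := mem_annihilated_top_of_fixed hρ hψ
    rw [annihilated_top_eq_span, Submodule.mem_span_singleton] at this
    obtain ⟨r, rfl⟩ := this
    exact ⟨r, rfl⟩
  · rintro ⟨r, rfl⟩
    exact ⟨r • smallVec 1 0, fun h => by rw [map_smul, liftOp_smallVec hρ], rfl⟩

lemma invSpinors_eq_bot (hρ : IsSpinLift ρ) (hN : N ≠ 1) : invSpinors ha hb ρ = ⊥ := by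
  refine (Submodule.eq_bot_iff _).2 fun φ hφ => ?_
  obtain ⟨ψ, hψ, rfl⟩ := mem_invSpinors_iff.1 hφ
  have := mem_annihilated_top_of_fixed hρ hψ
  rw [annihilated_top_eq_bot ha hb hN, Submodule.mem_bot] at this
  rw [this]
  rfl

end Sections
end SpSphere

open SpSphere in
theorem mainTheorem5 (n N : ℕ) (hn : n = N + 1) :
    -- the invariant metrics are exactly the metrics `g_{a,b}` with `a, b > 0`
    (∀ B : LinearMap.BilinForm ℝ (𝔪 N),
      IsInvariantMetric B ↔ ∃ a b : ℝ, 0 < a ∧ 0 < b ∧ B = metric N a b) ∧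
    ∀ (a b : ℝ) (ha : 0 < a) (hb : 0 < b),
      -- `e₁, …, e_{4n-1}` is a `g_{a,b}`-orthonormal basis of `𝔪`
      ((∀ k l, metric N a b (frame N a b k) (frame N a b l) = if k = l then 1 else 0) ∧
        Submodule.span ℝ (Set.range (frame N a b)) = ⊤) ∧
      -- `Σ` is a representation of `𝔥_ℂ`
      (∀ S T : ℂ ⊗[ℝ] isoAlg N, spinRepC ha hb ⁅S, T⁆ =
        spinRepC ha hb S * spinRepC ha hb T - spinRepC ha hb T * spinRepC ha hb S) ∧
      -- the `𝔰𝔭_ℂ(2n-2)`-invariants are, over `𝔰𝔭_ℂ(2)`, the direct sum of irreducible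
      -- representations of dimensions `n + 1` and `n - 1` (the latter being zero if `n = 1`)
      (∃ U V : Submodule ℂ (Spinor N), U ⊓ V = ⊥ ∧ U ⊔ V = annihilated ha hb (spLowerC N) ∧
        IsIrred ha hb (spDiagC N) U ∧ Module.finrank ℂ U = n + 1 ∧
        (n ≠ 1 → IsIrred ha hb (spDiagC N) V) ∧ Module.finrank ℂ V = n - 1) ∧
      -- the `𝔥_ℂ`-invariant elements of `Σ`
      (n ≠ 2 → annihilated ha hb (⊤ : Submodule ℂ (ℂ ⊗[ℝ] isoAlg N)) = ⊥) ∧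
      (n = 2 → Module.finrank ℂ (annihilated ha hb (⊤ : Submodule ℂ (ℂ ⊗[ℝ] isoAlg N))) = 1 ∧
        annihilated ha hb (⊤ : Submodule ℂ (ℂ ⊗[ℝ] isoAlg N)) ≤
          Submodule.span ℂ {y₁ N, ω N}) ∧
      -- the invariant sections of the homogeneous spinor bundle
      (∀ ρ : H N →* spinGroup (cliffForm N a b), IsSpinLift ρ →
        (n ≠ 2 → invSpinors ha hb ρ = ⊥) ∧
        (n = 2 → Module.finrank ℂ (invSpinors ha hb ρ) = 1 ∧
          ∀ φ ∈ invSpinors ha hb ρ, ∀ g : G N, φ g ∈ Submodule.span ℂ {y₁ N, ω N})) := by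
  subst hn
  refine ⟨isInvariantMetric_iff, fun a b ha hb => ⟨⟨frame_orthonormal ha hb, span_frame ha hb⟩,
    spinRepC_lie ha hb, ⟨bigSummand N, smallSummand N, bigSummand_inf_smallSummand, ?_,
      isIrred_bigSummand ha hb, finrank_bigSummand, fun h => isIrred_smallSummand ha hb (by omega),
      finrank_smallSummand⟩, fun h => annihilated_top_eq_bot ha hb (by omega), fun h => ?_,
    fun ρ hρ => ⟨fun h => invSpinors_eq_bot hρ (by omega), fun h => ?_⟩⟩⟩
  · rw [bigSummand_sup_smallSummand, annihilated_spLowerC]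
  · obtain rfl : N = 1 := by omega
    rw [annihilated_top_eq_span]
    exact ⟨finrank_span_singleton (smallVec_zero_ne_zero one_pos),
      (Submodule.span_singleton_le_iff_mem _ _).2 smallVec_mem_span⟩
  · obtain rfl : N = 1 := by omega
    rw [invSpinors_eq_span hρ]
    refine ⟨finrank_span_singleton fun h0 => smallVec_zero_ne_zero one_pos (congrFun h0 1), ?_⟩
    intro φ hφ g
    obtain ⟨r, rfl⟩ := Submodule.mem_span_singleton.1 hφ
    exact Submodule.smul_mem _ r smallVec_mem_span
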